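/- A knot projection $P$ is a generic immersed closed curve on $S^2$: a smooth immersion $P\colon S^1\to S^2$ whose only singularities are finitely many transverse double points. Its chord diagram $CD_P$ is the circle $S^1$ with one chord for each double point, joining its two preimages. Two chords cross if their endpoints alternate on the circle; otherwise they are parallel. Let $\otimes(P)$ be the number of pairs of crossing chords of $CD_P$; $\mathrm{tr}(P)$ the number of triples of pairwise crossing chords; $\mathrm{H}(P)$ the number of triples consisting of two parallel chords and a third chord crossing both; and $\mathrm{III}(P)$ the number of quadruples consisting of three pairwise parallel chords and a fourth chord crossing all three. The Reidemeister moves are the following local replacements inside a disk of $S^2$, up to reparametrization of the curves and homeomorphism of the sphere. RI: a simple strand is replaced by a strand with one self-crossing. RII: two disjoint simple strands are replaced by two simple strands crossing in exactly two points; it is weak if the curve runs along the two sides of the resulting bigon in the same direction, so that the two new chords cross, and strong if it runs in opposite directions, so that they are parallel. RIII: for three simple strands crossing pairwise exactly once, the triangle they form is replaced by the opposite one, so that the order of the two crossings on each strand is reversed; it is strong if the curve runs through the three sides of the triangle coherently (in the same rotational sense), and weak otherwise. **Theorem.** Let $P'$ be obtained from $P$ by a single move, where RI and RII are taken in the direction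 that creates double points, and let $\Delta x = x(P')-x(P)$. Then: 1. RI: $\Delta\otimes=\Delta\mathrm{tr}=\Delta\mathrm{H}=\Delta\mathrm{III}=0$. 2. Strong RII: $\Delta\otimes=4m$ for some integer $m\ge 0$; $\Delta\mathrm{tr}$, $\Delta\mathrm{H}$ and $\Delta\mathrm{III}$ are even. 3. Weak RII: $\Delta\otimes=4m-1$ for some integer $m\ge 1$; $\Delta\mathrm{tr}$ is odd; $\Delta\mathrm{H}$ and $\Delta\mathrm{III}$ are even. 4. Strong RIII: $\Delta\otimes\in\{3,-3\}$; $\Delta\mathrm{tr}$ is odd; $\Delta\mathrm{H}$ and $\Delta\mathrm{III}$ are even. 5. Weak RIII: $\Delta\otimes\in\{1,-1\}$; $\Delta\mathrm{tr}$ is odd; $\Delta\mathrm{H}$ and $\Delta\mathrm{III}$ are even. -/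

import Mathlib

open scoped ContDiff

/-- The unit sphere `S²` in Euclidean 3-space. -/
abbrev Sphere2 : Type := Metric.sphere (0 : EuclideanSpace ℝ (Fin 3)) 1

/-- A knot projection: a generic immersed spherical curve, i.e. a smooth immersion of the circle
`ℝ / ℤ` into the sphere whose only singularities are finitely many transverse double points. -/
structure KnotProjection where
  toFun : UnitAddCircle → Sphere2
  smooth : ContDiff ℝ ∞ (fun t : ℝ => (toFun (t : UnitAddCircle) : EuclideanSpace ℝ (Fin 3)))
  immersion : ∀ t : ℝ,
    deriv (fun t : ℝ => (toFun (t : UnitAddCircle) : EuclideanSpace ℝ (Fin 3))) t ≠ 0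
  transverse : ∀ s t : ℝ, (s : UnitAddCircle) ≠ (t : UnitAddCircle) →
    toFun (s : UnitAddCircle) = toFun (t : UnitAddCircle) →
    LinearIndependent ℝ
      ![deriv (fun t : ℝ => (toFun (t : UnitAddCircle) : EuclideanSpace ℝ (Fin 3))) s,
        deriv (fun t : ℝ => (toFun (t : UnitAddCircle) : EuclideanSpace ℝ (Fin 3))) t]
  no_triple : ∀ r s t : UnitAddCircle, r ≠ s → s ≠ t → r ≠ t →
    ¬ (toFun r = toFun s ∧ toFun s = toFun t)
  finite_double : {p : UnitAddCircle × UnitAddCircle | p.1 ≠ p.2 ∧ toFun p.1 = toFun p.2}.Finite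

namespace KnotProjection

instance : CoeFun KnotProjection (fun _ => UnitAddCircle → Sphere2) := ⟨toFun⟩

/-! ### Chord diagrams and the numbers of sub-chord diagrams -/

/-- The chord diagram `CD_P`: the unordered pairs of distinct points of the circle that are the two
preimages of a double point. -/
def chords (P : KnotProjection) : Set (Sym2 UnitAddCircle) :=
  {e | ∃ s t : UnitAddCircle, s ≠ t ∧ P s = P t ∧ e = s(s, t)}

end KnotProjection

/-- Two chords of the circle cross if their endpoints alternate in the cyclic order. -/
def ChordsCross (e f : Sym2 UnitAddCircle) : Prop :=
  ∃ a b c d : UnitAddCircle, e = s(a, b) ∧ f = s(c, d) ∧ sbtw a c b ∧ sbtw b d a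

/-- A cross chord `⊗`: two crossing chords. -/
def IsCrossChord (S : Set (Sym2 UnitAddCircle)) : Prop :=
  ∃ e f, e ≠ f ∧ S = {e, f} ∧ ChordsCross e f

/-- A triple chord: three pairwise crossing chords. -/
def IsTripleChord (S : Set (Sym2 UnitAddCircle)) : Prop :=
  ∃ e f g, e ≠ f ∧ e ≠ g ∧ f ≠ g ∧ S = {e, f, g} ∧
    ChordsCross e f ∧ ChordsCross e g ∧ ChordsCross f g

/-- An H-chord: two parallel (non-crossing) chords `f, g` and a sticking chord `e` that crosses
both of them. -/
def IsHChord (S : Set (Sym2 UnitAddCircle)) : Prop :=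
  ∃ e f g, e ≠ f ∧ e ≠ g ∧ f ≠ g ∧ S = {e, f, g} ∧
    ChordsCross e f ∧ ChordsCross e g ∧ ¬ ChordsCross f g

/-- A III-chord: three pairwise parallel (non-crossing) chords `f, g, h` and a chord `e` that
crosses all three of them. -/
def IsIIIChord (S : Set (Sym2 UnitAddCircle)) : Prop :=
  ∃ e f g h, e ≠ f ∧ e ≠ g ∧ e ≠ h ∧ f ≠ g ∧ f ≠ h ∧ g ≠ h ∧ S = {e, f, g, h} ∧
    ChordsCross e f ∧ ChordsCross e g ∧ ChordsCross e h ∧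
    ¬ ChordsCross f g ∧ ¬ ChordsCross f h ∧ ¬ ChordsCross g h

namespace KnotProjection

/-- The number of sub-chord diagrams of a given type in the chord diagram of `P`. -/
noncomputable def countSub (P : KnotProjection) (type : Set (Sym2 UnitAddCircle) → Prop) : ℕ :=
  {S : Set (Sym2 UnitAddCircle) | S ⊆ P.chords ∧ type S}.ncard

/-- `⊗(P)`, as an integer. -/
noncomputable def crossNumber (P : KnotProjection) : ℤ := P.countSub IsCrossChord

/-- `tr(P)`, as an integer. -/
noncomputable def tripleNumber (P : KnotProjection) : ℤ := P.countSub IsTripleChord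

/-- `H(P)` (the number of H-chords), as an integer. -/
noncomputable def hNumber (P : KnotProjection) : ℤ := P.countSub IsHChord

/-- `III(P)` (the number of III-chords), as an integer. -/
noncomputable def iiiNumber (P : KnotProjection) : ℤ := P.countSub IsIIIChord

/-! ### Reidemeister moves -/

/-- Two knot projections are equivalent if they agree up to a homeomorphism of the sphere and a
reparametrization of the circle (in particular if they are ambient isotopic). -/
def Equivalent (P Q : KnotProjection) : Prop :=
  ∃ (Φ : Sphere2 ≃ₜ Sphere2) (h : UnitAddCircle ≃ₜ UnitAddCircle), ∀ s, Q (h s) = Φ (P s)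

/-- `P` and `P'` differ by a local replacement inside a closed disk `disk` of the sphere. The part
of either curve in the disk consists of `n` proper strands, the images of the disjoint parameter
intervals `[a i, b i]`, and outside the open intervals `(a i, b i)` the two curves agree. All
parameters are taken in one period `[base, base + 1)`. -/
structure LocalReplacement (n : ℕ) (P P' : KnotProjection) where
  disk : Set Sphere2
  isDisk : Nonempty (Metric.closedBall (0 : EuclideanSpace ℝ (Fin 2)) 1 ≃ₜ disk)
  base : ℝ
  a : Fin n → ℝ
  b : Fin n → ℝ
  base_lt : ∀ i, base < a i
  a_lt_b : ∀ i, a i < b i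
  lt_base : ∀ i, b i < base + 1
  disjoint : ∀ i j, i ≠ j → Disjoint (Set.Icc (a i) (b i)) (Set.Icc (a j) (b j))
  mem_disk : ∀ t ∈ Set.Ico base (base + 1),
    P (t : UnitAddCircle) ∈ disk ↔ ∃ i, t ∈ Set.Icc (a i) (b i)
  mem_disk' : ∀ t ∈ Set.Ico base (base + 1),
    P' (t : UnitAddCircle) ∈ disk ↔ ∃ i, t ∈ Set.Icc (a i) (b i)
  mem_interior : ∀ t ∈ Set.Ico base (base + 1),
    P (t : UnitAddCircle) ∈ interior disk ↔ ∃ i, t ∈ Set.Ioo (a i) (b i)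
  mem_interior' : ∀ t ∈ Set.Ico base (base + 1),
    P' (t : UnitAddCircle) ∈ interior disk ↔ ∃ i, t ∈ Set.Ioo (a i) (b i)
  agree : ∀ t ∈ Set.Ico base (base + 1), (∀ i, t ∉ Set.Ioo (a i) (b i)) →
    P (t : UnitAddCircle) = P' (t : UnitAddCircle)

/-- The crossings of the curve `Q` at parameters in `T ⊆ ℝ`, as unordered pairs of parameters. -/
def crossingsIn (Q : KnotProjection) (T : Set ℝ) : Set (Sym2 ℝ) :=
  {e | ∃ s ∈ T, ∃ t ∈ T, s ≠ t ∧ Q (s : UnitAddCircle) = Q (t : UnitAddCircle) ∧ e = s(s, t)}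

namespace LocalReplacement

variable {n : ℕ} {P P' : KnotProjection}

/-- The parameters of the `i`-th strand. -/
def strand (L : LocalReplacement n P P') (i : Fin n) : Set ℝ := Set.Icc (L.a i) (L.b i)

/-- The parameters of all the strands. -/
def strands (L : LocalReplacement n P P') : Set ℝ := ⋃ i, L.strand i

end LocalReplacement

/-- Literal RI, creating a double point: a simple strand of the disk is replaced by a strand with
exactly one self-crossing. -/
def LocalRI (P P' : KnotProjection) : Prop :=
  ∃ L : LocalReplacement 1 P P', P.crossingsIn L.strands = ∅ ∧
    ∃ s t : ℝ, P'.crossingsIn L.strands = {s(s, t)}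

/-- Literal RII, creating two double points: two disjoint simple strands of the disk are replaced
by two simple strands that cross exactly twice, at the parameters `s₁ < s₂` of the first and
`t₁, t₂` of the second strand. `order t₁ t₂` specifies in which order the second strand meets the
two double points. -/
def LocalRII (order : ℝ → ℝ → Prop) (P P' : KnotProjection) : Prop :=
  ∃ L : LocalReplacement 2 P P', P.crossingsIn L.strands = ∅ ∧
    ∃ s₁ ∈ L.strand 0, ∃ s₂ ∈ L.strand 0, ∃ t₁ ∈ L.strand 1, ∃ t₂ ∈ L.strand 1,
      P'.crossingsIn L.strands = {s(s₁, t₁), s(s₂, t₂)} ∧ s₁ < s₂ ∧ order t₁ t₂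

/-- Literal RIII: before and after, the strands `0, 1, 2` of the disk are simple and every two of
them cross exactly once; strand `i` meets strand `i + 1` (mod 3) at parameter `x i` and strand
`i - 1` at parameter `y i` before, and at `x' i` and `y' i` after the move, and the order of the two
crossings is reversed on each strand (a strand is moved across the opposite vertex of the triangle).
The triangle is coherent if walking along the curve one passes its three sides in the same
rotational sense. `coherent` specifies whether it is. -/
def LocalRIII (coherent : Prop) (P P' : KnotProjection) : Prop :=
  ∃ (L : LocalReplacement 3 P P') (x y x' y' : Fin 3 → ℝ),
    (∀ i, x i ∈ L.strand i ∧ y i ∈ L.strand i ∧ x' i ∈ L.strand i ∧ y' i ∈ L.strand i) ∧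
    P.crossingsIn L.strands = Set.range (fun i => s(x i, y (i + 1))) ∧
    P'.crossingsIn L.strands = Set.range (fun i => s(x' i, y' (i + 1))) ∧
    (∀ i, (x i < y i ∧ y' i < x' i) ∨ (y i < x i ∧ x' i < y' i)) ∧
    (((∀ i, x i < y i) ∨ (∀ i, y i < x i)) ↔ coherent)

/-- A local move, up to equivalence of knot projections. -/
def UpToEquivalence (move : KnotProjection → KnotProjection → Prop) (P P' : KnotProjection) :
    Prop :=
  ∃ Q Q', Equivalent P Q ∧ Equivalent P' Q' ∧ move Q Q'

/-- `P'` is obtained from `P` by one RI that creates a double point. -/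
def RI : KnotProjection → KnotProjection → Prop := UpToEquivalence LocalRI

/-- `P'` is obtained from `P` by one strong RII that creates two double points: the branches are
connected so that the curve runs along the two sides of the bigon in opposite directions. -/
def StrongRII : KnotProjection → KnotProjection → Prop :=
  UpToEquivalence (LocalRII (fun t₁ t₂ => t₂ < t₁))

/-- `P'` is obtained from `P` by one weak RII that creates two double points: the branches are
connected so that the curve runs along the two sides of the bigon in the same direction. -/
def WeakRII : KnotProjection → KnotProjection → Prop :=
  UpToEquivalence (LocalRII (fun t₁ t₂ => t₁ < t₂))

/-- `P'` is obtained from `P` by one strong RIII: the branches are connected so that the three sides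
of the triangle are coherently oriented. -/
def StrongRIII : KnotProjection → KnotProjection → Prop := UpToEquivalence (LocalRIII True)

/-- `P'` is obtained from `P` by one weak RIII: the branches are connected so that the three sides
of the triangle are not coherently oriented. -/
def WeakRIII : KnotProjection → KnotProjection → Prop := UpToEquivalence (LocalRIII False)

end KnotProjection

/-!
The proof combines two parity conditions on chord diagrams of spherical curves, which go back to
Gauss, with a count of the sub-chord diagrams that contain some of the chords created by a move.

**Parity conditions.** Every chord crosses an even number of chords
(`KnotProjection.even_ncard_crossing`), and two parallel chords are crossed by an even number of
common chords (`KnotProjection.even_ncard_common`). A double point cuts the curve into two loops,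
and two parallel chords cut out two disjoint loops; in either case the chords in question are
counted by the points in which the two loops meet, and two loops in general position meet an even
number of times. To prove this, the curve is projected stereographically into the plane from a
point that it misses (`KnotProjection.exists_planar_model`). For a loop `α` and a point `z` off
it, the parity of the winding number is the sign by which a continuous square root of `α - z`
changes along the loop (`EvenAbout`). This parity is constant along segments that miss the loop,
since there `(α - z) / (α - w)` stays in the slit plane, and it flips at a transverse crossing
(`evenAbout_flip_of_crossing`), since for points `z`, `w` close to the crossing on both sides of
`α` this ratio passes the negative half-line exactly once. As the second loop returns to its
beginning, it crosses the first loop an even number of times (`even_ncard_of_closed`). When the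
two loops have a double point in common, the beginning and the end of the second loop lie in a
half-disk at this point that the first loop avoids (`even_ncard_of_corner`).

**Counting.** Crossing of chords is a topological notion, so the four numbers do not change under
equivalence (`KnotProjection.Equivalent.numbers_eq`). In a local replacement the chords outside
the disk stay, and how a chord of the disk crosses them depends only on the two strands that it
joins (`KnotProjection.LocalReplacement.chordsCross_outer_iff`).

* First move: the new chord crosses no other chord.
* Second move: the two new chords cross the same `k` old chords. So the cross chords increase by
  `2 k`, or `2 k + 1` if the new chords cross, and by the first parity condition `k` is even in
  the former and odd in the latter case. In the other numbers, the sets with exactly one new chord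
  come in pairs. The sets with both are `k` triple chords if the new chords cross; if they are
  parallel, they are `k` H-chords and as many III-chords as there are crossings between the `k`
  chords and the remaining ones, an even number by a handshake argument
  (`KnotProjection.numbers_of_twins`).
* Third move: every chord outside the disk crosses none or two of the three chords of the
  triangle, and the move exchanges crossing and parallel among these three. All three behave alike
  if and only if the triangle is coherent. The parity conditions before and after the move
  determine the parity of the number of chords that cross a given pair of the three, and thereby
  the parity of all differences (`KnotProjection.numbers_of_triangle_flip`).
-/

section

open Set Filter Topology Complex

/-! ### Winding parity by continuous square roots -/

/-- The curve `α`, closed on `[a, b]`, winds an even number of times around the point `z`: the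
function `α - z` has a continuous square root on `[a, b]` that takes the same value at both ends.
It is meant for points `z` off the curve, where it does not depend on the square root. -/
def EvenAbout (α : ℝ → ℂ) (a b : ℝ) (z : ℂ) : Prop :=
  ∃ q : ℝ → ℂ, ContinuousOn q (Icc a b) ∧ (∀ s ∈ Icc a b, q s ^ 2 = α s - z) ∧ q a = q b

lemma exists_continuousOn_sq_eq {f : ℝ → ℂ} {a b : ℝ} (hab : a ≤ b) (hf : ContinuousOn f (Icc a b))
    (h0 : ∀ s ∈ Icc a b, f s ≠ 0) :
    ∃ q : ℝ → ℂ, ContinuousOn q (Icc a b) ∧ ∀ s ∈ Icc a b, q s ^ 2 = f s := by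
  have hsc : IsSimplyConnected (univ : Set ℝ) := by
    have := (convex_univ (𝕜 := ℝ) (E := ℝ)).contractibleSpace univ_nonempty
    exact SimplyConnectedSpace.ofContractible _
  have hc : Continuous (fun s => f (projIcc a b hab s)) :=
    hf.comp_continuous (continuous_subtype_val.comp continuous_projIcc)
      (fun s => (projIcc a b hab s).2)
  obtain ⟨q, hq, hq2⟩ := Complex.exists_continuousOn_pow_eq hsc isOpen_univ hc.continuousOn
    (by rintro ⟨s, -, hs⟩; exact h0 _ (projIcc a b hab s).2 hs) two_ne_zero
  refine ⟨q, hq.mono (subset_univ _), fun s hs => ?_⟩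
  rw [hq2, projIcc_of_mem hab hs]

/-- Any continuous square root decides the parity, since two of them differ by a constant sign. -/
lemma evenAbout_iff_of_sq_eq {α q : ℝ → ℂ} {a b : ℝ} {z : ℂ} (hab : a ≤ b)
    (hq : ContinuousOn q (Icc a b)) (hq2 : ∀ s ∈ Icc a b, q s ^ 2 = α s - z)
    (h0 : ∀ s ∈ Icc a b, α s ≠ z) : EvenAbout α a b z ↔ q a = q b := by
  refine ⟨?_, fun h => ⟨q, hq, hq2, h⟩⟩
  rintro ⟨r, hr, hr2, hrab⟩
  have key := isPreconnected_Icc.eq_or_eq_neg_of_sq_eq hq hr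
    (fun s hs => by simp only [Pi.pow_apply, hq2 s hs, hr2 s hs])
    (fun {s} hs h => h0 s hs (by
      have := hr2 s hs
      rw [h] at this
      simpa [sub_eq_zero, eq_comm] using this))
  have ha : a ∈ Icc a b := left_mem_Icc.2 hab
  have hb : b ∈ Icc a b := right_mem_Icc.2 hab
  rcases key with h | h
  · rw [h ha, h hb, hrab]
  · rw [h ha, h hb]; simp [hrab]

lemma sqrt_exp_log {w : ℂ} (hw : w ≠ 0) : exp (log w / 2) ^ 2 = w := by
  rw [← exp_nat_mul]; push_cast
  rw [mul_div_cancel₀ _ two_ne_zero, exp_log hw]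

/-- The ratio `(x - z) / (x - w)` is a nonpositive real number only if `x` lies on the segment
from `z` to `w`. -/
lemma mem_slitPlane_of_notMem_segment {x z w : ℂ} (h : x ∉ segment ℝ z w) :
    (x - z) / (x - w) ∈ slitPlane := by
  by_contra hn
  apply h
  have hxw : x ≠ w := fun e => h (e ▸ right_mem_segment ℝ z w)
  rw [mem_slitPlane_iff] at hn
  push Not at hn
  set R := (x - z) / (x - w) with hR
  have hRr : R = (R.re : ℂ) := by apply Complex.ext <;> simp [hn.2]
  have h1 : x - z = R.re * (x - w) := by
    rw [← hRr, hR, div_mul_cancel₀ _ (sub_ne_zero.2 hxw)]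
  have hpos : (0:ℝ) < 1 - R.re := by linarith [hn.1]
  refine ⟨1 / (1 - R.re), -R.re / (1 - R.re), by positivity,
    div_nonneg (by linarith [hn.1]) hpos.le, ?_, ?_⟩
  · field_simp
    ring
  · have hc : ((1 - R.re : ℝ) : ℂ) ≠ 0 := by exact_mod_cast hpos.ne'
    simp only [real_smul]
    push_cast at hc ⊢
    field_simp
    linear_combination -h1

/-- If the curve misses the segment from `z` to `w`, then `(α - z) / (α - w)` stays in the slit
plane, where the principal square root is continuous; multiplying by it turns a square root of
`α - w` into one of `α - z`. -/
lemma EvenAbout.of_segment {α : ℝ → ℂ} {a b : ℝ} {z w : ℂ} (hα : ContinuousOn α (Icc a b))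
    (hab' : α a = α b) (h : ∀ s ∈ Icc a b, α s ∉ segment ℝ z w) (hw : EvenAbout α a b w) :
    EvenAbout α a b z := by
  obtain ⟨q, hq, hq2, hqab⟩ := hw
  have hs : ∀ s ∈ Icc a b, (α s - z) / (α s - w) ∈ slitPlane := fun s hs =>
    mem_slitPlane_of_notMem_segment (h s hs)
  have hne : ∀ s ∈ Icc a b, α s - w ≠ 0 := fun s hs e => h s hs (by
    rw [sub_eq_zero.1 e]; exact right_mem_segment ℝ z w)
  refine ⟨fun s => q s * exp (log ((α s - z) / (α s - w)) / 2), ?_, ?_, ?_⟩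
  · refine hq.mul (ContinuousOn.cexp ((ContinuousOn.clog ?_ hs).div_const 2))
    exact (hα.sub continuousOn_const).div (hα.sub continuousOn_const) hne
  · intro s hs'
    rw [mul_pow, hq2 s hs', sqrt_exp_log (slitPlane_ne_zero (hs s hs'))]
    field_simp [hne s hs']
  · simp only [hqab, hab']

lemma evenAbout_iff_of_convex {α : ℝ → ℂ} {a b : ℝ} {z w : ℂ} {K : Set ℂ}
    (hα : ContinuousOn α (Icc a b)) (hab' : α a = α b) (hK : Convex ℝ K)
    (h : ∀ s ∈ Icc a b, α s ∉ K) (hz : z ∈ K) (hw : w ∈ K) :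
    EvenAbout α a b z ↔ EvenAbout α a b w :=
  ⟨EvenAbout.of_segment hα hab' fun s hs hm => h s hs (hK.segment_subset hw hz hm),
    EvenAbout.of_segment hα hab' fun s hs hm => h s hs (hK.segment_subset hz hw hm)⟩

lemma im_exp_log_half_pos {w : ℂ} (hw : 0 < w.im) : 0 < (exp (log w / 2)).im := by
  rw [exp_im]
  refine mul_pos (Real.exp_pos _) ?_
  have h2 : (log w / 2).im = arg w / 2 := by simp [log_im]
  rw [h2]
  have h0 : 0 < arg w := by
    rcases (arg_nonneg_iff.2 hw.le).lt_or_eq with h | h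
    · exact h
    · exact absurd ((arg_eq_zero_iff.1 h.symm).2) hw.ne'
  exact Real.sin_pos_of_pos_of_lt_pi (by linarith) (by linarith [arg_le_pi w, Real.pi_pos])

lemma im_exp_log_half_neg {w : ℂ} (hw : w.im < 0) : (exp (log w / 2)).im < 0 := by
  rw [exp_im]
  refine mul_neg_of_pos_of_neg (Real.exp_pos _) ?_
  have h2 : (log w / 2).im = arg w / 2 := by simp [log_im]
  rw [h2]
  have h0 : arg w < 0 := arg_neg_iff.2 hw
  exact Real.sin_neg_of_neg_of_neg_pi_lt (by linarith) (by linarith [neg_pi_lt_arg w, Real.pi_pos])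

lemma re_ne_zero_of_sq_mem_slitPlane {k : ℂ} (h : k ^ 2 ∈ slitPlane) : k.re ≠ 0 := by
  intro h0
  rw [mem_slitPlane_iff] at h
  simp [pow_two, h0] at h
  nlinarith [mul_self_nonneg k.im]

/-- A continuous square root `k` of a closed curve `R` changes sign along the curve if `R` meets the
closed negative half-line only once, at the parameter `c`, and crosses it there upwards. Off `c` the
real part of `k` does not vanish; near `c` the function `k` is `±I` times the principal square root
of `-R`, so its real part changes sign. -/
lemma sqrt_jump {k R : ℝ → ℂ} {a b c : ℝ} (hac : a < c) (hcb : c < b)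
    (hk : ContinuousOn k (Icc a b)) (hR : ContinuousOn R (Icc a b))
    (hkR : ∀ s ∈ Icc a b, k s ^ 2 = R s)
    (hslit : ∀ s ∈ Icc a b, s ≠ c → R s ∈ slitPlane) (hc : (R c).re < 0)
    (hl : ∀ᶠ s in 𝓝[<] c, (R s).im < 0) (hr : ∀ᶠ s in 𝓝[>] c, 0 < (R s).im)
    (hab : R a = R b) : k b = - k a := by
  have hre : ∀ s ∈ Icc a b, s ≠ c → (k s).re ≠ 0 := fun s hs hsc =>
    re_ne_zero_of_sq_mem_slitPlane (hkR s hs ▸ hslit s hs hsc)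
  have hcI : Icc a b ∈ 𝓝 c := Icc_mem_nhds hac hcb
  have hRe : ∀ᶠ s in 𝓝 c, (R s).re < 0 :=
    (continuous_re.continuousAt.comp (hR.continuousAt hcI)).eventually_lt continuousAt_const hc
  obtain ⟨d, hd, hdI⟩ := Metric.eventually_nhds_iff_ball.1 (hRe.and hcI)
  -- parameters `l < c < r` so close to `c` that `R` has negative real part on `[l, r]`
  obtain ⟨l, hl1, hl2⟩ := ((hl.and (Ioo_mem_nhdsLT (show c - d < c by linarith))).and
    self_mem_nhdsWithin).exists.imp fun _ h => h
  obtain ⟨r, hr1, hr2⟩ := ((hr.and (Ioo_mem_nhdsGT (show c < c + d by linarith))).and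
    self_mem_nhdsWithin).exists.imp fun _ h => h
  have hball : Icc l r ⊆ Metric.ball c d := fun s hs => by
    rw [Real.ball_eq_Ioo]; exact ⟨by linarith [hl1.2.1, hs.1], by linarith [hr1.2.2, hs.2]⟩
  have hsub : Icc l r ⊆ Icc a b := fun s hs => (hdI s (hball hs)).2
  have hlr : l ≤ r := by linarith
  have hlI := hsub (left_mem_Icc.2 hlr)
  have hrI := hsub (right_mem_Icc.2 hlr)
  have hnegslit : ∀ s ∈ Icc l r, - R s ∈ slitPlane := fun s hs => by
    rw [mem_slitPlane_iff]; left
    have := (hdI s (hball hs)).1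
    simp only [neg_re]; linarith
  have key := isPreconnected_Icc.eq_or_eq_neg_of_sq_eq (hk.mono hsub)
    (g := fun s => I * exp (log (- R s) / 2))
    (continuousOn_const.mul (((((hR.mono hsub).neg).clog hnegslit).div_const 2).cexp))
    (fun s hs => by
      simp only [Pi.pow_apply]
      rw [mul_pow, sqrt_exp_log (slitPlane_ne_zero (hnegslit s hs)), hkR s (hsub hs), I_sq]; ring)
    (fun {s} hs h => by simp [I_ne_zero, exp_ne_zero] at h)
  have hsgn : (k l).re * (k r).re < 0 := by
    have h1 : 0 < (exp (log (- R l) / 2)).im := im_exp_log_half_pos (by simpa using hl1.1)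
    have h2 : (exp (log (- R r) / 2)).im < 0 := im_exp_log_half_neg (by simpa using hr1.1)
    have hl' := left_mem_Icc.2 hlr
    have hr' := right_mem_Icc.2 hlr
    rcases key with h | h
    · rw [h hl', h hr']
      simp only [mul_re, I_re, I_im, zero_mul, one_mul, zero_sub]
      nlinarith
    · rw [h hl', h hr']
      simp only [mul_re, I_re, I_im, zero_mul, one_mul, zero_sub, Pi.neg_apply, neg_re, neg_neg]
      nlinarith
  -- away from `c` the real part of `k` keeps its sign
  have sgn : ∀ x y : ℝ, x ≤ y → Icc x y ⊆ Icc a b → c ∉ Icc x y → 0 < (k x).re * (k y).re := by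
    intro x y hxy hs hcn
    by_contra hneg
    have hcont : ContinuousOn (fun s => (k s).re) (Icc x y) :=
      continuous_re.comp_continuousOn (hk.mono hs)
    have h0 : (0:ℝ) ∈ (fun s => (k s).re) '' Icc x y := by
      have hx := left_mem_Icc.2 hxy
      have hy := right_mem_Icc.2 hxy
      rcases le_total (k x).re 0 with h | h <;> rcases le_total (k y).re 0 with h' | h'
      · exfalso
        have h1 := hre x (hs hx) (fun e => hcn (e ▸ hx))
        have h2 := hre y (hs hy) (fun e => hcn (e ▸ hy))
        exact hneg (mul_pos_of_neg_of_neg (lt_of_le_of_ne h h1) (lt_of_le_of_ne h' h2))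
      · exact isPreconnected_Icc.intermediate_value hx hy hcont ⟨h, h'⟩
      · exact isPreconnected_Icc.intermediate_value hy hx hcont ⟨h', h⟩
      · exfalso
        have h1 := hre x (hs hx) (fun e => hcn (e ▸ hx))
        have h2 := hre y (hs hy) (fun e => hcn (e ▸ hy))
        exact hneg (mul_pos (lt_of_le_of_ne h h1.symm) (lt_of_le_of_ne h' h2.symm))
    obtain ⟨s, hs1, hs2⟩ := h0
    exact hre s (hs hs1) (fun e => hcn (e ▸ hs1)) hs2
  have h1 := sgn a l hlI.1 (Icc_subset_Icc_right hlI.2) (fun h => by linarith [h.2])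
  have h2 := sgn r b hrI.2 (Icc_subset_Icc_left hrI.1) (fun h => by linarith [h.1])
  have h3 : (k a).re * (k b).re < 0 := by
    by_contra h
    push Not at h
    have h4 := mul_nonneg (mul_pos h1 h2).le h
    have h5 : 0 ≤ ((k l).re * (k r).re) * ((k a).re * (k b).re) ^ 2 := by nlinarith
    have h6 : 0 < ((k a).re * (k b).re) ^ 2 := by
      have ha : (k a).re ≠ 0 := left_ne_zero_of_mul h1.ne'
      have hb : (k b).re ≠ 0 := right_ne_zero_of_mul h2.ne'
      positivity
    nlinarith
  have h4 : k a ^ 2 = k b ^ 2 := by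
    rw [hkR a (left_mem_Icc.2 (by linarith)), hkR b (right_mem_Icc.2 (by linarith)), hab]
  rcases sq_eq_sq_iff_eq_or_eq_neg.1 h4 with h | h
  · rw [h] at h3; nlinarith [mul_self_nonneg (k b).re]
  · rw [h, neg_neg]

/-- The parities around `z` and `w` differ if the ratio `(α - z) / (α - w)` crosses the negative
half-line exactly once. -/
lemma evenAbout_iff_not_of_ratio {α : ℝ → ℂ} {a b c : ℝ} {z w : ℂ} (hac : a < c) (hcb : c < b)
    (hα : ContinuousOn α (Icc a b)) (hab' : α a = α b)
    (hslit : ∀ s ∈ Icc a b, s ≠ c → (α s - z) / (α s - w) ∈ slitPlane)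
    (hc : ((α c - z) / (α c - w)).re < 0)
    (hl : ∀ᶠ s in 𝓝[<] c, ((α s - z) / (α s - w)).im < 0)
    (hr : ∀ᶠ s in 𝓝[>] c, 0 < ((α s - z) / (α s - w)).im) :
    EvenAbout α a b z ↔ ¬ EvenAbout α a b w := by
  have hab : a ≤ b := by linarith
  have hne : ∀ s ∈ Icc a b, (α s - z) / (α s - w) ≠ 0 := by
    intro s hs
    by_cases h : s = c
    · intro h0; rw [← h, h0] at hc; simp at hc
    · exact slitPlane_ne_zero (hslit s hs h)
  have hz : ∀ s ∈ Icc a b, α s ≠ z := fun s hs h => hne s hs (by simp [h])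
  have hw : ∀ s ∈ Icc a b, α s ≠ w := fun s hs h => hne s hs (by simp [h])
  obtain ⟨q, hq, hq2⟩ := exists_continuousOn_sq_eq (f := fun s => α s - z) hab
    (hα.sub continuousOn_const) (fun s hs => sub_ne_zero.2 (hz s hs))
  obtain ⟨p, hp, hp2⟩ := exists_continuousOn_sq_eq (f := fun s => α s - w) hab
    (hα.sub continuousOn_const) (fun s hs => sub_ne_zero.2 (hw s hs))
  rw [evenAbout_iff_of_sq_eq hab hq hq2 hz, evenAbout_iff_of_sq_eq hab hp hp2 hw]
  have hp0 : ∀ s ∈ Icc a b, p s ≠ 0 := fun s hs h => hw s hs (by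
    have := hp2 s hs; rw [h] at this; simpa [sub_eq_zero, eq_comm] using this)
  have hq0 : ∀ s ∈ Icc a b, q s ≠ 0 := fun s hs h => hz s hs (by
    have := hq2 s hs; rw [h] at this; simpa [sub_eq_zero, eq_comm] using this)
  have key := sqrt_jump (R := fun s => (α s - z) / (α s - w)) hac hcb (hq.div hp hp0)
    ((hα.sub continuousOn_const).div (hα.sub continuousOn_const)
      (fun s hs => sub_ne_zero.2 (hw s hs)))
    (fun s hs => by simp only [Pi.div_apply, div_pow, hq2 s hs, hp2 s hs]) hslit hc hl hr
    (by simp only [hab'])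
  have ha : a ∈ Icc a b := left_mem_Icc.2 hab
  have hb : b ∈ Icc a b := right_mem_Icc.2 hab
  have hpp : p a = p b ∨ p a = - p b :=
    sq_eq_sq_iff_eq_or_eq_neg.1 (by rw [hp2 a ha, hp2 b hb, hab'])
  simp only [Pi.div_apply] at key
  rcases hpp with h | h
  · rw [h] at key
    simp only [h, not_true, iff_false]
    intro h'
    rw [h'] at key
    have h3 : q b / p b ≠ 0 := div_ne_zero (hq0 b hb) (hp0 b hb)
    exact h3 (self_eq_neg.1 key)
  · rw [h, div_neg, neg_neg, div_left_inj' (hp0 b hb)] at key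
    rw [h]
    exact iff_of_true key.symm (fun h' => hp0 b hb (self_eq_neg.1 h'.symm))

/-! ### Change of the winding parity at a transverse crossing -/

lemma exists_lt_norm_sub_of_ne {α : ℝ → ℂ} {S : Set ℝ} {p : ℂ} (hS : IsCompact S)
    (hα : ContinuousOn α S) (hp : ∀ s ∈ S, α s ≠ p) :
    ∃ ρ > 0, ∀ s ∈ S, ρ < ‖α s - p‖ := by
  rcases S.eq_empty_or_nonempty with rfl | hne
  · exact ⟨1, one_pos, by simp⟩
  obtain ⟨s, hs, hmin⟩ := hS.exists_isMinOn hne (hα.sub (continuousOn_const (c := p))).norm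
  refine ⟨‖α s - p‖ / 2, half_pos (norm_pos_iff.2 (sub_ne_zero.2 (hp s hs))), fun t ht => ?_⟩
  have h1 := hmin ht
  have h2 := norm_pos_iff.2 (sub_ne_zero.2 (hp s hs))
  simp only [Pi.sub_apply, mem_ofPred_eq] at h1
  linarith

lemma HasDerivAt.eventually_slope_mem {α : ℝ → ℂ} {v : ℂ} {s : ℝ} (h : HasDerivAt α v s)
    {U : Set ℂ} (hU : IsOpen U) (hv : v ∈ U) :
    ∀ᶠ t in 𝓝[≠] s, ((t - s)⁻¹ : ℝ) • (α t - α s) ∈ U := by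
  filter_upwards [(hasDerivAt_iff_tendsto_slope.1 h).eventually (hU.mem_nhds hv)] with t ht
  rwa [slope_def_module] at ht

/-- Near a point where its derivative is positive on the functional `ℓ`, a curve is on the positive
side of the point after it and on the negative side before it. -/
lemma HasDerivAt.eventually_functional_sign {α : ℝ → ℂ} {v : ℂ} {s : ℝ} (h : HasDerivAt α v s)
    (ℓ : ℂ →L[ℝ] ℝ) (hv : 0 < ℓ v) :
    (∀ᶠ t in 𝓝[>] s, 0 < ℓ (α t - α s)) ∧ ∀ᶠ t in 𝓝[<] s, ℓ (α t - α s) < 0 := by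
  have h1 := h.eventually_slope_mem (isOpen_lt continuous_const ℓ.continuous) hv
  constructor
  · filter_upwards [h1.filter_mono (nhdsWithin_mono _ fun x hx => ne_of_gt hx),
      self_mem_nhdsWithin] with t ht hts
    have hts' : 0 < t - s := sub_pos.2 hts
    simp only [map_smul, smul_eq_mul] at ht
    exact (mul_pos_iff_of_pos_left (inv_pos.2 hts')).1 ht
  · filter_upwards [h1.filter_mono (nhdsWithin_mono _ fun x hx => ne_of_lt hx),
      self_mem_nhdsWithin] with t ht hts
    have hts' : 0 < s - t := sub_pos.2 hts
    simp only [map_smul, smul_eq_mul] at ht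
    by_contra hc
    push Not at hc
    have : (t - s)⁻¹ ≤ 0 := inv_nonpos.2 (by linarith)
    nlinarith

/-- The parities at two points on the normal line of a curve, at a small equal distance to the two
sides of a simple point with nonzero velocity, differ. -/
lemma evenAbout_flip_across_tangent {α : ℝ → ℂ} {a b c : ℝ} {v : ℂ} (hac : a < c) (hcb : c < b)
    (hα : ContinuousOn α (Icc a b)) (hab' : α a = α b) (hv : v ≠ 0) (hd : HasDerivAt α v c)
    (hinj : ∀ s ∈ Icc a b, α s = α c → s = c) :
    ∃ ρ > 0, ∀ ε : ℝ, 0 < ε → ε < ρ →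
      (EvenAbout α a b (α c - ε * I * v) ↔ ¬ EvenAbout α a b (α c + ε * I * v)) := by
  -- move the point to the origin and the tangent to the real axis
  set w : ℝ → ℂ := fun s => (α s - α c) / v with hw
  have hwd : HasDerivAt w 1 c := by
    have := (hd.sub_const (α c)).div_const v
    rwa [div_self hv] at this
  have hwc : w c = 0 := by simp [hw]
  have hsgn := hwd.eventually_functional_sign reCLM (by simp)
  simp only [hwc, sub_zero, reCLM_apply] at hsgn
  obtain ⟨δ, hδ, hδ'⟩ : ∃ δ > 0, ∀ s, |s - c| < δ → s ≠ c → (w s).re ≠ 0 := by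
    have h1 : ∀ᶠ t in 𝓝[≠] c, (w t).re ≠ 0 := by
      rw [← Iio_union_Ioi, nhdsWithin_union, eventually_sup]
      exact ⟨hsgn.2.mono fun _ h => h.ne, hsgn.1.mono fun _ h => h.ne'⟩
    rw [eventually_nhdsWithin_iff, Metric.eventually_nhds_iff] at h1
    obtain ⟨δ, hδ, h⟩ := h1
    exact ⟨δ, hδ, fun s hs hne => h (by rwa [Real.dist_eq]) hne⟩
  have hwcont : ContinuousOn w (Icc a b) := (hα.sub continuousOn_const).div_const v
  obtain ⟨ρ, hρ, hfar⟩ := exists_lt_norm_sub_of_ne (S := Icc a b \ Metric.ball c δ) (p := 0)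
    (isCompact_Icc.diff Metric.isOpen_ball) (hwcont.mono sdiff_subset) (by
      rintro s ⟨hs, hsb⟩ h0
      have : α s = α c := by
        simpa [hw, div_eq_zero_iff, hv, sub_eq_zero] using h0
      exact hsb (by rw [hinj s hs this]; exact Metric.mem_ball_self hδ))
  refine ⟨ρ, hρ, fun ε hε hερ => ?_⟩
  have hratio : ∀ s, (α s - (α c - ε * I * v)) / (α s - (α c + ε * I * v))
      = (w s - -(ε * I)) / (w s - ε * I) := by
    intro s
    have : α s = α c + w s * v := by simp only [hw]; field_simp; ring
    rw [this]
    rw [show α c + w s * v - (α c - ε * I * v) = (w s - -(ε * I)) * v by ring,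
      show α c + w s * v - (α c + ε * I * v) = (w s - (ε * I)) * v by ring,
      mul_div_mul_right _ _ hv]
  have him : ∀ s, (w s).re ≠ 0 →
      ((w s - -(ε * I)) / (w s - ε * I)).im = 2 * ε * (w s).re / normSq (w s - ε * I) := by
    intro s hs
    rw [div_im]
    simp
    ring
  have hnsq : ∀ s, (w s).re ≠ 0 → 0 < normSq (w s - ε * I) := by
    intro s hs
    rw [normSq_pos]
    intro h
    apply hs
    have := congrArg re h
    simpa using this
  apply evenAbout_iff_not_of_ratio hac hcb hα hab'
  · intro s hs hsc
    rw [hratio]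
    apply mem_slitPlane_of_notMem_segment
    intro hseg
    obtain ⟨x, y, hx, hy, hxy, he⟩ := hseg
    have hwe : w s = ((y - x) * ε : ℝ) * I := by
      rw [← he]; simp; ring
    by_cases hsb : |s - c| < δ
    · apply hδ' s hsb hsc
      rw [hwe]; simp
    · have := hfar s ⟨hs, by rwa [Metric.mem_ball, Real.dist_eq]⟩
      rw [sub_zero, hwe, norm_mul, norm_I, mul_one, norm_real, Real.norm_eq_abs, abs_mul,
        abs_of_pos hε] at this
      have h1 : |y - x| ≤ 1 := abs_le.2 ⟨by linarith, by linarith⟩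
      nlinarith
  · rw [hratio, hwc]
    have : (ε : ℂ) * I ≠ 0 := mul_ne_zero (by exact_mod_cast hε.ne') I_ne_zero
    rw [zero_sub, zero_sub, neg_neg, div_neg, div_self this]; simp
  · filter_upwards [hsgn.2] with s hs
    rw [hratio, him s hs.ne]
    exact div_neg_of_neg_of_pos (by nlinarith) (hnsq s hs.ne)
  · filter_upwards [hsgn.1] with s hs
    rw [hratio, him s hs.ne']
    exact div_pos (by positivity) (hnsq s hs.ne')

lemma cone_convex (η : ℝ) (hη : 0 ≤ η) : Convex ℝ {z : ℂ | η * |z.re| < z.im} := by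
  intro x hx y hy a b ha hb hab
  simp only [mem_ofPred_eq, add_re, add_im, real_smul, mul_re, mul_im, ofReal_re, ofReal_im,
    zero_mul, sub_zero, add_zero] at *
  have h1 := abs_add_le (a * x.re) (b * y.re)
  rw [abs_mul, abs_mul, abs_of_nonneg ha, abs_of_nonneg hb] at h1
  have h2 := mul_le_mul_of_nonneg_left h1 hη
  rcases ha.eq_or_lt with rfl | ha'
  · have : b = 1 := by linarith
    subst this; simp at *; linarith
  · have := mul_lt_mul_of_pos_left hx ha'
    have := mul_le_mul_of_nonneg_left hy.le hb
    nlinarith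

/-- The parity around `β x` flips where `β` crosses `α` transversally from right to left. Near the
crossing, `α` lies in a flat double cone around its tangent that is avoided by `β`, so that the two
branches of `β` stay in the two sectors of the complement, each of which contains a point of the
normal line. -/
lemma evenAbout_flip_of_crossing_of_pos {α β : ℝ → ℂ} {a b c t : ℝ} {v u : ℂ} (hac : a < c)
    (hcb : c < b) (hα : ContinuousOn α (Icc a b)) (hab' : α a = α b)
    (hdα : HasDerivAt α v c) (hdβ : HasDerivAt β u t) (hpt : β t = α c)
    (hinj : ∀ s ∈ Icc a b, α s = α c → s = c) (hv : v ≠ 0) (huv : 0 < (u / v).im) :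
    ∃ e : Prop, (∀ᶠ x in 𝓝[>] t, EvenAbout α a b (β x) ↔ e) ∧
      ∀ᶠ x in 𝓝[<] t, EvenAbout α a b (β x) ↔ ¬ e := by
  set μ := u / v with hμ
  set η : ℝ := μ.im / (|μ.re| + 1) with hη
  have hden : 0 < |μ.re| + 1 := by positivity
  have hηpos : 0 < η := div_pos huv hden
  have hημ : η * |μ.re| < μ.im := by
    rw [hη, div_mul_eq_mul_div, div_lt_iff₀ hden]; nlinarith
  obtain ⟨ρ₁, hρ₁, hflip⟩ := evenAbout_flip_across_tangent hac hcb hα hab' hv hdα hinj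
  -- the curve stays in the flat double cone near `c`
  set w : ℝ → ℂ := fun s => (α s - α c) / v with hw
  set y : ℝ → ℂ := fun x => (β x - α c) / v with hy
  have hwd : HasDerivAt w 1 c := by
    have := (hdα.sub_const (α c)).div_const v
    rwa [div_self hv] at this
  have hyd : HasDerivAt y μ t := (hdβ.sub_const (α c)).div_const v
  have hwc : w c = 0 := by simp [hw]
  have hyt : y t = 0 := by simp [hy, hpt]
  have hcone := hwd.eventually_slope_mem (U := {z : ℂ | |z.im| < η * |z.re|})
    (isOpen_lt (continuous_abs.comp continuous_im)
      (continuous_const.mul (continuous_abs.comp continuous_re))) (by simpa using hηpos)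
  rw [eventually_nhdsWithin_iff, Metric.eventually_nhds_iff] at hcone
  obtain ⟨δ, hδ, hnear⟩ := hcone
  have hwcont : ContinuousOn w (Icc a b) := (hα.sub continuousOn_const).div_const v
  obtain ⟨ρ₂, hρ₂, hfar⟩ := exists_lt_norm_sub_of_ne (S := Icc a b \ Metric.ball c δ) (p := 0)
    (isCompact_Icc.diff Metric.isOpen_ball) (hwcont.mono sdiff_subset) (by
      rintro s ⟨hs, hsb⟩ h0
      have : α s = α c := by
        simpa [hw, div_eq_zero_iff, hv, sub_eq_zero] using h0
      exact hsb (by rw [hinj s hs this]; exact Metric.mem_ball_self hδ))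
  have hflat : ∀ s ∈ Icc a b, ‖w s‖ < ρ₂ → |(w s).im| ≤ η * |(w s).re| := by
    intro s hs hlt
    by_cases hsc : s = c
    · simp [hsc, hwc]
    have hsb : s ∈ Metric.ball c δ := by
      by_contra hsb
      have := hfar s ⟨hs, hsb⟩
      rw [sub_zero] at this
      linarith
    have h1 := hnear hsb hsc
    rw [hwc, sub_zero] at h1
    simp only [mem_ofPred_eq, real_smul, mul_re, mul_im, ofReal_re, ofReal_im, zero_mul,
      sub_zero, add_zero, abs_mul] at h1
    have h2 : 0 < |(s - c)⁻¹| := abs_pos.2 (inv_ne_zero (sub_ne_zero.2 hsc))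
    have h3 : |(s - c)⁻¹| * |(w s).im| < |(s - c)⁻¹| * (η * |(w s).re|) := by linarith
    exact (lt_of_mul_lt_mul_left h3 h2.le).le
  set K : Set ℂ := {z : ℂ | η * |z.re| < z.im} ∩ Metric.ball 0 ρ₂ with hK
  have hKc : Convex ℝ K := (cone_convex η hηpos.le).inter (convex_ball _ _)
  -- the two sectors of the complement
  have hmap : ∀ σ : ℝ, |σ| = 1 → ∀ z₁ z₂ : ℂ, (σ : ℂ) * z₁ ∈ K → (σ : ℂ) * z₂ ∈ K →
      (EvenAbout α a b (α c + z₁ * v) ↔ EvenAbout α a b (α c + z₂ * v)) := by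
    intro σ hσ z₁ z₂ h₁ h₂
    set T : ℂ →ₗ[ℝ] ℂ := LinearMap.mulLeft ℝ ((σ : ℂ) * v⁻¹) with hT
    refine evenAbout_iff_of_convex (K := {z | T (z - α c) ∈ K}) hα hab' ?_ ?_ ?_ ?_
    · have : {z | T (z - α c) ∈ K} = (fun z => z + (-α c)) ⁻¹' (T ⁻¹' K) := by
        ext z; simp [sub_eq_add_neg]
      rw [this]
      exact (hKc.linear_preimage T).translate_preimage_left (-α c)
    · intro s hs hmem
      have he : T (α s - α c) = σ * w s := by simp only [hT, hw, LinearMap.mulLeft_apply]; ring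
      rw [mem_ofPred_eq, he] at hmem
      have hn : ‖w s‖ < ρ₂ := by
        have := hmem.2
        rwa [Metric.mem_ball, dist_zero_right, norm_mul, norm_real, Real.norm_eq_abs, hσ,
          one_mul] at this
      have h1 := hflat s hs hn
      have h2 := hmem.1
      simp only [mem_ofPred_eq, mul_re, mul_im, ofReal_re, ofReal_im, zero_mul,
        sub_zero, add_zero, abs_mul, hσ, one_mul] at h2
      have h3 : σ * (w s).im ≤ |(w s).im| := by
        calc σ * (w s).im ≤ |σ * (w s).im| := le_abs_self _
          _ = _ := by rw [abs_mul, hσ, one_mul]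
      linarith
    · simpa [hT, mul_assoc, mul_comm z₁ v, inv_mul_cancel_left₀ hv] using h₁
    · simpa [hT, mul_assoc, mul_comm z₂ v, inv_mul_cancel_left₀ hv] using h₂
  -- base points in the two sectors
  set ε := min ρ₁ ρ₂ / 2 with hε
  have hε0 : 0 < ε := half_pos (lt_min hρ₁ hρ₂)
  have hε1 : ε < ρ₁ := by linarith [min_le_left ρ₁ ρ₂]
  have hε2 : ε < ρ₂ := by linarith [min_le_right ρ₁ ρ₂]
  have hεK : (ε : ℂ) * I ∈ K := by
    refine ⟨by simpa using hε0, ?_⟩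
    rw [Metric.mem_ball, dist_zero_right, norm_mul, norm_I, norm_real, Real.norm_eq_abs,
      abs_of_pos hε0]; linarith
  have hycone := hyd.eventually_slope_mem (U := {z : ℂ | η * |z.re| < z.im})
    (isOpen_lt (continuous_const.mul (continuous_abs.comp continuous_re)) continuous_im) hημ
  have hysmall : ∀ᶠ x in 𝓝 t, ‖y x‖ < ρ₂ :=
    hyd.continuousAt.norm.eventually_lt continuousAt_const (by simpa [hyt] using hρ₂)
  have hβ : ∀ x, β x = α c + y x * v := fun x => by simp only [hy]; field_simp; ring
  have hside : ∀ x, x ≠ t → ((x - t)⁻¹ : ℝ) • (y x - y t) ∈ {z : ℂ | η * |z.re| < z.im} →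
      ‖y x‖ < ρ₂ → ((SignType.sign (x - t) : ℝ) : ℂ) * y x ∈ K := by
    intro x hx h1 h2
    rw [hyt, sub_zero] at h1
    have hxt : 0 < |x - t| := abs_pos.2 (sub_ne_zero.2 hx)
    have hσ : (x - t)⁻¹ = |x - t|⁻¹ * (SignType.sign (x - t) : ℝ) := by
      rcases lt_or_gt_of_ne hx with h | h
      · rw [sign_neg (by linarith), abs_of_neg (by linarith), inv_neg]
        simp
      · rw [sign_pos (by linarith), abs_of_pos (by linarith)]; simp
    have hs1 : |(SignType.sign (x - t) : ℝ)| = 1 := by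
      rcases lt_or_gt_of_ne hx with h | h
      · rw [sign_neg (by linarith)]; simp
      · rw [sign_pos (by linarith)]; simp
    refine ⟨?_, ?_⟩
    · simp only [mem_ofPred_eq, hσ, real_smul, mul_re, mul_im, ofReal_re, ofReal_im, zero_mul,
        sub_zero, add_zero, abs_mul, abs_inv, abs_abs] at h1 ⊢
      have h3 : 0 < |x - t|⁻¹ := inv_pos.2 hxt
      by_contra hc
      push Not at hc
      have := mul_le_mul_of_nonneg_left hc h3.le
      linarith
    · rw [Metric.mem_ball, dist_zero_right, norm_mul, norm_real, Real.norm_eq_abs, hs1, one_mul]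
      exact h2
  refine ⟨EvenAbout α a b (α c + ε * I * v), ?_, ?_⟩
  · filter_upwards [hycone.filter_mono (nhdsWithin_mono _ fun x hx => ne_of_gt hx),
      hysmall.filter_mono nhdsWithin_le_nhds, self_mem_nhdsWithin] with x h1 h2 h3
    have h4 := hside x (ne_of_gt h3) h1 h2
    rw [sign_pos (sub_pos.2 h3)] at h4
    rw [hβ]
    exact hmap 1 (by simp) _ _ (by simpa using h4) (by simpa using hεK)
  · filter_upwards [hycone.filter_mono (nhdsWithin_mono _ fun x hx => ne_of_lt hx),
      hysmall.filter_mono nhdsWithin_le_nhds, self_mem_nhdsWithin] with x h1 h2 h3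
    have h4 := hside x (ne_of_lt h3) h1 h2
    rw [sign_neg (sub_neg.2 h3)] at h4
    rw [hβ, ← hflip ε hε0 hε1]
    have := hmap (-1) (by simp) (y x) (-(ε * I)) (by simpa using h4) (by simpa using hεK)
    rw [this, neg_mul, ← sub_eq_add_neg]

lemma evenAbout_flip_of_crossing {α β : ℝ → ℂ} {a b c t : ℝ} {v u : ℂ} (hac : a < c)
    (hcb : c < b) (hα : ContinuousOn α (Icc a b)) (hab' : α a = α b)
    (hdα : HasDerivAt α v c) (hdβ : HasDerivAt β u t) (hpt : β t = α c)
    (hinj : ∀ s ∈ Icc a b, α s = α c → s = c) (huv : (u / v).im ≠ 0) :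
    ∃ e : Prop, (∀ᶠ x in 𝓝[>] t, EvenAbout α a b (β x) ↔ e) ∧
      ∀ᶠ x in 𝓝[<] t, EvenAbout α a b (β x) ↔ ¬ e := by
  have hv : v ≠ 0 := by rintro rfl; simp at huv
  rcases lt_or_gt_of_ne huv with h | h
  · -- reverse the second curve
    have hd' : HasDerivAt (fun x => β (-x)) (-u) (-t) := by
      have := HasDerivAt.scomp (-t) (g₁ := β) (g₁' := u) (by simpa using hdβ) (hasDerivAt_neg (-t))
      simpa [Function.comp_def] using this
    obtain ⟨e, h1, h2⟩ := evenAbout_flip_of_crossing_of_pos hac hcb hα hab' hdα hd'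
      (by simpa using hpt)
      hinj hv (by rw [neg_div, neg_im]; linarith)
    refine ⟨¬ e, ?_, ?_⟩
    · have := tendsto_neg_nhdsGT (a := t) |>.eventually h2
      simpa using this
    · have := tendsto_neg_nhdsLT (a := t) |>.eventually h1
      simpa using this
  · exact evenAbout_flip_of_crossing_of_pos hac hcb hα hab' hdα hdβ hpt hinj hv h

/-! ### Parity of the number of crossings of two loops -/

/-- Let the loop `α` close up with a corner, and let `β` leave the corner in the direction `vb` in
which `α` arrives and return to it in the direction `va` in which `α` leaves. Then the beginning and
the end of `β` miss `α` and see it with the same parity: both lie in a half-disk at the corner, cut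
out by a functional that is positive on `vb` and on `-va`, and `α` avoids this half-disk. -/
lemma evenAbout_iff_of_corner {α β : ℝ → ℂ} {a b c d : ℝ} {va vb : ℂ} (hab : a < b)
    (hα : ContinuousOn α (Icc a b)) (hab' : α a = α b)
    (hda : HasDerivAt α va a) (hdb : HasDerivAt α vb b)
    (hinj : ∀ s ∈ Icc a b, α s = α a → s = a ∨ s = b)
    (hdc : HasDerivAt β vb c) (hdd : HasDerivAt β va d) (hc : β c = α a) (hd : β d = α a)
    (hv : (va / vb).im ≠ 0) :
    ∃ e : Prop, (∀ᶠ x in 𝓝[>] c, β x ∉ α '' Icc a b ∧ (EvenAbout α a b (β x) ↔ e)) ∧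
      ∀ᶠ x in 𝓝[<] d, β x ∉ α '' Icc a b ∧ (EvenAbout α a b (β x) ↔ e) := by
  have hvb : vb ≠ 0 := by rintro rfl; simp at hv
  -- `ℓ z = Re (z / vb) + r Im (z / vb)`, with `r` chosen such that `ℓ vb = 1` and `ℓ va = -1`
  obtain ⟨ℓ, hℓb, hℓa⟩ : ∃ ℓ : ℂ →L[ℝ] ℝ, 0 < ℓ vb ∧ 0 < ℓ (-va) := by
    set r := -(1 + (va / vb).re) / (va / vb).im with hr
    refine ⟨(reCLM + r • imCLM).comp ((ContinuousLinearMap.mul ℝ ℂ) vb⁻¹), ?_, ?_⟩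
    · simp [inv_mul_cancel₀ hvb]
    · have : vb⁻¹ * -va = - (va / vb) := by field_simp
      simp only [ContinuousLinearMap.comp_apply, ContinuousLinearMap.mul_apply', this]
      simp only [add_apply, reCLM_apply, smul_apply, imCLM_apply,
        neg_re, neg_im, smul_eq_mul, hr]
      field_simp
      linarith
  have h1 := (hdb.eventually_functional_sign ℓ hℓb).2
  have h2 := (hda.eventually_functional_sign (-ℓ) (by simpa using hℓa)).1
  have h3 := (hdc.eventually_functional_sign ℓ hℓb).1
  have h4 := (hdd.eventually_functional_sign (-ℓ) (by simpa using hℓa)).2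
  rw [eventually_nhdsWithin_iff, Metric.eventually_nhds_iff] at h1 h2
  obtain ⟨δ₁, hδ₁, h1⟩ := h1
  obtain ⟨δ₂, hδ₂, h2⟩ := h2
  obtain ⟨ρ, hρ, hfar⟩ := exists_lt_norm_sub_of_ne (p := α a)
    (S := (Icc a b \ Metric.ball b δ₁) \ Metric.ball a δ₂)
    ((isCompact_Icc.diff Metric.isOpen_ball).diff Metric.isOpen_ball)
    (hα.mono (sdiff_subset.trans sdiff_subset)) (by
      rintro s ⟨⟨hs, hsb⟩, hsa⟩ h0
      rcases hinj s hs h0 with rfl | rfl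
      · exact hsa (Metric.mem_ball_self hδ₂)
      · exact hsb (Metric.mem_ball_self hδ₁))
  set K : Set ℂ := {z | ℓ (α a) < ℓ z} ∩ Metric.ball (α a) ρ with hK
  have hKc : Convex ℝ K :=
    (convex_halfSpace_gt ℓ.toLinearMap.isLinear _).inter (convex_ball _ _)
  have hdis : ∀ s ∈ Icc a b, α s ∉ K := by
    rintro s hs ⟨hm1, hm2⟩
    rw [mem_ofPred_eq] at hm1
    have hsab : s ∈ Metric.ball b δ₁ ∨ s ∈ Metric.ball a δ₂ := by
      by_contra hcon
      push Not at hcon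
      have := hfar s ⟨⟨hs, hcon.1⟩, hcon.2⟩
      rw [Metric.mem_ball, dist_eq_norm] at hm2
      linarith
    rcases hsab with h | h
    · rcases hs.2.eq_or_lt with rfl | hlt
      · rw [hab'] at hm1; exact lt_irrefl _ hm1
      · have := h1 h hlt
        rw [map_sub, ← hab'] at this; linarith
    · rcases hs.1.eq_or_lt with rfl | hlt
      · exact lt_irrefl _ hm1
      · have := h2 h hlt
        simp only [neg_apply, map_sub] at this; linarith
  have hKE : ∀ z ∈ K, ∀ w ∈ K, (EvenAbout α a b z ↔ EvenAbout α a b w) := fun z hz w hw =>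
    evenAbout_iff_of_convex hα hab' hKc hdis hz hw
  have hcK : ∀ᶠ x in 𝓝[>] c, β x ∈ K := by
    have hb : ∀ᶠ x in 𝓝 c, β x ∈ Metric.ball (α a) ρ :=
      hdc.continuousAt.eventually (by rw [hc]; exact Metric.ball_mem_nhds _ hρ)
    filter_upwards [h3, hb.filter_mono nhdsWithin_le_nhds] with x hx hx'
    refine ⟨?_, hx'⟩
    rw [map_sub, hc] at hx
    rw [mem_ofPred_eq]; linarith
  have hdK : ∀ᶠ x in 𝓝[<] d, β x ∈ K := by
    have hb : ∀ᶠ x in 𝓝 d, β x ∈ Metric.ball (α a) ρ :=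
      hdd.continuousAt.eventually (by rw [hd]; exact Metric.ball_mem_nhds _ hρ)
    filter_upwards [h4, hb.filter_mono nhdsWithin_le_nhds] with x hx hx'
    refine ⟨?_, hx'⟩
    simp only [neg_apply, map_sub, hd] at hx
    rw [mem_ofPred_eq]; linarith
  obtain ⟨x₀, hx₀⟩ := hcK.exists
  refine ⟨EvenAbout α a b (β x₀), ?_, ?_⟩
  · filter_upwards [hcK] with x hx
    exact ⟨fun ⟨s, hs, h⟩ => hdis s hs (h ▸ hx), hKE _ hx _ hx₀⟩
  · filter_upwards [hdK] with x hx
    exact ⟨fun ⟨s, hs, h⟩ => hdis s hs (h ▸ hx), hKE _ hx _ hx₀⟩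

lemma eventually_evenAbout_iff {α β : ℝ → ℂ} {a b t : ℝ} (hα : ContinuousOn α (Icc a b))
    (hab' : α a = α b) (hβ : ContinuousAt β t) (ht : β t ∉ α '' Icc a b) :
    ∀ᶠ x in 𝓝 t, (EvenAbout α a b (β x) ↔ EvenAbout α a b (β t)) := by
  have hcl : IsClosed (α '' Icc a b) := (isCompact_Icc.image_of_continuousOn hα).isClosed
  obtain ⟨ρ, hρ, hball⟩ := Metric.mem_nhds_iff.1 (hcl.isOpen_compl.mem_nhds ht)
  filter_upwards [hβ.eventually (Metric.ball_mem_nhds _ hρ)] with x hx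
  exact evenAbout_iff_of_convex hα hab' (convex_ball (β t) ρ)
    (fun s hs h => hball h ⟨s, hs, rfl⟩) hx (Metric.mem_ball_self hρ)

lemma iff_of_eventually_iff {e : ℝ → Prop} {c d : ℝ} (hcd : c ≤ d)
    (h : ∀ t ∈ Icc c d, ∀ᶠ x in 𝓝 t, (e x ↔ e t)) : e c ↔ e d := by
  refine isPreconnected_Icc.induction₂ (fun x y => e x ↔ e y)
    (fun x hx => ((h x hx).filter_mono nhdsWithin_le_nhds).mono fun y hy => hy.symm)
    (fun _ _ _ _ _ _ => Iff.trans) (fun _ _ _ _ => Iff.symm)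
    (left_mem_Icc.2 hcd) (right_mem_Icc.2 hcd)

/-- A proposition that depends on a real parameter, is locally constant off a finite set and flips
at each point of this set has the same truth value at both ends if and only if the set has an even
number of elements. -/
lemma even_card_flips {e : ℝ → Prop} (B : Finset ℝ) : ∀ {c d : ℝ}, c ≤ d → ↑B ⊆ Ioo c d →
    (∀ t ∈ Icc c d, t ∉ B → ∀ᶠ x in 𝓝 t, (e x ↔ e t)) →
    (∀ t ∈ B, ∃ p : Prop, (∀ᶠ x in 𝓝[>] t, e x ↔ p) ∧ ∀ᶠ x in 𝓝[<] t, e x ↔ ¬ p) →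
    ((e c ↔ e d) ↔ Even B.card) := by
  induction B using Finset.induction_on_min with
  | empty =>
    intro c d hcd _ h _
    simpa using iff_of_eventually_iff hcd (fun t ht => h t ht (by simp))
  | insert m B hm ih =>
    intro c d hcd hB hconst hflip
    have hmB : m ∉ B := fun h => lt_irrefl _ (hm m h)
    have hmI := hB (Finset.mem_coe.2 (Finset.mem_insert_self m B))
    obtain ⟨p, hr, hl⟩ := hflip m (Finset.mem_insert_self m B)
    have hgt : ∀ᶠ x in 𝓝[>] m, x < d ∧ ∀ t ∈ B, x < t := by
      refine (Filter.Eventually.and ?_ ?_).filter_mono nhdsWithin_le_nhds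
      · exact eventually_lt_nhds hmI.2
      · rw [Finset.eventually_all]
        exact fun t ht => eventually_lt_nhds (hm t ht)
    obtain ⟨r, ⟨hr1, hr2, hr3⟩, hr4⟩ := ((hr.and hgt).and self_mem_nhdsWithin).exists
    obtain ⟨l, ⟨hl1, hl2⟩, hl3⟩ := ((hl.and ((eventually_gt_nhds hmI.1).filter_mono
      nhdsWithin_le_nhds)).and self_mem_nhdsWithin).exists
    have hr4' : m < r := hr4
    have hl3' : l < m := hl3
    have h1 : e c ↔ e l := iff_of_eventually_iff hl2.le fun t ht => hconst t
      ⟨ht.1, by linarith [ht.2, hmI.2]⟩ (by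
        rw [Finset.mem_insert, not_or]
        refine ⟨by linarith [ht.2], fun h => ?_⟩
        have := hm t h
        linarith [ht.2])
    have h2 := ih (c := r) (d := d) hr2.le (fun t ht => ⟨hr3 t ht,
        (hB (Finset.mem_coe.2 (Finset.mem_insert_of_mem ht))).2⟩)
      (fun t ht htB => hconst t ⟨by linarith [ht.1, hmI.1], ht.2⟩ (by
        rw [Finset.mem_insert, not_or]
        exact ⟨by linarith [ht.1], htB⟩))
      (fun t ht => hflip t (Finset.mem_insert_of_mem ht))
    rw [Finset.card_insert_of_notMem hmB, Nat.even_add_one, ← h2, h1]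
    tauto

/-- At the parameter `t` the curve `β` crosses `α` on `(a, b)` transversally, at a simple point of
`α` on `[a, b]`. -/
def TransverseAt (α β : ℝ → ℂ) (a b t : ℝ) : Prop :=
  ∃ s ∈ Ioo a b, α s = β t ∧ (∀ r ∈ Icc a b, α r = α s → r = s) ∧
    ∃ v u : ℂ, HasDerivAt α v s ∧ HasDerivAt β u t ∧ (u / v).im ≠ 0

lemma evenAbout_iff_iff_even_ncard {α β : ℝ → ℂ} {a b c d : ℝ} (hcd : c ≤ d)
    (hα : ContinuousOn α (Icc a b)) (hab' : α a = α b) (hβ : Continuous β)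
    (hfin : {t ∈ Ioo c d | β t ∈ α '' Icc a b}.Finite)
    (htr : ∀ t ∈ Ioo c d, β t ∈ α '' Icc a b → TransverseAt α β a b t)
    (hc : β c ∉ α '' Icc a b) (hd : β d ∉ α '' Icc a b) :
    (EvenAbout α a b (β c) ↔ EvenAbout α a b (β d)) ↔
      Even {t ∈ Ioo c d | β t ∈ α '' Icc a b}.ncard := by
  rw [ncard_eq_toFinset_card _ hfin]
  apply even_card_flips (e := fun t => EvenAbout α a b (β t)) _ hcd
  · intro t ht; simp only [Finite.coe_toFinset] at ht; exact ht.1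
  · intro t ht htB
    apply eventually_evenAbout_iff hα hab' hβ.continuousAt
    intro hmem
    apply htB
    rw [Finite.mem_toFinset]
    refine ⟨⟨lt_of_le_of_ne ht.1 ?_, lt_of_le_of_ne ht.2 ?_⟩, hmem⟩
    · rintro rfl; exact hc hmem
    · rintro rfl; exact hd hmem
  · intro t ht
    rw [Finite.mem_toFinset] at ht
    obtain ⟨s, hs, hst, hinj, v, u, hv, hu, huv⟩ := htr t ht.1 ht.2
    exact evenAbout_flip_of_crossing hs.1 hs.2 hα hab' hv hu hst.symm hinj huv

/-- Two closed plane curves in general position meet an even number of times. -/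
theorem even_ncard_of_closed {α β : ℝ → ℂ} {a b c d : ℝ} (hcd : c ≤ d)
    (hα : ContinuousOn α (Icc a b)) (hab' : α a = α b) (hβ : Continuous β)
    (hfin : {t ∈ Ioo c d | β t ∈ α '' Icc a b}.Finite)
    (htr : ∀ t ∈ Ioo c d, β t ∈ α '' Icc a b → TransverseAt α β a b t)
    (hc : β c ∉ α '' Icc a b) (hd : β c = β d) :
    Even {t ∈ Ioo c d | β t ∈ α '' Icc a b}.ncard := by
  rw [← evenAbout_iff_iff_even_ncard hcd hα hab' hβ hfin htr hc (hd ▸ hc), hd]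

/-- A closed plane curve that is cut into two loops at one of its double points: the loops meet an
even number of times away from this point. -/
theorem even_ncard_of_corner {α β : ℝ → ℂ} {a b c d : ℝ} {va vb : ℂ} (hab : a < b) (hcd : c < d)
    (hα : ContinuousOn α (Icc a b)) (hab' : α a = α b) (hβ : Continuous β)
    (hfin : {t ∈ Ioo c d | β t ∈ α '' Icc a b}.Finite)
    (htr : ∀ t ∈ Ioo c d, β t ∈ α '' Icc a b → TransverseAt α β a b t)
    (hda : HasDerivAt α va a) (hdb : HasDerivAt α vb b)
    (hinj : ∀ s ∈ Icc a b, α s = α a → s = a ∨ s = b)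
    (hdc : HasDerivAt β vb c) (hdd : HasDerivAt β va d) (hc : β c = α a) (hd : β d = α a)
    (hv : (va / vb).im ≠ 0) :
    Even {t ∈ Ioo c d | β t ∈ α '' Icc a b}.ncard := by
  obtain ⟨e, h1, h2⟩ := evenAbout_iff_of_corner hab hα hab' hda hdb hinj hdc hdd hc hd hv
  -- shrink the interval
  obtain ⟨r, hcr, hr⟩ := mem_nhdsGT_iff_exists_Ioc_subset.1 h1
  obtain ⟨l, hld, hl⟩ := mem_nhdsLT_iff_exists_Ico_subset.1 h2
  have hcr' : c < r := hcr
  have hld' : l < d := hld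
  set c' := min r ((c + d) / 2) with hc'
  set d' := max l ((c + d) / 2) with hd'
  have hc1 : c < c' := lt_min hcr' (by linarith)
  have hd1 : d' < d := max_lt hld' (by linarith)
  have hcd' : c' ≤ d' := (min_le_right _ _).trans (le_max_right _ _)
  have hr' : ∀ x ∈ Ioc c c', β x ∉ α '' Icc a b ∧ (EvenAbout α a b (β x) ↔ e) := fun x hx =>
    hr ⟨hx.1, hx.2.trans (min_le_left _ _)⟩
  have hl' : ∀ x ∈ Ico d' d, β x ∉ α '' Icc a b ∧ (EvenAbout α a b (β x) ↔ e) := fun x hx =>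
    hl ⟨(le_max_left _ _).trans hx.1, hx.2⟩
  have hset : {t ∈ Ioo c d | β t ∈ α '' Icc a b} = {t ∈ Ioo c' d' | β t ∈ α '' Icc a b} := by
    ext t
    constructor
    · rintro ⟨ht, hm⟩
      refine ⟨⟨?_, ?_⟩, hm⟩
      · by_contra hcon; push Not at hcon
        exact (hr' t ⟨ht.1, hcon⟩).1 hm
      · by_contra hcon; push Not at hcon
        exact (hl' t ⟨hcon, ht.2⟩).1 hm
    · rintro ⟨ht, hm⟩
      exact ⟨⟨hc1.trans ht.1, ht.2.trans hd1⟩, hm⟩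
  have hcc := hr' c' ⟨hc1, le_rfl⟩
  have hdd' := hl' d' ⟨le_rfl, hd1⟩
  rw [hset]
  rw [← evenAbout_iff_iff_even_ncard hcd' hα hab' hβ (hset ▸ hfin)
    (fun t ht => htr t ⟨hc1.trans ht.1, ht.2.trans hd1⟩) hcc.1 hdd'.1, hcc.2, hdd'.2]

/-! ### Plane models of knot projections -/

namespace KnotProjection

/-- The lift of the curve to Euclidean space, as a function of a real parameter. -/
def lift (P : KnotProjection) (t : ℝ) : EuclideanSpace ℝ (Fin 3) := P (t : UnitAddCircle)

/-- The curve misses a point of the sphere: the smooth map `(r, t) ↦ r • P t` of a plane into space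
is not surjective. -/
lemma exists_unit_vector_ne (P : KnotProjection) :
    ∃ v : EuclideanSpace ℝ (Fin 3), ‖v‖ = 1 ∧ ∀ t : ℝ, P.lift t ≠ v := by
  have hs : ContDiff ℝ 1 P.lift := P.smooth.of_le (by norm_cast)
  have hf : ContDiff ℝ 1 (fun x : ℝ × ℝ => x.1 • P.lift x.2) :=
    contDiff_fst.smul (hs.comp contDiff_snd)
  obtain ⟨x, hx⟩ := (hf.dense_compl_range_of_finrank_lt_finrank (by simp)).nonempty
  have hx0 : x ≠ 0 := fun h => hx ⟨(0, 0), by simp [h]⟩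
  refine ⟨‖x‖⁻¹ • x, ?_, fun t ht => hx ⟨(‖x‖, t), ?_⟩⟩
  · rw [norm_smul, norm_inv, norm_norm, inv_mul_cancel₀ (norm_ne_zero_iff.2 hx0)]
  · simp only [ht]
    rw [smul_inv_smul₀ (norm_ne_zero_iff.2 hx0)]

/-- Stereographic projection from a missed point makes the knot projection a plane curve with the
same double points, which are still transverse. -/
theorem exists_planar_model (P : KnotProjection) :
    ∃ γ : ℝ → ℂ, Differentiable ℝ γ ∧
      (∀ s t : ℝ, γ s = γ t ↔ P (s : UnitAddCircle) = P (t : UnitAddCircle)) ∧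
      ∀ s t : ℝ, (s : UnitAddCircle) ≠ (t : UnitAddCircle) →
        P (s : UnitAddCircle) = P (t : UnitAddCircle) → (deriv γ s / deriv γ t).im ≠ 0 := by
  obtain ⟨v, hv, hPv⟩ := P.exists_unit_vector_ne
  have hfr : Module.finrank ℝ (Submodule.span ℝ {v})ᗮ = Module.finrank ℝ ℂ := by
    have : Fact (Module.finrank ℝ (EuclideanSpace ℝ (Fin 3)) = 2 + 1) := ⟨by simp⟩
    rw [Submodule.finrank_orthogonal_span_singleton (n := 2)
      (by rintro rfl; simp at hv), Complex.finrank_real_complex]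
  let L : (Submodule.span ℝ {v})ᗮ ≃L[ℝ] ℂ := ContinuousLinearEquiv.ofFinrankEq hfr
  let γ : ℝ → ℂ := fun t => L (stereoToFun v (P.lift t))
  let G : ℂ → EuclideanSpace ℝ (Fin 3) := fun z => stereoInvFunAux v (L.symm z)
  have hsm : Differentiable ℝ P.lift := P.smooth.differentiable (by simp)
  have hγ : Differentiable ℝ γ := by
    intro t
    have hmem : P.lift t ∈ {x : EuclideanSpace ℝ (Fin 3) | innerSL ℝ v x ≠ (1 : ℝ)} := by
      intro h
      have hn : ‖P.lift t‖ = 1 := by simp [lift]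
      rw [innerSL_apply_apply, inner_eq_one_iff_of_norm_eq_one hv hn] at h
      exact hPv t h.symm
    have hopen : IsOpen {x : EuclideanSpace ℝ (Fin 3) | innerSL ℝ v x ≠ (1 : ℝ)} :=
      isOpen_ne_fun (innerSL ℝ v).continuous continuous_const
    have h1 : DifferentiableAt ℝ (stereoToFun v) (P.lift t) :=
      ((contDiffOn_stereoToFun (n := 1)).contDiffAt (hopen.mem_nhds hmem)).differentiableAt
        one_ne_zero
    exact L.differentiableAt.comp t (h1.comp t (hsm t))
  have hG : Differentiable ℝ G := by
    intro z
    exact ((contDiff_stereoInvFunAux (m := 1)).differentiable one_ne_zero _).comp z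
      ((Submodule.subtypeL _).differentiableAt.comp z L.symm.differentiableAt)
  have hGγ : ∀ t, G (γ t) = P.lift t := by
    intro t
    have := stereo_left_inv hv (x := P (t : UnitAddCircle)) (hPv t)
    simp only [G, γ, L.symm_apply_apply]
    exact congrArg Subtype.val this
  have hderiv : ∀ t, deriv P.lift t = fderiv ℝ G (γ t) (deriv γ t) := by
    intro t
    have h1 := (hG (γ t)).hasFDerivAt.comp_hasDerivAt t (hγ t).hasDerivAt
    have h2 : G ∘ γ = P.lift := funext hGγ
    rw [h2] at h1
    exact h1.deriv
  have hiff : ∀ s t : ℝ, γ s = γ t ↔ P (s : UnitAddCircle) = P (t : UnitAddCircle) := by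
    intro s t
    constructor
    · intro h
      have := congrArg G h
      rw [hGγ, hGγ] at this
      exact Subtype.ext this
    · intro h
      simp only [γ, lift, h]
  refine ⟨γ, hγ, hiff, fun s t hst hP him => ?_⟩
  have hγt : deriv γ t ≠ 0 := by
    intro h0
    have := hderiv t
    rw [h0, map_zero] at this
    exact P.immersion t this
  have hr : deriv γ s = (deriv γ s / deriv γ t).re • deriv γ t := by
    rw [real_smul]
    have : ((deriv γ s / deriv γ t).re : ℂ) = deriv γ s / deriv γ t := by
      apply Complex.ext <;> simp [him]
    rw [this, div_mul_cancel₀ _ hγt]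
  have hlin := P.transverse s t hst hP
  rw [LinearIndependent.pair_iff] at hlin
  have hds := hderiv s
  rw [hr, map_smul, (hiff s t).2 hP, ← hderiv t] at hds
  have := hlin 1 (-(deriv γ s / deriv γ t).re) (by
    change (1 : ℝ) • deriv P.lift s + _ • deriv P.lift t = 0
    rw [hds, one_smul, neg_smul, add_neg_cancel])
  exact one_ne_zero this.1

lemma coe_inj_of_lt {s t : ℝ} (h : |s - t| < 1) :
    (s : UnitAddCircle) = (t : UnitAddCircle) ↔ s = t := by
  refine ⟨fun he => ?_, fun h => h ▸ rfl⟩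
  rw [AddCircle.coe_eq_coe_iff_of_mem_Ico (p := 1) (a := min s t)] at he
  · exact he
  · rw [abs_lt] at h
    exact ⟨min_le_left _ _, by rcases min_choice s t with h' | h' <;> rw [h'] <;> linarith⟩
  · rw [abs_lt] at h
    exact ⟨min_le_right _ _, by rcases min_choice s t with h' | h' <;> rw [h'] <;> linarith⟩

/-- The two preimages of a double point are its only ones. -/
lemma eq_or_eq_of_double (P : KnotProjection) {r s t : UnitAddCircle} (hrs : r ≠ s) (h1 : P r = P s)
    (h2 : P t = P s) : t = r ∨ t = s := by
  by_contra h
  push Not at h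
  exact P.no_triple r s t hrs (Ne.symm h.2) (Ne.symm h.1) ⟨h1, h2.symm⟩

/-- Two arcs of a knot projection, each starting and ending at the same point, meet an even number
of times in their interiors, if they are disjoint as arcs of the circle or complementary to each
other. -/
lemma even_ncard_arcs (P : KnotProjection) {a b c d : ℝ} (hab : a < b) (hbc : b ≤ c) (hcd : c < d)
    (hda : d ≤ a + 1) (hPab : P (a : UnitAddCircle) = P (b : UnitAddCircle))
    (hPcd : P (c : UnitAddCircle) = P (d : UnitAddCircle))
    (hcorner : (c = b ∧ d = a + 1) ∨ (b < c ∧ d < a + 1)) :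
    Even {t ∈ Ioo c d | ∃ s ∈ Ioo a b, P (s : UnitAddCircle) = P (t : UnitAddCircle)}.ncard := by
  obtain ⟨γ, hγ, hiff, htr⟩ := P.exists_planar_model
  have hne : ∀ s ∈ Icc a b, ∀ t ∈ Ioo c d, (s : UnitAddCircle) ≠ (t : UnitAddCircle) := by
    intro s hs t ht h
    have := (coe_inj_of_lt (by rw [abs_lt]; constructor <;> linarith [hs.1, hs.2, ht.1, ht.2])).1 h
    linarith [hs.1, hs.2, ht.1, ht.2]
  have habne : (a : UnitAddCircle) ≠ (b : UnitAddCircle) := by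
    intro h
    have := (coe_inj_of_lt (by rw [abs_lt]; constructor <;> linarith)).1 h
    linarith
  have hend : ∀ t ∈ Ioo c d, P (t : UnitAddCircle) ≠ P (b : UnitAddCircle) := by
    intro t ht h
    rcases P.eq_or_eq_of_double habne hPab h with h' | h'
    · exact hne a (left_mem_Icc.2 hab.le) t ht h'.symm
    · exact hne b (right_mem_Icc.2 hab.le) t ht h'.symm
  have hset : {t ∈ Ioo c d | ∃ s ∈ Ioo a b, P (s : UnitAddCircle) = P (t : UnitAddCircle)}
      = {t ∈ Ioo c d | γ t ∈ γ '' Icc a b} := by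
    ext t
    constructor
    · rintro ⟨ht, s, hs, h⟩
      exact ⟨ht, s, Ioo_subset_Icc_self hs, (hiff s t).2 h⟩
    · rintro ⟨ht, s, hs, h⟩
      rw [hiff] at h
      refine ⟨ht, s, ⟨lt_of_le_of_ne hs.1 ?_, lt_of_le_of_ne hs.2 ?_⟩, h⟩
      · rintro rfl; exact hend t ht (h.symm.trans hPab)
      · rintro rfl; exact hend t ht h.symm
  have hfin : {t ∈ Ioo c d | γ t ∈ γ '' Icc a b}.Finite := by
    rw [← hset]
    refine Set.Finite.of_finite_image (f := fun t : ℝ => (t : UnitAddCircle))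
      ((P.finite_double.image Prod.snd).subset ?_) ?_
    · rintro _ ⟨t, ⟨ht, s, hs, h⟩, rfl⟩
      exact ⟨((s : UnitAddCircle), (t : UnitAddCircle)),
        ⟨hne s (Ioo_subset_Icc_self hs) t ht, h⟩, rfl⟩
    · rintro s ⟨hs, -⟩ t ⟨ht, -⟩ h
      exact (coe_inj_of_lt (by rw [abs_lt]; constructor <;> linarith [hs.1, hs.2, ht.1, ht.2])).1 h
  have htrans : ∀ t ∈ Ioo c d, γ t ∈ γ '' Icc a b → TransverseAt γ γ a b t := by
    intro t ht hm
    have hm' : t ∈ {t ∈ Ioo c d | γ t ∈ γ '' Icc a b} := ⟨ht, hm⟩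
    rw [← hset] at hm'
    obtain ⟨-, s, hs, h⟩ := hm'
    have hst := hne s (Ioo_subset_Icc_self hs) t ht
    refine ⟨s, hs, (hiff s t).2 h, fun r hr hrs => ?_, deriv γ s, deriv γ t,
      (hγ s).hasDerivAt, (hγ t).hasDerivAt, htr t s hst.symm h.symm⟩
    rcases P.eq_or_eq_of_double hst.symm h.symm ((hiff r s).1 hrs) with h' | h'
    · exact absurd h' (hne r hr t ht)
    · exact (coe_inj_of_lt (by rw [abs_lt]; constructor <;> linarith [hs.1, hs.2, hr.1, hr.2])).1 h'
  rw [hset]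
  have hγab : γ a = γ b := (hiff a b).2 hPab
  rcases hcorner with ⟨rfl, rfl⟩ | ⟨hbc', hda'⟩
  · have hper : ∀ t : ℝ, γ (t + 1) = γ t := fun t => by
      rw [hiff, AddCircle.coe_add_period]
    have hdper : deriv γ (a + 1) = deriv γ a := by
      rw [← deriv_comp_add_const]; simp only [hper]
    refine even_ncard_of_corner hab hcd hγ.continuous.continuousOn hγab hγ.continuous hfin htrans
      (hγ a).hasDerivAt (hγ c).hasDerivAt ?_ (hγ c).hasDerivAt (hdper ▸ (hγ (a + 1)).hasDerivAt)
      hγab.symm (hper a) (htr a c habne hPab)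
    intro s hs h
    rcases P.eq_or_eq_of_double habne hPab ((hiff s c).1 (h.trans hγab)) with h' | h'
    · exact Or.inl ((coe_inj_of_lt (by
        rw [abs_lt]; constructor <;> linarith [hs.1, hs.2])).1 h')
    · exact Or.inr ((coe_inj_of_lt (by
        rw [abs_lt]; constructor <;> linarith [hs.1, hs.2])).1 h')
  · refine even_ncard_of_closed hcd.le hγ.continuous.continuousOn hγab hγ.continuous hfin htrans ?_
      ((hiff c d).2 hPcd)
    rintro ⟨s, hs, h⟩
    rw [hiff] at h
    have hcdne : (c : UnitAddCircle) ≠ (d : UnitAddCircle) := by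
      intro h
      have := (coe_inj_of_lt (by rw [abs_lt]; constructor <;> linarith)).1 h
      linarith
    rcases P.eq_or_eq_of_double hcdne hPcd (h.trans hPcd) with h' | h'
    · have := (coe_inj_of_lt (by rw [abs_lt]; constructor <;> linarith [hs.1, hs.2])).1 h'
      linarith [hs.1, hs.2]
    · have := (coe_inj_of_lt (by rw [abs_lt]; constructor <;> linarith [hs.1, hs.2])).1 h'
      linarith [hs.1, hs.2]

end KnotProjection

end

section

open Set Filter Topology

/-! ### Crossing chords of the circle and invariance under equivalence -/

/-- The cyclic order of the circle, read off from representatives in one period. -/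
lemma sbtw_coe_iff {B x y z : ℝ} (hx : x ∈ Ico B (B + 1)) (hy : y ∈ Ico B (B + 1))
    (hz : z ∈ Ico B (B + 1)) :
    sbtw (x : UnitAddCircle) (y : UnitAddCircle) (z : UnitAddCircle) ↔
      (x < y ∧ y < z) ∨ (y < z ∧ z < x) ∨ (z < x ∧ x < y) := by
  have hIco : ∀ u v : ℝ, u ∈ Ico B (B + 1) → v ∈ Ico B (B + 1) →
      toIcoMod (zero_lt_one' ℝ) u v = if u ≤ v then v else v + 1 := by
    intro u v hu hv
    rw [toIcoMod_eq_iff]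
    split_ifs with h
    · exact ⟨⟨h, by linarith [hu.1, hv.2]⟩, 0, by simp⟩
    · exact ⟨⟨by linarith [hu.2, hv.1], by linarith⟩, -1, by simp⟩
  have hIoc : ∀ u v : ℝ, u ∈ Ico B (B + 1) → v ∈ Ico B (B + 1) →
      toIocMod (zero_lt_one' ℝ) u v = if u < v then v else v + 1 := by
    intro u v hu hv
    rw [toIocMod_eq_iff]
    split_ifs with h
    · exact ⟨⟨h, by linarith [hu.1, hv.2]⟩, 0, by simp⟩
    · exact ⟨⟨by linarith [hu.2, hv.1], by linarith⟩, -1, by simp⟩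
  rw [sbtw_iff_not_btw]
  erw [QuotientAddGroup.btw_coe_iff]
  rw [hIco z y hz hy, hIoc z x hz hx]
  have h1 := hx.1; have h2 := hx.2; have h3 := hy.1; have h4 := hy.2
  split_ifs <;> grind

/-- The pairs `x, y` and `u, v` of real numbers alternate on the line. -/
def Alternate (x y u v : ℝ) : Prop :=
  (x < u ∧ u < y ∧ y < v) ∨ (x < v ∧ v < y ∧ y < u) ∨ (y < u ∧ u < x ∧ x < v) ∨
  (y < v ∧ v < x ∧ x < u) ∨ (u < x ∧ x < v ∧ v < y) ∨ (v < x ∧ x < u ∧ u < y) ∨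
  (u < y ∧ y < v ∧ v < x) ∨ (v < y ∧ y < u ∧ u < x)

lemma chordsCross_coe_iff {B x y u v : ℝ} (hx : x ∈ Ico B (B + 1)) (hy : y ∈ Ico B (B + 1))
    (hu : u ∈ Ico B (B + 1)) (hv : v ∈ Ico B (B + 1)) :
    ChordsCross s((x : UnitAddCircle), (y : UnitAddCircle))
      s((u : UnitAddCircle), (v : UnitAddCircle)) ↔ Alternate x y u v := by
  constructor
  · rintro ⟨a, b, c, d, h1, h2, h3, h4⟩
    rw [Sym2.eq_iff] at h1 h2
    rcases h1 with ⟨rfl, rfl⟩ | ⟨rfl, rfl⟩ <;> rcases h2 with ⟨rfl, rfl⟩ | ⟨rfl, rfl⟩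
    · rw [sbtw_coe_iff hx hu hy] at h3; rw [sbtw_coe_iff hy hv hx] at h4; grind [Alternate]
    · rw [sbtw_coe_iff hx hv hy] at h3; rw [sbtw_coe_iff hy hu hx] at h4; grind [Alternate]
    · rw [sbtw_coe_iff hy hu hx] at h3; rw [sbtw_coe_iff hx hv hy] at h4; grind [Alternate]
    · rw [sbtw_coe_iff hy hv hx] at h3; rw [sbtw_coe_iff hx hu hy] at h4; grind [Alternate]
  · intro h
    have h' : ((x < u ∧ u < y ∨ u < y ∧ y < x ∨ y < x ∧ x < u) ∧
        (y < v ∧ v < x ∨ v < x ∧ x < y ∨ x < y ∧ y < v)) ∨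
        ((x < v ∧ v < y ∨ v < y ∧ y < x ∨ y < x ∧ x < v) ∧
        (y < u ∧ u < x ∨ u < x ∧ x < y ∨ x < y ∧ y < u)) := by grind [Alternate]
    rcases h' with ⟨h3, h4⟩ | ⟨h3, h4⟩
    · exact ⟨x, y, u, v, rfl, rfl, (sbtw_coe_iff hx hu hy).2 h3, (sbtw_coe_iff hy hv hx).2 h4⟩
    · exact ⟨x, y, v, u, rfl, Sym2.eq_swap, (sbtw_coe_iff hx hv hy).2 h3,
        (sbtw_coe_iff hy hu hx).2 h4⟩

lemma exists_coe_mem_Ico (B : ℝ) (p : UnitAddCircle) :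
    ∃ x ∈ Ico B (B + 1), (x : UnitAddCircle) = p :=
  ⟨AddCircle.equivIco 1 B p, (AddCircle.equivIco 1 B p).2, AddCircle.coe_equivIco⟩

lemma coe_inj_of_mem_Ico {B x y : ℝ} (hx : x ∈ Ico B (B + 1)) (hy : y ∈ Ico B (B + 1)) :
    (x : UnitAddCircle) = (y : UnitAddCircle) ↔ x = y :=
  AddCircle.coe_eq_coe_iff_of_mem_Ico hx hy

lemma ChordsCross.symm {e f : Sym2 UnitAddCircle} (h : ChordsCross e f) : ChordsCross f e := by
  induction e using Sym2.ind with | _ a b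
  induction f using Sym2.ind with | _ c d
  obtain ⟨x, hx, rfl⟩ := exists_coe_mem_Ico 0 a
  obtain ⟨y, hy, rfl⟩ := exists_coe_mem_Ico 0 b
  obtain ⟨u, hu, rfl⟩ := exists_coe_mem_Ico 0 c
  obtain ⟨v, hv, rfl⟩ := exists_coe_mem_Ico 0 d
  rw [chordsCross_coe_iff hx hy hu hv] at h
  rw [chordsCross_coe_iff hu hv hx hy]
  grind [Alternate]

lemma chordsCross_comm {e f : Sym2 UnitAddCircle} : ChordsCross e f ↔ ChordsCross f e :=
  ⟨ChordsCross.symm, ChordsCross.symm⟩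

lemma not_chordsCross_self (e : Sym2 UnitAddCircle) : ¬ ChordsCross e e := by
  induction e using Sym2.ind with | _ a b
  obtain ⟨x, hx, rfl⟩ := exists_coe_mem_Ico 0 a
  obtain ⟨y, hy, rfl⟩ := exists_coe_mem_Ico 0 b
  rw [chordsCross_coe_iff hx hy hx hy]
  grind [Alternate]

lemma isOpen_coe_image_Ioo (x y : ℝ) : IsOpen ((fun t : ℝ => (t : UnitAddCircle)) '' Ioo x y) :=
  QuotientAddGroup.isOpenMap_coe _ isOpen_Ioo

lemma isPreconnected_coe_image_Ioo (x y : ℝ) :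
    IsPreconnected ((fun t : ℝ => (t : UnitAddCircle)) '' Ioo x y) :=
  isPreconnected_Ioo.image _ (AddCircle.continuous_mk' 1).continuousOn

/-- Two chords cross if and only if the ends of the first separate the ends of the second on the
circle. This characterization is invariant under homeomorphisms of the circle, also under those that
reverse the cyclic order. -/
lemma chordsCross_iff_separated {e f : Sym2 UnitAddCircle} :
    ChordsCross e f ↔ ∃ a b c d : UnitAddCircle, e = s(a, b) ∧ f = s(c, d) ∧ a ≠ b ∧
      c ∉ ({a, b} : Set UnitAddCircle) ∧ d ∉ ({a, b} : Set UnitAddCircle) ∧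
      ∀ C : Set UnitAddCircle, IsPreconnected C → C ⊆ {a, b}ᶜ → c ∈ C → d ∉ C := by
  constructor
  · intro h
    induction e using Sym2.ind with | _ a b
    induction f using Sym2.ind with | _ c d
    obtain ⟨x, rfl⟩ := QuotientAddGroup.mk_surjective a
    obtain ⟨y, hy, rfl⟩ := exists_coe_mem_Ico x b
    obtain ⟨u, hu, rfl⟩ := exists_coe_mem_Ico x c
    obtain ⟨v, hv, rfl⟩ := exists_coe_mem_Ico x d
    have hx : x ∈ Ico x (x + 1) := ⟨le_rfl, by linarith⟩
    have hA := (chordsCross_coe_iff hx hy hu hv).1 h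
    have hxy : x < y := by have := hy.1; have := hu.1; have := hv.1; grind [Alternate]
    have hcover : ∀ p : UnitAddCircle, p ∈ ({(x : UnitAddCircle), (y : UnitAddCircle)}ᶜ : Set _) →
        p ∈ ((fun t : ℝ => (t : UnitAddCircle)) '' Ioo x y) ∪
          ((fun t : ℝ => (t : UnitAddCircle)) '' Ioo y (x + 1)) := by
      intro p hp
      obtain ⟨t, ht, rfl⟩ := exists_coe_mem_Ico x p
      simp only [mem_compl_iff, mem_insert_iff, mem_singleton_iff, not_or] at hp
      have h1 : t ≠ x := fun h => hp.1 (by rw [h])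
      have h2 : t ≠ y := fun h => hp.2 (by rw [h])
      rcases lt_or_gt_of_ne h2 with h | h
      · exact Or.inl ⟨t, ⟨lt_of_le_of_ne ht.1 h1.symm, h⟩, rfl⟩
      · exact Or.inr ⟨t, ⟨h, ht.2⟩, rfl⟩
    have hdisj : Disjoint ((fun t : ℝ => (t : UnitAddCircle)) '' Ioo x y)
          ((fun t : ℝ => (t : UnitAddCircle)) '' Ioo y (x + 1)) := by
      rw [Set.disjoint_left]
      rintro _ ⟨s, hs, rfl⟩ ⟨t, ht, h⟩
      have := (coe_inj_of_mem_Ico (B := x) ⟨by linarith [ht.1], ht.2⟩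
        ⟨hs.1.le, by linarith [hs.2, hy.2]⟩).1 h
      linarith [hs.2, ht.1]
    have key : ∀ s ∈ Ioo x y, ∀ t ∈ Ioo y (x + 1), ∀ C : Set UnitAddCircle, IsPreconnected C →
        C ⊆ {(x : UnitAddCircle), (y : UnitAddCircle)}ᶜ → (s : UnitAddCircle) ∈ C →
        (t : UnitAddCircle) ∉ C := by
      intro s hs t ht C hC hsub hsC htC
      have := hC.subset_left_of_subset_union (isOpen_coe_image_Ioo x y)
        (isOpen_coe_image_Ioo y (x + 1)) hdisj (fun p hp => hcover p (hsub hp)) ⟨_, hsC, s, hs, rfl⟩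
      exact Set.disjoint_left.1 hdisj (this htC) ⟨t, ht, rfl⟩
    have hne : ∀ t ∈ Ico x (x + 1), t ≠ x → t ≠ y →
        (t : UnitAddCircle) ∉ ({(x : UnitAddCircle), (y : UnitAddCircle)} : Set _) := by
      intro t ht h1 h2 hm
      rcases hm with h | h
      · exact h1 ((coe_inj_of_mem_Ico ht hx).1 h)
      · exact h2 ((coe_inj_of_mem_Ico ht hy).1 h)
    have hu1 := hu.1
    have hv1 := hv.1
    refine ⟨x, y, u, v, rfl, rfl, fun h => hxy.ne ((coe_inj_of_mem_Ico hx hy).1 h),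
      hne u hu (by grind [Alternate]) (by grind [Alternate]),
      hne v hv (by grind [Alternate]) (by grind [Alternate]), ?_⟩
    have hcase : (u ∈ Ioo x y ∧ v ∈ Ioo y (x + 1)) ∨ (v ∈ Ioo x y ∧ u ∈ Ioo y (x + 1)) := by
      have := hu.2
      have := hv.2
      simp only [mem_Ioo]
      grind [Alternate]
    rcases hcase with ⟨h1, h2⟩ | ⟨h1, h2⟩
    · exact key u h1 v h2
    · exact fun C hC hsub h3 h4 => key v h1 u h2 C hC hsub h4 h3
  · rintro ⟨a, b, c, d, rfl, rfl, hab, hc, hd, hC⟩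
    obtain ⟨x, rfl⟩ := QuotientAddGroup.mk_surjective a
    obtain ⟨y, hy, rfl⟩ := exists_coe_mem_Ico x b
    obtain ⟨u, hu, rfl⟩ := exists_coe_mem_Ico x c
    obtain ⟨v, hv, rfl⟩ := exists_coe_mem_Ico x d
    have hx : x ∈ Ico x (x + 1) := ⟨le_rfl, by linarith⟩
    rw [mem_insert_iff, mem_singleton_iff, not_or] at hc hd
    have hxy : x < y := lt_of_le_of_ne hy.1 (fun h => hab (by rw [h]))
    have hxu : x < u := lt_of_le_of_ne hu.1 (fun h => hc.1 (by rw [h]))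
    have hxv : x < v := lt_of_le_of_ne hv.1 (fun h => hd.1 (by rw [h]))
    have huy : u ≠ y := fun h => hc.2 (by rw [h])
    have hvy : v ≠ y := fun h => hd.2 (by rw [h])
    refine (chordsCross_coe_iff hx hy hu hv).2 ?_
    by_contra hA
    have hcase : (u ∈ Ioo x y ∧ v ∈ Ioo x y) ∨ (u ∈ Ioo y (x + 1) ∧ v ∈ Ioo y (x + 1)) := by
      have := hu.2
      have := hv.2
      simp only [mem_Ioo]
      grind [Alternate]
    have hsub : ∀ t ∈ Ioo x (x + 1), t ≠ y →
        (t : UnitAddCircle) ∈ ({(x : UnitAddCircle), (y : UnitAddCircle)}ᶜ : Set _) := by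
      intro t ht hty hm
      have ht' : t ∈ Ico x (x + 1) := ⟨ht.1.le, ht.2⟩
      rcases hm with h | h
      · exact ht.1.ne' ((coe_inj_of_mem_Ico ht' hx).1 h)
      · exact hty ((coe_inj_of_mem_Ico ht' hy).1 h)
    rcases hcase with ⟨h1, h2⟩ | ⟨h1, h2⟩
    · refine hC _ (isPreconnected_coe_image_Ioo x y) ?_ ⟨u, h1, rfl⟩ ⟨v, h2, rfl⟩
      rintro _ ⟨t, ht, rfl⟩
      exact hsub t ⟨ht.1, ht.2.trans hy.2⟩ ht.2.ne
    · refine hC _ (isPreconnected_coe_image_Ioo y (x + 1)) ?_ ⟨u, h1, rfl⟩ ⟨v, h2, rfl⟩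
      rintro _ ⟨t, ht, rfl⟩
      exact hsub t ⟨hxy.trans ht.1, ht.2⟩ ht.1.ne'

lemma ChordsCross.map {e f : Sym2 UnitAddCircle} (h : UnitAddCircle ≃ₜ UnitAddCircle)
    (hef : ChordsCross e f) : ChordsCross (e.map h) (f.map h) := by
  rw [chordsCross_iff_separated] at hef ⊢
  obtain ⟨a, b, c, d, rfl, rfl, hab, hc, hd, hC⟩ := hef
  refine ⟨h a, h b, h c, h d, rfl, rfl, h.injective.ne hab, ?_, ?_, ?_⟩
  · simpa [h.injective.eq_iff] using hc
  · simpa [h.injective.eq_iff] using hd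
  · intro C hpre hsub hcC hdC
    refine hC (h ⁻¹' C) (h.isPreconnected_preimage.2 hpre) ?_ hcC hdC
    intro p hp hm
    refine hsub hp ?_
    rcases hm with rfl | hm
    · exact Or.inl rfl
    · rw [mem_singleton_iff] at hm; exact Or.inr (by rw [hm]; rfl)

lemma chordsCross_map_iff {e f : Sym2 UnitAddCircle} (h : UnitAddCircle ≃ₜ UnitAddCircle) :
    ChordsCross (e.map h) (f.map h) ↔ ChordsCross e f := by
  refine ⟨fun hef => ?_, ChordsCross.map h⟩
  have := hef.map h.symm
  rwa [Sym2.map_map, Sym2.map_map, h.symm_comp_self, Sym2.map_id, id, id] at this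

namespace KnotProjection

lemma chords_eq_image {P Q : KnotProjection} {Φ : Sphere2 ≃ₜ Sphere2}
    {h : UnitAddCircle ≃ₜ UnitAddCircle} (hPQ : ∀ s, Q (h s) = Φ (P s)) :
    Q.chords = Sym2.map h '' P.chords := by
  ext e
  constructor
  · rintro ⟨s, t, hst, heq, rfl⟩
    obtain ⟨s, rfl⟩ := h.surjective s
    obtain ⟨t, rfl⟩ := h.surjective t
    refine ⟨s(s, t), ⟨s, t, fun h' => hst (by rw [h']), ?_, rfl⟩, rfl⟩
    rw [hPQ, hPQ] at heq
    exact Φ.injective heq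
  · rintro ⟨_, ⟨s, t, hst, heq, rfl⟩, rfl⟩
    exact ⟨h s, h t, h.injective.ne hst, by rw [hPQ, hPQ, heq], rfl⟩

lemma Equivalent.countSub_eq {P Q : KnotProjection} (hPQ : Equivalent P Q)
    {type : Set (Sym2 UnitAddCircle) → Prop}
    (htype : ∀ (h : UnitAddCircle ≃ₜ UnitAddCircle) S, type S → type (Sym2.map h '' S)) :
    Q.countSub type = P.countSub type := by
  obtain ⟨Φ, h, hΦ⟩ := hPQ
  have hinj : Function.Injective (Sym2.map h) := Sym2.map.injective h.injective
  have himg : ∀ S : Set (Sym2 UnitAddCircle), Sym2.map h.symm '' (Sym2.map h '' S) = S := by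
    intro S
    rw [← image_comp, ← Sym2.map_comp, h.symm_comp_self, Sym2.map_id, image_id]
  unfold countSub
  rw [← ncard_image_of_injective {S | S ⊆ P.chords ∧ type S} hinj.image_injective,
    chords_eq_image hΦ]
  congr 1
  ext S
  constructor
  · rintro ⟨hS, hT⟩
    obtain ⟨S, hS', rfl⟩ := subset_image_iff.1 hS
    exact ⟨S, ⟨hS', himg S ▸ htype h.symm _ hT⟩, rfl⟩
  · rintro ⟨S, ⟨hS, hT⟩, rfl⟩
    exact ⟨image_mono hS, htype h S hT⟩

lemma Equivalent.numbers_eq {P Q : KnotProjection} (hPQ : Equivalent P Q) :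
    Q.crossNumber = P.crossNumber ∧ Q.tripleNumber = P.tripleNumber ∧
      Q.hNumber = P.hNumber ∧ Q.iiiNumber = P.iiiNumber := by
  have hne : ∀ (h : UnitAddCircle ≃ₜ UnitAddCircle) (e f : Sym2 UnitAddCircle),
      e.map h ≠ f.map h ↔ e ≠ f := fun h e f => (Sym2.map.injective h.injective).ne_iff
  refine ⟨congrArg (Nat.cast : ℕ → ℤ) (hPQ.countSub_eq ?_),
    congrArg (Nat.cast : ℕ → ℤ) (hPQ.countSub_eq ?_),
    congrArg (Nat.cast : ℕ → ℤ) (hPQ.countSub_eq ?_),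
    congrArg (Nat.cast : ℕ → ℤ) (hPQ.countSub_eq ?_)⟩
  · rintro h _ ⟨e, f, h1, rfl, h2⟩
    refine ⟨e.map h, f.map h, ?_⟩
    simp only [hne, chordsCross_map_iff, image_insert_eq, image_singleton, true_and]
    exact ⟨h1, h2⟩
  · rintro h _ ⟨e, f, g, h1, h2, h3, rfl, h4⟩
    refine ⟨e.map h, f.map h, g.map h, ?_⟩
    simp only [hne, chordsCross_map_iff, image_insert_eq, image_singleton, true_and]
    exact ⟨h1, h2, h3, h4⟩
  · rintro h _ ⟨e, f, g, h1, h2, h3, rfl, h4⟩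
    refine ⟨e.map h, f.map h, g.map h, ?_⟩
    simp only [hne, chordsCross_map_iff, image_insert_eq, image_singleton, true_and]
    exact ⟨h1, h2, h3, h4⟩
  · rintro h _ ⟨e, f, g, k, h1, h2, h3, h4, h5, h6, rfl, h7⟩
    refine ⟨e.map h, f.map h, g.map h, k.map h, ?_⟩
    simp only [hne, chordsCross_map_iff, image_insert_eq, image_singleton, true_and]
    exact ⟨h1, h2, h3, h4, h5, h6, h7⟩

end KnotProjection

/-! ### The parity conditions of Gauss -/

namespace KnotProjection

lemma finite_chords (P : KnotProjection) : P.chords.Finite := by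
  refine (P.finite_double.image (fun p => s(p.1, p.2))).subset ?_
  rintro _ ⟨s, t, hst, h, rfl⟩
  exact ⟨(s, t), ⟨hst, h⟩, rfl⟩

/-- Distinct chords have no common end point. -/
lemma eq_of_mem_chords (P : KnotProjection) {e f : Sym2 UnitAddCircle} (he : e ∈ P.chords)
    (hf : f ∈ P.chords) {a : UnitAddCircle} (hae : a ∈ e) (haf : a ∈ f) : e = f := by
  obtain ⟨b, rfl⟩ := hae
  obtain ⟨c, rfl⟩ := haf
  have key : ∀ x, s(a, x) ∈ P.chords → a ≠ x ∧ P a = P x := by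
    rintro x ⟨s, t, hst, h, h'⟩
    rcases Sym2.eq_iff.1 h' with ⟨rfl, rfl⟩ | ⟨rfl, rfl⟩
    · exact ⟨hst, h⟩
    · exact ⟨hst.symm, h.symm⟩
  obtain ⟨hab, h1⟩ := key b he
  obtain ⟨hac, h2⟩ := key c hf
  rcases P.eq_or_eq_of_double hab h1 (h2.symm.trans h1) with h | h
  · exact absurd h.symm hac
  · rw [h]

/-- The chords joining two disjoint arcs are counted by their ends on the second arc. -/
lemma ncard_chords_between (P : KnotProjection) {a b c d : ℝ} (hbc : b ≤ c) (hda : d ≤ a + 1) :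
    {f ∈ P.chords | ∃ s ∈ Ioo a b, ∃ t ∈ Ioo c d,
        f = s((s : UnitAddCircle), (t : UnitAddCircle))}.ncard =
      {t ∈ Ioo c d | ∃ s ∈ Ioo a b, P (s : UnitAddCircle) = P (t : UnitAddCircle)}.ncard := by
  have hne : ∀ s ∈ Ioo a b, ∀ t ∈ Ioo c d, (s : UnitAddCircle) ≠ (t : UnitAddCircle) := by
    intro s hs t ht h
    have := (coe_inj_of_lt (by rw [abs_lt]; constructor <;> linarith [hs.1, hs.2, ht.1, ht.2])).1 h
    linarith [hs.1, hs.2, ht.1, ht.2]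
  have hex : ∀ t, t ∈ {t ∈ Ioo c d | ∃ s ∈ Ioo a b, P (s : UnitAddCircle) = P (t : UnitAddCircle)} →
      ∃ s ∈ Ioo a b, P (s : UnitAddCircle) = P (t : UnitAddCircle) := fun t ht => ht.2
  choose! g hg1 hg2 using hex
  rw [← InjOn.ncard_image (s := {t ∈ Ioo c d | ∃ s ∈ Ioo a b, P (s : UnitAddCircle) =
    P (t : UnitAddCircle)}) (f := fun t => s((g t : UnitAddCircle), (t : UnitAddCircle)))]
  · congr 1
    ext f
    constructor
    · rintro ⟨hf, s, hs, t, ht, rfl⟩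
      have hst : s(((s : ℝ) : UnitAddCircle), ((t : ℝ) : UnitAddCircle)) ∈ P.chords := hf
      have hP : P (s : UnitAddCircle) = P (t : UnitAddCircle) := by
        obtain ⟨x, y, -, h, h'⟩ := hf
        rcases Sym2.eq_iff.1 h' with ⟨h1, h2⟩ | ⟨h1, h2⟩
        · rw [h1, h2, h]
        · rw [h1, h2, h]
      have htm : t ∈ {t ∈ Ioo c d | ∃ s ∈ Ioo a b, P (s : UnitAddCircle) = P (t : UnitAddCircle)} :=
        ⟨ht, s, hs, hP⟩
      refine ⟨t, htm, ?_⟩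
      exact P.eq_of_mem_chords ⟨_, _, hne _ (hg1 t htm) t ht, hg2 t htm, rfl⟩ hf
        (Sym2.mem_mk_right _ _) (Sym2.mem_mk_right _ _)
    · rintro ⟨t, ht, rfl⟩
      exact ⟨⟨_, _, hne _ (hg1 t ht) t ht.1, hg2 t ht, rfl⟩, g t, hg1 t ht, t, ht.1, rfl⟩
  · intro t ht t' ht' h
    rcases Sym2.eq_iff.1 h with ⟨-, h2⟩ | ⟨h1, -⟩
    · exact (coe_inj_of_lt (by
        rw [abs_lt]; constructor <;>
          linarith [(hg1 t ht).1, (hg1 t ht).2, ht.1.1, ht.1.2, ht'.1.1, ht'.1.2])).1 h2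
    · exact absurd h1 (hne _ (hg1 t ht) _ ht'.1)

/-- Real parameters of a chord. -/
lemma exists_params (P : KnotProjection) {e : Sym2 UnitAddCircle} (he : e ∈ P.chords) :
    ∃ a b : ℝ, a < b ∧ b < a + 1 ∧ e = s((a : UnitAddCircle), (b : UnitAddCircle)) ∧
      P (a : UnitAddCircle) = P (b : UnitAddCircle) := by
  obtain ⟨p, q, hpq, h, rfl⟩ := he
  obtain ⟨a, rfl⟩ := QuotientAddGroup.mk_surjective p
  obtain ⟨b, hb, rfl⟩ := exists_coe_mem_Ico a q
  exact ⟨a, b, lt_of_le_of_ne hb.1 (fun h => hpq (by rw [h])), hb.2, rfl, h⟩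

/-- Gauss's parity condition: every chord crosses an even number of chords. -/
theorem even_ncard_crossing (P : KnotProjection) {e : Sym2 UnitAddCircle} (he : e ∈ P.chords) :
    Even {f ∈ P.chords | ChordsCross e f}.ncard := by
  obtain ⟨a, b, hab, hba, rfl, hP⟩ := P.exists_params he
  have key := P.even_ncard_arcs hab le_rfl hba le_rfl hP
    (by rw [AddCircle.coe_add_period]; exact hP.symm) (Or.inl ⟨rfl, rfl⟩)
  rw [← P.ncard_chords_between le_rfl le_rfl] at key
  convert key using 3
  ext f
  refine and_congr_right fun hf => ?_
  have ha' : a ∈ Ico a (a + 1) := ⟨le_rfl, by linarith⟩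
  have hb' : b ∈ Ico a (a + 1) := ⟨hab.le, hba⟩
  constructor
  · intro h
    induction f using Sym2.ind with | _ c d
    obtain ⟨u, hu, rfl⟩ := exists_coe_mem_Ico a c
    obtain ⟨v, hv, rfl⟩ := exists_coe_mem_Ico a d
    rw [chordsCross_coe_iff ha' hb' hu hv] at h
    have hu1 := hu.1
    have hv1 := hv.1
    rcases lt_or_ge u b with hub | hub
    · exact ⟨u, ⟨by grind [Alternate], hub⟩, v, ⟨by grind [Alternate], hv.2⟩, rfl⟩
    · exact ⟨v, ⟨by grind [Alternate], by grind [Alternate]⟩, u, ⟨by grind [Alternate], hu.2⟩,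
        Sym2.eq_swap⟩
  · rintro ⟨s, hs, t, ht, rfl⟩
    rw [chordsCross_coe_iff ha' hb' ⟨hs.1.le, hs.2.trans hba⟩ ⟨by linarith [ht.1], ht.2⟩]
    exact Or.inl ⟨hs.1, hs.2, ht.1⟩

/-- The case in which the ends of the two chords follow each other in the order `a, b, c, d`. -/
lemma even_ncard_common_of_lt (P : KnotProjection) {a b c d : ℝ} (hab : a < b) (hbc : b < c)
    (hcd : c < d) (hda : d < a + 1) (hP : P (a : UnitAddCircle) = P (b : UnitAddCircle))
    (hP' : P (c : UnitAddCircle) = P (d : UnitAddCircle)) :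
    Even {g ∈ P.chords | ChordsCross s((a : UnitAddCircle), (b : UnitAddCircle)) g ∧
      ChordsCross s((c : UnitAddCircle), (d : UnitAddCircle)) g}.ncard := by
  have key := P.even_ncard_arcs hab hbc.le hcd hda.le hP hP' (Or.inr ⟨hbc, hda⟩)
  rw [← P.ncard_chords_between hbc.le hda.le] at key
  convert key using 3
  ext f
  refine and_congr_right fun hf => ?_
  have ha' : a ∈ Ico a (a + 1) := ⟨le_rfl, by linarith⟩
  have hb' : b ∈ Ico a (a + 1) := ⟨hab.le, by linarith⟩
  have hc' : c ∈ Ico a (a + 1) := ⟨by linarith, by linarith⟩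
  have hd' : d ∈ Ico a (a + 1) := ⟨by linarith, by linarith⟩
  constructor
  · rintro ⟨h, h'⟩
    induction f using Sym2.ind with | _ x y
    obtain ⟨u, hu, rfl⟩ := exists_coe_mem_Ico a x
    obtain ⟨v, hv, rfl⟩ := exists_coe_mem_Ico a y
    rw [chordsCross_coe_iff ha' hb' hu hv] at h
    rw [chordsCross_coe_iff hc' hd' hu hv] at h'
    have hu1 := hu.1
    have hv1 := hv.1
    rcases lt_or_ge u b with hub | hub
    · exact ⟨u, ⟨by grind [Alternate], hub⟩, v,
        ⟨by grind [Alternate], by grind [Alternate]⟩, rfl⟩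
    · exact ⟨v, ⟨by grind [Alternate], by grind [Alternate]⟩, u,
        ⟨by grind [Alternate], by grind [Alternate]⟩, Sym2.eq_swap⟩
  · rintro ⟨s, hs, t, ht, rfl⟩
    have hs' : s ∈ Ico a (a + 1) := ⟨hs.1.le, by linarith [hs.2]⟩
    have ht' : t ∈ Ico a (a + 1) := ⟨by linarith [ht.1], by linarith [ht.2]⟩
    rw [chordsCross_coe_iff ha' hb' hs' ht', chordsCross_coe_iff hc' hd' hs' ht']
    obtain ⟨hs1, hs2⟩ := hs
    obtain ⟨ht1, ht2⟩ := ht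
    constructor <;> grind [Alternate]

/-- Gauss's second parity condition: two parallel chords are crossed by an even number of common
chords. -/
theorem even_ncard_common (P : KnotProjection) {e f : Sym2 UnitAddCircle} (he : e ∈ P.chords)
    (hf : f ∈ P.chords) (hef : e ≠ f) (hpar : ¬ ChordsCross e f) :
    Even {g ∈ P.chords | ChordsCross e g ∧ ChordsCross f g}.ncard := by
  obtain ⟨a, b, hab, hba, rfl, hP⟩ := P.exists_params he
  obtain ⟨c, d, hcd, hda, hc, hd, rfl, hP'⟩ : ∃ c d : ℝ, c < d ∧ d < a + 1 ∧ a ≤ c ∧ c < a + 1 ∧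
      f = s((c : UnitAddCircle), (d : UnitAddCircle)) ∧
      P (c : UnitAddCircle) = P (d : UnitAddCircle) := by
    obtain ⟨p, q, hpq, h, rfl⟩ := hf
    obtain ⟨c, hc, rfl⟩ := exists_coe_mem_Ico a p
    obtain ⟨d, hd, rfl⟩ := exists_coe_mem_Ico a q
    rcases lt_trichotomy c d with hlt | heq | hgt
    · exact ⟨c, d, hlt, hd.2, hc.1, hc.2, rfl, h⟩
    · exact absurd (by rw [heq]) hpq
    · exact ⟨d, c, hgt, hc.2, hd.1, hd.2, Sym2.eq_swap, h.symm⟩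
  have ha' : a ∈ Ico a (a + 1) := ⟨le_rfl, by linarith⟩
  have hb' : b ∈ Ico a (a + 1) := ⟨hab.le, hba⟩
  have hc' : c ∈ Ico a (a + 1) := ⟨hc, hd⟩
  have hd' : d ∈ Ico a (a + 1) := ⟨by linarith, hda⟩
  rw [chordsCross_coe_iff ha' hb' hc' hd'] at hpar
  have hsep : ∀ x ∈ ({a, b} : Set ℝ), ∀ y ∈ ({c, d} : Set ℝ), x ≠ y := by
    rintro x hx y hy rfl
    refine hef (P.eq_of_mem_chords he hf (a := (x : UnitAddCircle)) ?_ ?_)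
    · rcases hx with rfl | rfl <;> simp
    · rcases hy with rfl | rfl <;> simp
  have hac := hsep a (by simp) c (by simp)
  have had := hsep a (by simp) d (by simp)
  have hbc := hsep b (by simp) c (by simp)
  have hbd := hsep b (by simp) d (by simp)
  have hcase : b < c ∨ d < b := by grind [Alternate]
  rcases hcase with h | h
  · exact P.even_ncard_common_of_lt hab h hcd hda hP hP'
  · have hac' : a < c := lt_of_le_of_ne hc hac
    have key := P.even_ncard_common_of_lt hcd h (show b < a + 1 from hba) (by linarith) hP'
      (by rw [AddCircle.coe_add_period]; exact hP.symm)
    rw [AddCircle.coe_add_period, Sym2.eq_swap (a := (b : UnitAddCircle))] at key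
    simpa only [and_comm (a := ChordsCross s((a : UnitAddCircle), (b : UnitAddCircle)) _)] using key

end KnotProjection

/-! ### Counting sub-chord diagrams by their new chords -/

section

open scoped Classical

/-- A set of `n` pairwise crossing chords. -/
def IsClique (n : ℕ) (U : Finset (Sym2 UnitAddCircle)) : Prop :=
  U.card = n ∧ ∀ e ∈ U, ∀ f ∈ U, e ≠ f → ChordsCross e f

/-- A set of `n` pairwise parallel chords together with a chord that crosses all of them. -/
def IsStar (n : ℕ) (U : Finset (Sym2 UnitAddCircle)) : Prop :=
  U.card = n + 1 ∧ ∃ e ∈ U, ∀ f ∈ U, f ≠ e → ChordsCross e f ∧ ∀ g ∈ U, g ≠ e → ¬ ChordsCross f g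

lemma isCrossChord_iff {U : Finset (Sym2 UnitAddCircle)} :
    IsCrossChord (U : Set (Sym2 UnitAddCircle)) ↔ IsClique 2 U := by
  constructor
  · rintro ⟨e, f, hef, hU, h⟩
    have : U = {e, f} := by rw [← Finset.coe_inj, hU]; simp
    subst this
    refine ⟨Finset.card_pair hef, ?_⟩
    have := h.symm
    simp only [Finset.mem_insert, Finset.mem_singleton]
    rintro x (rfl | rfl) y (rfl | rfl) <;> simp_all
  · rintro ⟨hc, h⟩
    obtain ⟨e, f, hef, rfl⟩ := Finset.card_eq_two.1 hc
    exact ⟨e, f, hef, by simp, h e (by simp) f (by simp) hef⟩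

lemma isTripleChord_iff {U : Finset (Sym2 UnitAddCircle)} :
    IsTripleChord (U : Set (Sym2 UnitAddCircle)) ↔ IsClique 3 U := by
  constructor
  · rintro ⟨e, f, g, hef, heg, hfg, hU, h1, h2, h3⟩
    have : U = {e, f, g} := by rw [← Finset.coe_inj, hU]; simp
    subst this
    refine ⟨Finset.card_eq_three.2 ⟨e, f, g, hef, heg, hfg, rfl⟩, ?_⟩
    have := h1.symm
    have := h2.symm
    have := h3.symm
    simp only [Finset.mem_insert, Finset.mem_singleton]
    rintro x (rfl | rfl | rfl) y (rfl | rfl | rfl) <;> simp_all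
  · rintro ⟨hc, h⟩
    obtain ⟨e, f, g, hef, heg, hfg, rfl⟩ := Finset.card_eq_three.1 hc
    exact ⟨e, f, g, hef, heg, hfg, by simp, h e (by simp) f (by simp) hef,
      h e (by simp) g (by simp) heg, h f (by simp) g (by simp) hfg⟩

lemma isHChord_iff {U : Finset (Sym2 UnitAddCircle)} :
    IsHChord (U : Set (Sym2 UnitAddCircle)) ↔ IsStar 2 U := by
  constructor
  · rintro ⟨e, f, g, hef, heg, hfg, hU, h1, h2, h3⟩
    have : U = {e, f, g} := by rw [← Finset.coe_inj, hU]; simp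
    subst this
    refine ⟨Finset.card_eq_three.2 ⟨e, f, g, hef, heg, hfg, rfl⟩, e, by simp, ?_⟩
    have := not_chordsCross_self f
    have := not_chordsCross_self g
    have h3' := mt ChordsCross.symm h3
    simp only [Finset.mem_insert, Finset.mem_singleton]
    rintro x (rfl | rfl | rfl) hx
    · exact absurd rfl hx
    · refine ⟨h1, ?_⟩; rintro y (rfl | rfl | rfl) hy <;> simp_all
    · refine ⟨h2, ?_⟩; rintro y (rfl | rfl | rfl) hy <;> simp_all
  · rintro ⟨hc, e, he, h⟩
    have hc' : (U.erase e).card = 2 := by rw [Finset.card_erase_of_mem he, hc]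
    obtain ⟨f, g, hfg, hU⟩ := Finset.card_eq_two.1 hc'
    have hf : f ∈ U.erase e := by simp [hU]
    have hg : g ∈ U.erase e := by simp [hU]
    rw [Finset.mem_erase] at hf hg
    refine ⟨e, f, g, hf.1.symm, hg.1.symm, hfg, ?_, (h f hf.2 hf.1).1, (h g hg.2 hg.1).1,
      (h f hf.2 hf.1).2 g hg.2 hg.1⟩
    rw [← Finset.insert_erase he, hU]; simp

lemma isIIIChord_iff {U : Finset (Sym2 UnitAddCircle)} :
    IsIIIChord (U : Set (Sym2 UnitAddCircle)) ↔ IsStar 3 U := by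
  constructor
  · rintro ⟨e, f, g, k, hef, heg, hek, hfg, hfk, hgk, hU, h1, h2, h3, h4, h5, h6⟩
    have : U = {e, f, g, k} := by rw [← Finset.coe_inj, hU]; simp
    subst this
    refine ⟨by simp [*], e, by simp, ?_⟩
    have := not_chordsCross_self f
    have := not_chordsCross_self g
    have := not_chordsCross_self k
    have h4' := mt ChordsCross.symm h4
    have h5' := mt ChordsCross.symm h5
    have h6' := mt ChordsCross.symm h6
    simp only [Finset.mem_insert, Finset.mem_singleton]
    rintro x (rfl | rfl | rfl | rfl) hx
    · exact absurd rfl hx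
    · refine ⟨h1, ?_⟩; rintro y (rfl | rfl | rfl | rfl) hy <;> simp_all
    · refine ⟨h2, ?_⟩; rintro y (rfl | rfl | rfl | rfl) hy <;> simp_all
    · refine ⟨h3, ?_⟩; rintro y (rfl | rfl | rfl | rfl) hy <;> simp_all
  · rintro ⟨hc, e, he, h⟩
    have hc' : (U.erase e).card = 3 := by rw [Finset.card_erase_of_mem he, hc]
    obtain ⟨f, g, k, hfg, hfk, hgk, hU⟩ := Finset.card_eq_three.1 hc'
    have hf : f ∈ U.erase e := by simp [hU]
    have hg : g ∈ U.erase e := by simp [hU]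
    have hk : k ∈ U.erase e := by simp [hU]
    rw [Finset.mem_erase] at hf hg hk
    refine ⟨e, f, g, k, hf.1.symm, hg.1.symm, hk.1.symm, hfg, hfk, hgk, ?_, (h f hf.2 hf.1).1,
      (h g hg.2 hg.1).1, (h k hk.2 hk.1).1, (h f hf.2 hf.1).2 g hg.2 hg.1,
      (h f hf.2 hf.1).2 k hk.2 hk.1, (h g hg.2 hg.1).2 k hk.2 hk.1⟩
    rw [← Finset.insert_erase he, hU]; simp

/-- The number of sets of chords in `V` that the chords in `T` complete to a set of the given
type. -/
noncomputable def extCount (type : Finset (Sym2 UnitAddCircle) → Prop)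
    (V T : Finset (Sym2 UnitAddCircle)) : ℕ :=
  (V.powerset.filter fun S => type (S ∪ T)).card

/-- The sub-chord diagrams of a given type, sorted by their part in a subset `C` of the chords. -/
lemma KnotProjection.countSub_eq_sum (P : KnotProjection)
    {type : Set (Sym2 UnitAddCircle) → Prop} {type' : Finset (Sym2 UnitAddCircle) → Prop}
    (htype : ∀ U : Finset (Sym2 UnitAddCircle), type U ↔ type' U)
    {V C : Finset (Sym2 UnitAddCircle)} (hVC : Disjoint V C)
    (hP : P.chords = ((V ∪ C : Finset (Sym2 UnitAddCircle)) : Set (Sym2 UnitAddCircle))) :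
    P.countSub type = ∑ T ∈ C.powerset, extCount type' V T := by
  have h1 : {S : Set (Sym2 UnitAddCircle) | S ⊆ P.chords ∧ type S} =
      (fun U : Finset (Sym2 UnitAddCircle) => (U : Set (Sym2 UnitAddCircle))) ''
        (((V ∪ C).powerset.filter type' : Finset (Finset (Sym2 UnitAddCircle))) : Set _) := by
    ext S
    constructor
    · rintro ⟨hS, hT⟩
      have hfin : S.Finite := P.finite_chords.subset hS
      refine ⟨hfin.toFinset, ?_, hfin.coe_toFinset⟩
      simp only [Finset.coe_filter, Finset.mem_powerset, mem_ofPred_eq]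
      refine ⟨?_, (htype _).1 (by rwa [hfin.coe_toFinset])⟩
      rw [← Finset.coe_subset, hfin.coe_toFinset, ← hP]; exact hS
    · rintro ⟨U, hU, rfl⟩
      simp only [Finset.coe_filter, Finset.mem_powerset, mem_ofPred_eq] at hU
      exact ⟨by rw [hP]; exact_mod_cast hU.1, (htype U).2 hU.2⟩
  unfold KnotProjection.countSub
  rw [h1, ncard_image_of_injective _ Finset.coe_injective, ncard_coe_finset,
    Finset.card_eq_sum_card_fiberwise (f := fun U => U ∩ C) (t := C.powerset)]
  · refine Finset.sum_congr rfl fun T hT => ?_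
    rw [Finset.mem_powerset] at hT
    refine Finset.card_bij' (fun U _ => U \ C) (fun S _ => S ∪ T) ?_ ?_ ?_ ?_
    · intro U hU
      simp only [Finset.mem_filter, Finset.mem_powerset] at hU ⊢
      obtain ⟨⟨hU1, hU2⟩, rfl⟩ := hU
      rw [Finset.sdiff_union_inter]
      refine ⟨fun x hx => ?_, hU2⟩
      rw [Finset.mem_sdiff] at hx
      exact (Finset.mem_union.1 (hU1 hx.1)).resolve_right hx.2
    · intro S hS
      simp only [Finset.mem_filter, Finset.mem_powerset] at hS ⊢
      refine ⟨⟨Finset.union_subset_union hS.1 hT, hS.2⟩, ?_⟩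
      rw [Finset.union_inter_distrib_right, Finset.inter_eq_left.2 hT,
        Finset.disjoint_iff_inter_eq_empty.1 (hVC.mono_left hS.1), Finset.empty_union]
    · intro U hU
      simp only [Finset.mem_filter, Finset.mem_powerset] at hU
      rw [← hU.2, Finset.sdiff_union_inter]
    · intro S hS
      simp only [Finset.mem_filter, Finset.mem_powerset] at hS
      rw [Finset.union_sdiff_distrib, Finset.sdiff_eq_empty_iff_subset.2 hT, Finset.union_empty,
        Finset.sdiff_eq_self_of_disjoint (hVC.mono_left hS.1)]
  · intro U hU
    simp

lemma IsClique.image {n : ℕ} {U : Finset (Sym2 UnitAddCircle)} (h : IsClique n U)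
    {φ : Sym2 UnitAddCircle → Sym2 UnitAddCircle} (hinj : Set.InjOn φ U)
    (hφ : ∀ e ∈ U, ∀ f ∈ U, ChordsCross (φ e) (φ f) ↔ ChordsCross e f) :
    IsClique n (U.image φ) := by
  refine ⟨by rw [Finset.card_image_of_injOn hinj, h.1], ?_⟩
  simp only [Finset.mem_image]
  rintro _ ⟨e, he, rfl⟩ _ ⟨f, hf, rfl⟩ hne
  exact (hφ e he f hf).2 (h.2 e he f hf fun h => hne (by rw [h]))

lemma IsStar.image {n : ℕ} {U : Finset (Sym2 UnitAddCircle)} (h : IsStar n U)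
    {φ : Sym2 UnitAddCircle → Sym2 UnitAddCircle} (hinj : Set.InjOn φ U)
    (hφ : ∀ e ∈ U, ∀ f ∈ U, ChordsCross (φ e) (φ f) ↔ ChordsCross e f) :
    IsStar n (U.image φ) := by
  obtain ⟨hc, e, he, h⟩ := h
  refine ⟨by rw [Finset.card_image_of_injOn hinj, hc], φ e, Finset.mem_image_of_mem φ he, ?_⟩
  simp only [Finset.mem_image]
  rintro _ ⟨f, hf, rfl⟩ hne
  have hfe : f ≠ e := fun h => hne (by rw [h])
  refine ⟨(hφ e he f hf).2 (h f hf hfe).1, ?_⟩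
  rintro _ ⟨g, hg, rfl⟩ hge hcr
  exact (h f hf hfe).2 g hg (fun h => hge (by rw [h])) ((hφ f hf g hg).1 hcr)

/-- Chords that cross the same chords of `V` extend equally many subsets of `V` to a set of a type
that depends on the crossings only. -/
lemma extCount_singleton_congr {type : Finset (Sym2 UnitAddCircle) → Prop}
    (htype : ∀ (U : Finset (Sym2 UnitAddCircle)) (φ : Sym2 UnitAddCircle → Sym2 UnitAddCircle),
      Set.InjOn φ U → (∀ e ∈ U, ∀ f ∈ U, ChordsCross (φ e) (φ f) ↔ ChordsCross e f) →
      type U → type (U.image φ))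
    {V : Finset (Sym2 UnitAddCircle)} {c c' : Sym2 UnitAddCircle} (hc : c ∉ V) (hc' : c' ∉ V)
    (h : ∀ d ∈ V, ChordsCross c d ↔ ChordsCross c' d) :
    extCount type V {c} = extCount type V {c'} := by
  have key : ∀ c c' : Sym2 UnitAddCircle, c ∉ V → c' ∉ V →
      (∀ d ∈ V, ChordsCross c d ↔ ChordsCross c' d) →
      ∀ S ⊆ V, type (S ∪ {c}) → type (S ∪ {c'}) := by
    intro c c' hc hc' h S hS hT
    have hsw : ∀ d ∈ V, Equiv.swap c c' d = d := fun d hd =>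
      Equiv.swap_apply_of_ne_of_ne (fun e => hc (e ▸ hd)) (fun e => hc' (e ▸ hd))
    have := htype _ (Equiv.swap c c') (Equiv.swap c c').injective.injOn ?_ hT
    · rw [Finset.image_union, Finset.image_singleton, Equiv.swap_apply_left] at this
      convert this
      symm
      calc S.image (Equiv.swap c c') = S.image id := Finset.image_congr fun d hd => hsw d (hS hd)
        _ = S := Finset.image_id
    · simp only [Finset.mem_union, Finset.mem_singleton]
      rintro e (he | rfl) f (hf | rfl)
      · rw [hsw e (hS he), hsw f (hS hf)]
      · rw [hsw e (hS he), Equiv.swap_apply_left, chordsCross_comm, ← h e (hS he), chordsCross_comm]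
      · rw [hsw f (hS hf), Equiv.swap_apply_left, h f (hS hf)]
      · exact iff_of_false (not_chordsCross_self _) (not_chordsCross_self _)
  unfold extCount
  congr 1
  refine Finset.filter_congr fun S hS => ?_
  rw [Finset.mem_powerset] at hS
  exact ⟨key c c' hc hc' h S hS, key c' c hc' hc (fun d hd => (h d hd).symm) S hS⟩

end

/-! ### Extensions of a pair of chords -/

section

open scoped Classical

lemma extCount_eq_ite {type : Finset (Sym2 UnitAddCircle) → Prop}
    {V T : Finset (Sym2 UnitAddCircle)} {q : Prop} [Decidable q]
    (h : ∀ S ⊆ V, type (S ∪ T) ↔ S = ∅ ∧ q) : extCount type V T = if q then 1 else 0 := by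
  unfold extCount
  split_ifs with hq
  · rw [Finset.card_eq_one]
    refine ⟨∅, ?_⟩
    ext S
    simp only [Finset.mem_filter, Finset.mem_powerset, Finset.mem_singleton]
    exact ⟨fun hS => ((h S hS.1).1 hS.2).1, fun hS => by
      subst hS; exact ⟨Finset.empty_subset _, (h ∅ (Finset.empty_subset _)).2 ⟨rfl, hq⟩⟩⟩
  · rw [Finset.card_eq_zero, Finset.filter_eq_empty_iff]
    intro S hS hT
    exact hq ((h S (Finset.mem_powerset.1 hS)).1 hT).2

lemma extCount_eq_card_filter {type : Finset (Sym2 UnitAddCircle) → Prop}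
    {V T : Finset (Sym2 UnitAddCircle)} {p : Sym2 UnitAddCircle → Prop}
    (h : ∀ S ⊆ V, type (S ∪ T) ↔ ∃ d, S = {d} ∧ p d) :
    extCount type V T = (V.filter p).card := by
  unfold extCount
  rw [← Finset.card_image_of_injective (V.filter p) (Finset.singleton_injective)]
  congr 1
  ext S
  simp only [Finset.mem_filter, Finset.mem_powerset, Finset.mem_image]
  constructor
  · rintro ⟨hS, hT⟩
    obtain ⟨d, rfl, hd⟩ := (h S hS).1 hT
    exact ⟨d, ⟨Finset.singleton_subset_iff.1 hS, hd⟩, rfl⟩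
  · rintro ⟨d, ⟨hd, hp⟩, rfl⟩
    have := Finset.singleton_subset_iff.2 hd
    exact ⟨this, (h _ this).2 ⟨d, rfl, hp⟩⟩

lemma extCount_eq_zero {type : Finset (Sym2 UnitAddCircle) → Prop}
    {V T : Finset (Sym2 UnitAddCircle)} (h : ∀ S ⊆ V, ¬ type (S ∪ T)) : extCount type V T = 0 := by
  unfold extCount
  rw [Finset.card_eq_zero, Finset.filter_eq_empty_iff]
  exact fun S hS => h S (Finset.mem_powerset.1 hS)

variable {V : Finset (Sym2 UnitAddCircle)} {c₁ c₂ : Sym2 UnitAddCircle}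

lemma card_union_of_subset {S T : Finset (Sym2 UnitAddCircle)} (hT : Disjoint V T) (hS : S ⊆ V) :
    (S ∪ T).card = S.card + T.card :=
  Finset.card_union_of_disjoint (hT.mono_left hS)

lemma isClique_three_iff {x y z : Sym2 UnitAddCircle} (hxy : x ≠ y) (hxz : x ≠ z) (hyz : y ≠ z) :
    IsClique 3 {x, y, z} ↔ ChordsCross x y ∧ ChordsCross x z ∧ ChordsCross y z := by
  have h1 := chordsCross_comm (e := x) (f := y)
  have h2 := chordsCross_comm (e := x) (f := z)
  have h3 := chordsCross_comm (e := y) (f := z)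
  simp only [IsClique, Finset.card_eq_three.2 ⟨x, y, z, hxy, hxz, hyz, rfl⟩, true_and,
    Finset.mem_insert, Finset.mem_singleton, forall_eq_or_imp, forall_eq]
  grind

lemma isStar_two_iff {x y z : Sym2 UnitAddCircle} (hxy : x ≠ y) (hxz : x ≠ z) (hyz : y ≠ z) :
    IsStar 2 {x, y, z} ↔ (ChordsCross x y ∧ ChordsCross x z ∧ ¬ ChordsCross y z) ∨
      (ChordsCross x y ∧ ¬ ChordsCross x z ∧ ChordsCross y z) ∨
      (¬ ChordsCross x y ∧ ChordsCross x z ∧ ChordsCross y z) := by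
  have h1 := chordsCross_comm (e := x) (f := y)
  have h2 := chordsCross_comm (e := x) (f := z)
  have h3 := chordsCross_comm (e := y) (f := z)
  have := not_chordsCross_self x
  have := not_chordsCross_self y
  have := not_chordsCross_self z
  simp only [IsStar, Finset.card_eq_three.2 ⟨x, y, z, hxy, hxz, hyz, rfl⟩, true_and,
    Finset.mem_insert, Finset.mem_singleton, exists_eq_or_imp, exists_eq_left,
    forall_eq_or_imp, forall_eq]
  grind

lemma extCount_pair_clique_two (hc : c₁ ≠ c₂) (hV : Disjoint V {c₁, c₂}) :
    extCount (IsClique 2) V {c₁, c₂} = if ChordsCross c₁ c₂ then 1 else 0 := by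
  apply extCount_eq_ite
  intro S hS
  have hcard := card_union_of_subset hV hS
  rw [Finset.card_pair hc] at hcard
  constructor
  · rintro ⟨h2, h⟩
    refine ⟨Finset.card_eq_zero.1 (by omega), h c₁ (by simp) c₂ (by simp) hc⟩
  · rintro ⟨rfl, h⟩
    have := h.symm
    rw [Finset.empty_union]
    refine ⟨Finset.card_pair hc, ?_⟩
    simp only [Finset.mem_insert, Finset.mem_singleton]
    rintro x (rfl | rfl) y (rfl | rfl) <;> simp_all

lemma ne_of_disjoint_pair (hV : Disjoint V {c₁, c₂}) {d : Sym2 UnitAddCircle} (hd : d ∈ V) :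
    d ≠ c₁ ∧ d ≠ c₂ := by
  have := Finset.disjoint_left.1 hV hd
  simpa [not_or] using this

lemma extCount_pair_clique_three (hc : c₁ ≠ c₂) (hV : Disjoint V {c₁, c₂}) :
    extCount (IsClique 3) V {c₁, c₂} =
      if ChordsCross c₁ c₂ then (V.filter fun d => ChordsCross c₁ d ∧ ChordsCross c₂ d).card
      else 0 := by
  have key : ∀ S ⊆ V, IsClique 3 (S ∪ {c₁, c₂}) ↔ ∃ d, S = {d} ∧
      (ChordsCross c₁ c₂ ∧ ChordsCross c₁ d ∧ ChordsCross c₂ d) := by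
    intro S hS
    have hcard := card_union_of_subset hV hS
    rw [Finset.card_pair hc] at hcard
    have hsingle : ∀ d ∈ V, IsClique 3 ({d} ∪ {c₁, c₂}) ↔
        (ChordsCross c₁ c₂ ∧ ChordsCross c₁ d ∧ ChordsCross c₂ d) := by
      intro d hd
      obtain ⟨h1, h2⟩ := ne_of_disjoint_pair hV hd
      rw [← Finset.insert_eq, isClique_three_iff h1 h2 hc, chordsCross_comm (e := d) (f := c₁),
        chordsCross_comm (e := d) (f := c₂)]
      tauto
    constructor
    · intro h
      obtain ⟨d, rfl⟩ := Finset.card_eq_one.1 (show S.card = 1 by have := h.1; omega)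
      exact ⟨d, rfl, (hsingle d (Finset.singleton_subset_iff.1 hS)).1 h⟩
    · rintro ⟨d, rfl, h⟩
      exact (hsingle d (Finset.singleton_subset_iff.1 hS)).2 h
  rw [extCount_eq_card_filter key]
  split_ifs with h <;> simp [h]

lemma extCount_pair_star_two (hc : c₁ ≠ c₂) (hV : Disjoint V {c₁, c₂}) :
    extCount (IsStar 2) V {c₁, c₂} =
      if ChordsCross c₁ c₂ then (V.filter fun d => ChordsCross c₁ d ∧ ¬ ChordsCross c₂ d).card +
        (V.filter fun d => ChordsCross c₂ d ∧ ¬ ChordsCross c₁ d).card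
      else (V.filter fun d => ChordsCross c₁ d ∧ ChordsCross c₂ d).card := by
  have key : ∀ S ⊆ V, IsStar 2 (S ∪ {c₁, c₂}) ↔ ∃ d, S = {d} ∧
      ((ChordsCross c₁ c₂ ∧ (ChordsCross c₁ d ∧ ¬ ChordsCross c₂ d ∨
        ChordsCross c₂ d ∧ ¬ ChordsCross c₁ d)) ∨
        (¬ ChordsCross c₁ c₂ ∧ ChordsCross c₁ d ∧ ChordsCross c₂ d)) := by
    intro S hS
    have hcard := card_union_of_subset hV hS
    rw [Finset.card_pair hc] at hcard
    have hsingle : ∀ d ∈ V, IsStar 2 ({d} ∪ {c₁, c₂}) ↔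
        ((ChordsCross c₁ c₂ ∧ (ChordsCross c₁ d ∧ ¬ ChordsCross c₂ d ∨
        ChordsCross c₂ d ∧ ¬ ChordsCross c₁ d)) ∨
        (¬ ChordsCross c₁ c₂ ∧ ChordsCross c₁ d ∧ ChordsCross c₂ d)) := by
      intro d hd
      obtain ⟨h1, h2⟩ := ne_of_disjoint_pair hV hd
      rw [← Finset.insert_eq, isStar_two_iff h1 h2 hc, chordsCross_comm (e := d) (f := c₁),
        chordsCross_comm (e := d) (f := c₂)]
      tauto
    constructor
    · intro h
      obtain ⟨d, rfl⟩ := Finset.card_eq_one.1 (show S.card = 1 by have := h.1; omega)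
      exact ⟨d, rfl, (hsingle d (Finset.singleton_subset_iff.1 hS)).1 h⟩
    · rintro ⟨d, rfl, h⟩
      exact (hsingle d (Finset.singleton_subset_iff.1 hS)).2 h
  rw [extCount_eq_card_filter key]
  split_ifs with h
  · rw [← Finset.card_union_of_disjoint, ← Finset.filter_or]
    · simp [h]
    · rw [Finset.disjoint_filter]; tauto
  · simp [h]

/-- The number of pairs of parallel chords in `W`. -/
noncomputable def parallelPairs (W : Finset (Sym2 UnitAddCircle)) : ℕ :=
  ((W.powersetCard 2).filter fun S => ∀ d ∈ S, ∀ e ∈ S, ¬ ChordsCross d e).card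

/-- The number of crossings between a chord of `M` and a chord of `Z`, as ordered pairs. -/
noncomputable def crossingPairs (M Z : Finset (Sym2 UnitAddCircle)) : ℕ :=
  ((M ×ˢ Z).filter fun p => ChordsCross p.1 p.2).card

/-- If `c₁` and `c₂` cross, one of them is the chord of the star that crosses all the others. -/
lemma extCount_pair_star_three_of_cross (hc : c₁ ≠ c₂) (hV : Disjoint V {c₁, c₂})
    (h12 : ChordsCross c₁ c₂) :
    extCount (IsStar 3) V {c₁, c₂} =
      parallelPairs (V.filter fun d => ChordsCross c₁ d ∧ ¬ ChordsCross c₂ d) +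
        parallelPairs (V.filter fun d => ChordsCross c₂ d ∧ ¬ ChordsCross c₁ d) := by
  unfold extCount parallelPairs
  rw [← Finset.card_union_of_disjoint]
  · congr 1
    ext S
    simp only [Finset.mem_filter, Finset.mem_powerset, Finset.mem_union, Finset.mem_powersetCard]
    have hcard : S ⊆ V → (S ∪ {c₁, c₂}).card = S.card + 2 := fun hS => by
      rw [card_union_of_subset hV hS, Finset.card_pair hc]
    constructor
    · rintro ⟨hS, hU, e, he, h⟩
      rw [hcard hS] at hU
      have hne : ∀ d ∈ S, d ≠ c₁ ∧ d ≠ c₂ := fun d hd => ne_of_disjoint_pair hV (hS hd)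
      rw [Finset.mem_union, Finset.mem_insert, Finset.mem_singleton] at he
      rcases he with he | rfl | rfl
      · exact absurd h12 ((h c₁ (by simp) (hne e he).1.symm).2 c₂ (by simp) (hne e he).2.symm)
      · refine Or.inl ⟨⟨fun d hd => ?_, by omega⟩, fun d hd f hf => ?_⟩
        · have h1 := h d (by simp [hd]) (hne d hd).1
          rw [Finset.mem_filter]
          refine ⟨hS hd, h1.1, fun hcr => ?_⟩
          exact h1.2 c₂ (by simp) hc.symm hcr.symm
        · exact (h d (by simp [hd]) (hne d hd).1).2 f (by simp [hf]) (hne f hf).1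
      · refine Or.inr ⟨⟨fun d hd => ?_, by omega⟩, fun d hd f hf => ?_⟩
        · have h1 := h d (by simp [hd]) (hne d hd).2
          rw [Finset.mem_filter]
          refine ⟨hS hd, h1.1, fun hcr => ?_⟩
          exact h1.2 c₁ (by simp) hc hcr.symm
        · exact (h d (by simp [hd]) (hne d hd).2).2 f (by simp [hf]) (hne f hf).2
    · have hself := not_chordsCross_self
      rintro (⟨⟨hS, h2⟩, hpar⟩ | ⟨⟨hS, h2⟩, hpar⟩)
      · have hSV := hS.trans (Finset.filter_subset _ _)
        have hS' : ∀ d ∈ S, ChordsCross c₁ d ∧ ¬ ChordsCross c₂ d := fun d hd =>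
          (Finset.mem_filter.1 (hS hd)).2
        refine ⟨hSV, by rw [hcard hSV, h2], c₁, by simp, ?_⟩
        intro f hf hfc
        simp only [Finset.mem_union, Finset.mem_insert, Finset.mem_singleton] at hf
        rcases hf with hf | rfl | rfl
        · refine ⟨(hS' f hf).1, fun g hg hgc => ?_⟩
          simp only [Finset.mem_union, Finset.mem_insert, Finset.mem_singleton] at hg
          rcases hg with hg | rfl | rfl
          · exact hpar f hf g hg
          · exact absurd rfl hgc
          · exact fun hcr => (hS' f hf).2 hcr.symm
        · exact absurd rfl hfc
        · refine ⟨h12, fun g hg hgc => ?_⟩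
          simp only [Finset.mem_union, Finset.mem_insert, Finset.mem_singleton] at hg
          rcases hg with hg | rfl | rfl
          · exact (hS' g hg).2
          · exact absurd rfl hgc
          · exact hself _
      · have hSV := hS.trans (Finset.filter_subset _ _)
        have hS' : ∀ d ∈ S, ChordsCross c₂ d ∧ ¬ ChordsCross c₁ d := fun d hd =>
          (Finset.mem_filter.1 (hS hd)).2
        refine ⟨hSV, by rw [hcard hSV, h2], c₂, by simp, ?_⟩
        intro f hf hfc
        simp only [Finset.mem_union, Finset.mem_insert, Finset.mem_singleton] at hf
        rcases hf with hf | rfl | rfl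
        · refine ⟨(hS' f hf).1, fun g hg hgc => ?_⟩
          simp only [Finset.mem_union, Finset.mem_insert, Finset.mem_singleton] at hg
          rcases hg with hg | rfl | rfl
          · exact hpar f hf g hg
          · exact fun hcr => (hS' f hf).2 hcr.symm
          · exact absurd rfl hgc
        · refine ⟨h12.symm, fun g hg hgc => ?_⟩
          simp only [Finset.mem_union, Finset.mem_insert, Finset.mem_singleton] at hg
          rcases hg with hg | rfl | rfl
          · exact (hS' g hg).2
          · exact hself _
          · exact absurd rfl hgc
        · exact absurd rfl hfc
  · rw [Finset.disjoint_left]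
    intro S h1 h2
    simp only [Finset.mem_filter, Finset.mem_powersetCard] at h1 h2
    obtain ⟨d, hd⟩ := Finset.card_pos.1 (show 0 < S.card by omega)
    exact (Finset.mem_filter.1 (h2.1.1 hd)).2.2 (Finset.mem_filter.1 (h1.1.1 hd)).2.1

/-- If `c₁` and `c₂` are parallel, both are crossed by the same chord of the star. -/
lemma extCount_pair_star_three_of_parallel (hc : c₁ ≠ c₂) (hV : Disjoint V {c₁, c₂})
    (h12 : ¬ ChordsCross c₁ c₂) :
    extCount (IsStar 3) V {c₁, c₂} =
      crossingPairs (V.filter fun d => ChordsCross c₁ d ∧ ChordsCross c₂ d)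
        (V.filter fun d => ¬ ChordsCross c₁ d ∧ ¬ ChordsCross c₂ d) := by
  unfold extCount crossingPairs
  symm
  refine Finset.card_bij (fun p _ => {p.1, p.2}) ?_ ?_ ?_
  · rintro ⟨d, e⟩ hp
    simp only [Finset.mem_filter, Finset.mem_product] at hp
    obtain ⟨⟨⟨hd, hd1, hd2⟩, he, he1, he2⟩, hde⟩ := hp
    have hne : d ≠ e := by rintro rfl; exact he1 hd1
    have hdn := ne_of_disjoint_pair hV hd
    have hen := ne_of_disjoint_pair hV he
    have hsub : ({d, e} : Finset (Sym2 UnitAddCircle)) ⊆ V := by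
      intro x hx
      rw [Finset.mem_insert, Finset.mem_singleton] at hx
      rcases hx with rfl | rfl <;> assumption
    simp only [Finset.mem_filter, Finset.mem_powerset]
    refine ⟨hsub, ?_, d, by simp, ?_⟩
    · rw [card_union_of_subset hV hsub, Finset.card_pair hc, Finset.card_pair hne]
    · have := chordsCross_comm (e := c₁) (f := c₂)
      have := chordsCross_comm (e := c₁) (f := d)
      have := chordsCross_comm (e := c₂) (f := d)
      have := chordsCross_comm (e := c₁) (f := e)
      have := chordsCross_comm (e := c₂) (f := e)
      have := not_chordsCross_self c₁
      have := not_chordsCross_self c₂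
      have := not_chordsCross_self e
      simp only [Finset.mem_union, Finset.mem_insert, Finset.mem_singleton]
      rintro x ((rfl | rfl) | rfl | rfl) hx
      · exact absurd rfl hx
      all_goals
        refine ⟨by tauto, ?_⟩
        rintro y ((rfl | rfl) | rfl | rfl) hy <;> tauto
  · rintro ⟨d, e⟩ hp ⟨d', e'⟩ hp' h
    simp only [Finset.mem_filter, Finset.mem_product] at hp hp'
    have hd : d ∈ ({d', e'} : Finset (Sym2 UnitAddCircle)) := by rw [← h]; simp
    have he : e ∈ ({d', e'} : Finset (Sym2 UnitAddCircle)) := by rw [← h]; simp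
    simp only [Finset.mem_insert, Finset.mem_singleton] at hd he
    rcases hd with rfl | rfl <;> rcases he with rfl | rfl <;> tauto
  · intro S hS
    simp only [Finset.mem_filter, Finset.mem_powerset] at hS
    obtain ⟨hSV, hcard, z, hz, h⟩ := hS
    rw [card_union_of_subset hV hSV, Finset.card_pair hc] at hcard
    have hne : ∀ d ∈ S, d ≠ c₁ ∧ d ≠ c₂ := fun d hd => ne_of_disjoint_pair hV (hSV hd)
    rw [Finset.mem_union, Finset.mem_insert, Finset.mem_singleton] at hz
    rcases hz with hz | rfl | rfl
    · have hcard' : (S.erase z).card = 1 := by rw [Finset.card_erase_of_mem hz]; omega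
      obtain ⟨e, he⟩ := Finset.card_eq_one.1 hcard'
      have heS : e ∈ S.erase z := by simp [he]
      rw [Finset.mem_erase] at heS
      have hc1 := h c₁ (by simp) (hne z hz).1.symm
      have hc2 := h c₂ (by simp) (hne z hz).2.symm
      refine ⟨(z, e), ?_, ?_⟩
      · simp only [Finset.mem_filter, Finset.mem_product]
        refine ⟨⟨⟨hSV hz, hc1.1.symm, hc2.1.symm⟩, hSV heS.2, ?_, ?_⟩, ?_⟩
        · exact hc1.2 e (by simp [heS.2]) heS.1
        · exact hc2.2 e (by simp [heS.2]) heS.1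
        · exact (h e (by simp [heS.2]) heS.1).1
      · rw [← Finset.insert_erase hz, he]
    · exact absurd (h c₂ (by simp) hc.symm).1 h12
    · exact absurd (h c₁ (by simp) hc).1.symm h12

/-- Each crossing pair within `M` is counted in both orders. -/
lemma even_crossingPairs_self (M : Finset (Sym2 UnitAddCircle)) : Even (crossingPairs M M) := by
  unfold crossingPairs
  rw [← ZMod.natCast_eq_zero_iff_even, Finset.card_eq_sum_ones, Nat.cast_sum]
  refine Finset.sum_involution (fun p _ => p.swap) ?_ ?_ ?_ ?_
  · intros; decide
  · rintro ⟨d, e⟩ hp - h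
    simp only [Finset.mem_filter, Prod.swap_prod_mk, Prod.mk.injEq] at hp h
    obtain ⟨rfl, -⟩ := h
    exact not_chordsCross_self _ hp.2
  · rintro ⟨d, e⟩ hp
    simp only [Finset.mem_filter, Finset.mem_product, Prod.swap_prod_mk] at hp ⊢
    exact ⟨⟨hp.1.2, hp.1.1⟩, hp.2.symm⟩
  · intros; simp

lemma crossingPairs_eq_sum (M Z : Finset (Sym2 UnitAddCircle)) :
    crossingPairs M Z = ∑ d ∈ M, (Z.filter (ChordsCross d)).card := by
  unfold crossingPairs
  rw [Finset.card_filter, Finset.sum_product]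
  simp only [Finset.card_filter]

lemma crossingPairs_union_right (M : Finset (Sym2 UnitAddCircle))
    {Z W : Finset (Sym2 UnitAddCircle)}
    (h : Disjoint Z W) : crossingPairs M (Z ∪ W) = crossingPairs M Z + crossingPairs M W := by
  simp only [crossingPairs_eq_sum, ← Finset.sum_add_distrib]
  refine Finset.sum_congr rfl fun d _ => ?_
  rw [Finset.filter_union, Finset.card_union_of_disjoint (Finset.disjoint_filter_filter h)]

lemma crossingPairs_union_left {M N : Finset (Sym2 UnitAddCircle)} (Z : Finset (Sym2 UnitAddCircle))
    (h : Disjoint M N) : crossingPairs (M ∪ N) Z = crossingPairs M Z + crossingPairs N Z := by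
  simp only [crossingPairs_eq_sum, Finset.sum_union h]

/-- If the chords of `M` cross an even number of chords of `V`, then `M` and its complement cross an
even number of times, because the crossings within `M` are counted twice. -/
lemma even_crossingPairs_sdiff {M : Finset (Sym2 UnitAddCircle)} (hM : M ⊆ V)
    (h : ∀ d ∈ M, Even (V.filter (ChordsCross d)).card) : Even (crossingPairs M (V \ M)) := by
  have h1 : Even (crossingPairs M V) := by
    rw [crossingPairs_eq_sum]
    exact Finset.even_sum _ h
  rw [← Finset.sdiff_union_of_subset hM, crossingPairs_union_right M Finset.sdiff_disjoint,
    Nat.even_add] at h1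
  exact h1.2 (even_crossingPairs_self M)

end

/-! ### The effect of an isolated chord and of twin chords -/

section

open scoped Classical

lemma sum_powerset_pair {M : Type*} [AddCommMonoid M] {X : Type*} [DecidableEq X]
    {c₁ c₂ : X} (hc : c₁ ≠ c₂)
    (f : Finset X → M) :
    ∑ T ∈ ({c₁, c₂} : Finset X).powerset, f T = f ∅ + f {c₁} + f {c₂} + f {c₁, c₂} := by
  rw [Finset.sum_powerset_insert (by simpa using hc), ← insert_empty_eq c₂,
    Finset.sum_powerset_insert (by simp), Finset.sum_powerset_insert (by simp)]
  simp only [Finset.powerset_empty, Finset.sum_singleton, insert_empty_eq]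
  abel

lemma sum_powerset_triple {M : Type*} [AddCommMonoid M] {X : Type*} [DecidableEq X]
    {c₀ c₁ c₂ : X} (h01 : c₀ ≠ c₁)
    (h02 : c₀ ≠ c₂) (h12 : c₁ ≠ c₂) (f : Finset X → M) :
    ∑ T ∈ ({c₀, c₁, c₂} : Finset X).powerset, f T =
      (f ∅ + f {c₀} + f {c₁} + f {c₂}) + f {c₀, c₁} + f {c₀, c₂} + f {c₁, c₂} + f {c₀, c₁, c₂} := by
  rw [Finset.sum_powerset_insert (by simp [h01, h02]), sum_powerset_pair h12, sum_powerset_pair h12]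
  simp only [insert_empty_eq]
  abel

namespace KnotProjection

variable {P P' : KnotProjection} {V : Finset (Sym2 UnitAddCircle)} {c c₀ c₁ c₂ : Sym2 UnitAddCircle}

lemma countSub_eq_extCount {type : Set (Sym2 UnitAddCircle) → Prop}
    {type' : Finset (Sym2 UnitAddCircle) → Prop}
    (htype : ∀ U : Finset (Sym2 UnitAddCircle), type U ↔ type' U)
    (hP : P.chords = (V : Set (Sym2 UnitAddCircle))) : P.countSub type = extCount type' V ∅ := by
  rw [P.countSub_eq_sum htype (V := V) (C := ∅) (by simp) (by simpa using hP)]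
  simp

lemma countSub_eq_of_pair {type : Set (Sym2 UnitAddCircle) → Prop}
    {type' : Finset (Sym2 UnitAddCircle) → Prop}
    (htype : ∀ U : Finset (Sym2 UnitAddCircle), type U ↔ type' U) (hc : c₁ ≠ c₂)
    (hV : Disjoint V {c₁, c₂})
    (hP : P.chords = ((V ∪ {c₁, c₂} : Finset (Sym2 UnitAddCircle)) : Set (Sym2 UnitAddCircle))) :
    P.countSub type = extCount type' V ∅ + extCount type' V {c₁} + extCount type' V {c₂} +
      extCount type' V {c₁, c₂} := by
  rw [P.countSub_eq_sum htype hV hP, sum_powerset_pair hc]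

lemma countSub_eq_of_triple {type : Set (Sym2 UnitAddCircle) → Prop}
    {type' : Finset (Sym2 UnitAddCircle) → Prop}
    (htype : ∀ U : Finset (Sym2 UnitAddCircle), type U ↔ type' U) (h01 : c₀ ≠ c₁)
    (h02 : c₀ ≠ c₂) (h12 : c₁ ≠ c₂) (hV : Disjoint V {c₀, c₁, c₂})
    (hP : P.chords = ((V ∪ {c₀, c₁, c₂} : Finset (Sym2 UnitAddCircle)) :
      Set (Sym2 UnitAddCircle))) :
    P.countSub type = (extCount type' V ∅ + extCount type' V {c₀} + extCount type' V {c₁} +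
      extCount type' V {c₂}) + extCount type' V {c₀, c₁} + extCount type' V {c₀, c₂} +
      extCount type' V {c₁, c₂} + extCount type' V {c₀, c₁, c₂} := by
  rw [P.countSub_eq_sum htype hV hP, sum_powerset_triple h01 h02 h12]

lemma not_isClique_of_isolated {n : ℕ} (hn : 2 ≤ n) (hc : c ∉ V)
    (h : ∀ d ∈ V, ¬ ChordsCross c d) : ∀ S ⊆ V, ¬ IsClique n (S ∪ {c}) := by
  rintro S hS ⟨hcard, hcl⟩
  rw [card_union_of_subset (Finset.disjoint_singleton_right.2 hc) hS,
    Finset.card_singleton] at hcard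
  obtain ⟨d, hd⟩ := Finset.card_pos.1 (show 0 < S.card by omega)
  exact h d (hS hd) (hcl c (by simp) d (by simp [hd]) (fun e => hc (e ▸ hS hd)))

lemma not_isStar_of_isolated {n : ℕ} (hn : 1 ≤ n) (hc : c ∉ V)
    (h : ∀ d ∈ V, ¬ ChordsCross c d) : ∀ S ⊆ V, ¬ IsStar n (S ∪ {c}) := by
  rintro S hS ⟨hcard, e, he, hst⟩
  rw [card_union_of_subset (Finset.disjoint_singleton_right.2 hc) hS,
    Finset.card_singleton] at hcard
  obtain ⟨d, hd⟩ := Finset.card_pos.1 (show 0 < S.card by omega)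
  have hdc : d ≠ c := fun e => hc (e ▸ hS hd)
  rw [Finset.mem_union, Finset.mem_singleton] at he
  rcases he with he | rfl
  · exact h e (hS he) (hst c (by simp) (fun h' => hc (h' ▸ hS he))).1.symm
  · exact h d (hS hd) (hst d (by simp [hd]) hdc).1

/-- A new chord that crosses no other chord does not change the numbers. -/
theorem numbers_eq_of_isolated (hc : c ∉ V) (h : ∀ d ∈ V, ¬ ChordsCross c d)
    (hP : P.chords = (V : Set (Sym2 UnitAddCircle)))
    (hP' : P'.chords = ((V ∪ {c} : Finset (Sym2 UnitAddCircle)) : Set (Sym2 UnitAddCircle))) :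
    P'.crossNumber - P.crossNumber = 0 ∧ P'.tripleNumber - P.tripleNumber = 0 ∧
      P'.hNumber - P.hNumber = 0 ∧ P'.iiiNumber - P.iiiNumber = 0 := by
  have key : ∀ {type : Set (Sym2 UnitAddCircle) → Prop}
      {type' : Finset (Sym2 UnitAddCircle) → Prop}
      (_ : ∀ U : Finset (Sym2 UnitAddCircle), type U ↔ type' U),
      (∀ S ⊆ V, ¬ type' (S ∪ {c})) → (P'.countSub type : ℤ) - P.countSub type = 0 := by
    intro type type' htype h0
    rw [countSub_eq_extCount htype hP,
      P'.countSub_eq_sum htype (Finset.disjoint_singleton_right.2 hc) hP', ← insert_empty_eq c,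
      Finset.sum_powerset_insert (by simp)]
    simp only [Finset.powerset_empty, Finset.sum_singleton, insert_empty_eq, extCount_eq_zero h0]
    simp
  exact ⟨key (fun _ => isCrossChord_iff) (not_isClique_of_isolated le_rfl hc h),
    key (fun _ => isTripleChord_iff) (not_isClique_of_isolated (by norm_num) hc h),
    key (fun _ => isHChord_iff) (not_isStar_of_isolated (by norm_num) hc h),
    key (fun _ => isIIIChord_iff) (not_isStar_of_isolated (by norm_num) hc h)⟩

lemma ncard_chords_filter {W : Finset (Sym2 UnitAddCircle)}
    (hP : P.chords = (W : Set (Sym2 UnitAddCircle))) (p : Sym2 UnitAddCircle → Prop) :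
    {f ∈ P.chords | p f}.ncard = (W.filter p).card := by
  rw [hP, ← ncard_coe_finset]
  congr 1
  ext f
  simp

/-- The effect of two new chords that cross the same old chords. With `k` for the number of the
latter, the cross chords increase by `2 k`, and by one more if the new chords cross; by the first
parity condition `k` is even or odd accordingly. In the other numbers the sets that contain exactly
one of the two chords come in pairs. -/
theorem numbers_of_twins (hc : c₁ ≠ c₂) (hV : Disjoint V {c₁, c₂})
    (h : ∀ d ∈ V, ChordsCross c₁ d ↔ ChordsCross c₂ d)
    (hP : P.chords = (V : Set (Sym2 UnitAddCircle)))
    (hP' : P'.chords = ((V ∪ {c₁, c₂} : Finset (Sym2 UnitAddCircle)) : Set (Sym2 UnitAddCircle))) :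
    (¬ ChordsCross c₁ c₂ → (∃ m : ℤ, 0 ≤ m ∧ P'.crossNumber - P.crossNumber = 4 * m) ∧
      Even (P'.tripleNumber - P.tripleNumber) ∧ Even (P'.hNumber - P.hNumber) ∧
      Even (P'.iiiNumber - P.iiiNumber)) ∧
    (ChordsCross c₁ c₂ → (∃ m : ℤ, 1 ≤ m ∧ P'.crossNumber - P.crossNumber = 4 * m - 1) ∧
      Odd (P'.tripleNumber - P.tripleNumber) ∧ Even (P'.hNumber - P.hNumber) ∧
      Even (P'.iiiNumber - P.iiiNumber)) := by
  set N := V.filter (ChordsCross c₁) with hN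
  have hboth : (V.filter fun d => ChordsCross c₁ d ∧ ChordsCross c₂ d) = N :=
    Finset.filter_congr fun d hd => by rw [← h d hd, and_self]
  have hnone : (V.filter fun d => ¬ ChordsCross c₁ d ∧ ¬ ChordsCross c₂ d) = V \ N := by
    rw [hN, ← Finset.filter_not]
    exact Finset.filter_congr fun d hd => by rw [← h d hd, and_self]
  have he1 : (V.filter fun d => ChordsCross c₁ d ∧ ¬ ChordsCross c₂ d) = ∅ :=
    Finset.filter_eq_empty_iff.2 fun d hd => by rw [← h d hd]; tauto
  have he2 : (V.filter fun d => ChordsCross c₂ d ∧ ¬ ChordsCross c₁ d) = ∅ :=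
    Finset.filter_eq_empty_iff.2 fun d hd => by rw [← h d hd]; tauto
  have hc1V : c₁ ∉ V := fun hm => Finset.disjoint_left.1 hV hm (by simp)
  have hc2V : c₂ ∉ V := fun hm => Finset.disjoint_left.1 hV hm (by simp)
  have hdeg : Even (N.card + if ChordsCross c₁ c₂ then 1 else 0) := by
    have := P'.even_ncard_crossing (e := c₁) (by rw [hP']; simp)
    rw [ncard_chords_filter hP', Finset.filter_union, Finset.card_union_of_disjoint
      (Finset.disjoint_filter_filter hV), Finset.filter_insert, if_neg (not_chordsCross_self _),
      Finset.filter_singleton] at this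
    convert this using 2
    split_ifs <;> simp
  have hout : Even (crossingPairs N (V \ N)) := by
    refine even_crossingPairs_sdiff (Finset.filter_subset _ _) fun d hd => ?_
    have := P.even_ncard_crossing (e := d) (by rw [hP]; exact (Finset.mem_filter.1 hd).1)
    rwa [ncard_chords_filter hP] at this
  -- the sets with one of the two chords come in pairs
  have s2 := extCount_singleton_congr (type := IsClique 2)
    (fun U φ h1 h2 h3 => h3.image h1 h2) hc1V hc2V h
  have s3 := extCount_singleton_congr (type := IsClique 3)
    (fun U φ h1 h2 h3 => h3.image h1 h2) hc1V hc2V h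
  have t2 := extCount_singleton_congr (type := IsStar 2)
    (fun U φ h1 h2 h3 => h3.image h1 h2) hc1V hc2V h
  have t3 := extCount_singleton_congr (type := IsStar 3)
    (fun U φ h1 h2 h3 => h3.image h1 h2) hc1V hc2V h
  have d2 : extCount (IsClique 2) V {c₁} = N.card := by
    apply extCount_eq_card_filter
    intro S hS
    have hcard := card_union_of_subset (Finset.disjoint_singleton_right.2 hc1V) hS
    rw [Finset.card_singleton] at hcard
    constructor
    · rintro ⟨h2, hcl⟩
      obtain ⟨d, rfl⟩ := Finset.card_eq_one.1 (show S.card = 1 by omega)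
      exact ⟨d, rfl, hcl c₁ (by simp) d (by simp)
        (fun e => hc1V (e ▸ Finset.singleton_subset_iff.1 hS))⟩
    · rintro ⟨d, rfl, hd⟩
      refine ⟨by rw [hcard, Finset.card_singleton], ?_⟩
      have := hd.symm
      simp only [Finset.mem_union, Finset.mem_singleton]
      rintro x (rfl | rfl) y (rfl | rfl) <;> simp_all
  unfold crossNumber tripleNumber hNumber iiiNumber
  rw [countSub_eq_extCount (fun _ => isCrossChord_iff) hP,
    countSub_eq_extCount (fun _ => isTripleChord_iff) hP,
    countSub_eq_extCount (fun _ => isHChord_iff) hP,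
    countSub_eq_extCount (fun _ => isIIIChord_iff) hP,
    countSub_eq_of_pair (fun _ => isCrossChord_iff) hc hV hP',
    countSub_eq_of_pair (fun _ => isTripleChord_iff) hc hV hP',
    countSub_eq_of_pair (fun _ => isHChord_iff) hc hV hP',
    countSub_eq_of_pair (fun _ => isIIIChord_iff) hc hV hP', ← s2, ← s3, ← t2, ← t3, d2,
    extCount_pair_clique_two hc hV, extCount_pair_clique_three hc hV, extCount_pair_star_two hc hV,
    hboth, he1, he2]
  constructor
  · intro h12
    rw [extCount_pair_star_three_of_parallel hc hV h12, hboth, hnone]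
    simp only [if_neg h12, add_zero] at hdeg ⊢
    obtain ⟨k, hk⟩ := hdeg
    obtain ⟨l, hl⟩ := hout
    refine ⟨⟨k, by positivity, by rw [hk]; push_cast; ring⟩, ?_, ?_, ?_⟩
    · exact ⟨extCount (IsClique 3) V {c₁}, by push_cast; ring⟩
    · exact ⟨extCount (IsStar 2) V {c₁} + k, by rw [hk]; push_cast; ring⟩
    · exact ⟨extCount (IsStar 3) V {c₁} + l, by rw [hl]; push_cast; ring⟩
  · intro h12
    rw [extCount_pair_star_three_of_cross hc hV h12, he1, he2]
    have hpp : parallelPairs ∅ = 0 := by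
      unfold parallelPairs
      rw [Finset.powersetCard_eq_empty.2 (by simp)]; simp
    simp only [if_pos h12, hpp, Finset.card_empty, add_zero] at hdeg ⊢
    obtain ⟨k, hk⟩ := hdeg
    have hk' : (N.card : ℤ) = 2 * k - 1 := by omega
    refine ⟨⟨k, by omega, by push_cast; rw [hk']; ring⟩, ?_, ?_, ?_⟩
    · exact ⟨extCount (IsClique 3) V {c₁} + k - 1, by push_cast; rw [hk']; ring⟩
    · exact ⟨extCount (IsStar 2) V {c₁}, by push_cast; ring⟩
    · exact ⟨extCount (IsStar 3) V {c₁}, by push_cast; ring⟩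

end KnotProjection

end

/-! ### The effect of complementing a triangle -/

section

open scoped Classical

variable {V : Finset (Sym2 UnitAddCircle)} {c₀ c₁ c₂ c₀' c₁' c₂' : Sym2 UnitAddCircle}

lemma extCount_triple_clique_two (h01 : c₀ ≠ c₁) (h02 : c₀ ≠ c₂) (h12 : c₁ ≠ c₂)
    (hV : Disjoint V {c₀, c₁, c₂}) : extCount (IsClique 2) V {c₀, c₁, c₂} = 0 := by
  apply extCount_eq_zero
  rintro S hS ⟨hcard, -⟩
  rw [card_union_of_subset hV hS, Finset.card_eq_three.2 ⟨_, _, _, h01, h02, h12, rfl⟩] at hcard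
  omega

lemma extCount_triple_clique_three (h01 : c₀ ≠ c₁) (h02 : c₀ ≠ c₂) (h12 : c₁ ≠ c₂)
    (hV : Disjoint V {c₀, c₁, c₂}) : extCount (IsClique 3) V {c₀, c₁, c₂} =
      if ChordsCross c₀ c₁ ∧ ChordsCross c₀ c₂ ∧ ChordsCross c₁ c₂ then 1 else 0 := by
  apply extCount_eq_ite
  intro S hS
  have hcard := card_union_of_subset hV hS
  rw [Finset.card_eq_three.2 ⟨_, _, _, h01, h02, h12, rfl⟩] at hcard
  rw [← isClique_three_iff h01 h02 h12]
  constructor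
  · intro h
    obtain rfl := Finset.card_eq_zero.1 (show S.card = 0 by have := h.1; omega)
    exact ⟨rfl, by rwa [Finset.empty_union] at h⟩
  · rintro ⟨rfl, h⟩
    rwa [Finset.empty_union]

lemma extCount_triple_star_two (h01 : c₀ ≠ c₁) (h02 : c₀ ≠ c₂) (h12 : c₁ ≠ c₂)
    (hV : Disjoint V {c₀, c₁, c₂}) : extCount (IsStar 2) V {c₀, c₁, c₂} =
      if (ChordsCross c₀ c₁ ∧ ChordsCross c₀ c₂ ∧ ¬ ChordsCross c₁ c₂) ∨
      (ChordsCross c₀ c₁ ∧ ¬ ChordsCross c₀ c₂ ∧ ChordsCross c₁ c₂) ∨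
      (¬ ChordsCross c₀ c₁ ∧ ChordsCross c₀ c₂ ∧ ChordsCross c₁ c₂) then 1 else 0 := by
  apply extCount_eq_ite
  intro S hS
  have hcard := card_union_of_subset hV hS
  rw [Finset.card_eq_three.2 ⟨_, _, _, h01, h02, h12, rfl⟩] at hcard
  rw [← isStar_two_iff h01 h02 h12]
  constructor
  · intro h
    obtain rfl := Finset.card_eq_zero.1 (show S.card = 0 by have := h.1; omega)
    exact ⟨rfl, by rwa [Finset.empty_union] at h⟩
  · rintro ⟨rfl, h⟩
    rwa [Finset.empty_union]

/-- If each chord of `V` crosses none or two of three chords, then the three chords do not lie in a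
III-chord. -/
lemma extCount_triple_star_three (h01 : c₀ ≠ c₁) (h02 : c₀ ≠ c₂) (h12 : c₁ ≠ c₂)
    (hV : Disjoint V {c₀, c₁, c₂})
    (hsep : ∀ d ∈ V, ChordsCross c₀ d ↔ ¬ (ChordsCross c₁ d ↔ ChordsCross c₂ d)) :
    extCount (IsStar 3) V {c₀, c₁, c₂} = 0 := by
  apply extCount_eq_zero
  rintro S hS ⟨hcard, e, he, h⟩
  rw [card_union_of_subset hV hS, Finset.card_eq_three.2 ⟨_, _, _, h01, h02, h12, rfl⟩] at hcard
  obtain ⟨d, rfl⟩ := Finset.card_eq_one.1 (show S.card = 1 by omega)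
  have hdV := Finset.singleton_subset_iff.1 hS
  have hd := Finset.disjoint_left.1 hV hdV
  simp only [Finset.mem_insert, Finset.mem_singleton, not_or] at hd
  have hs := hsep d hdV
  simp only [Finset.mem_union, Finset.mem_insert, Finset.mem_singleton] at he h
  have e0 := h c₀ (by simp)
  have e1 := h c₁ (by simp)
  have e2 := h c₂ (by simp)
  have ed := h d (by simp)
  rcases he with rfl | rfl | rfl | rfl
  · exact hs.1 (e0 (Ne.symm hd.1)).1.symm
      (iff_of_true (e1 (Ne.symm hd.2.1)).1.symm (e2 (Ne.symm hd.2.2)).1.symm)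
  · exact hs.1 (ed hd.1).1 (iff_of_false
      (fun hcr => (ed hd.1).2 c₁ (by simp) h01.symm hcr.symm)
      (fun hcr => (ed hd.1).2 c₂ (by simp) h02.symm hcr.symm))
  · exact (ed hd.2.1).2 c₀ (by simp) h01 (hs.2 fun hiff =>
      (ed hd.2.1).2 c₂ (by simp) h12.symm (hiff.1 (ed hd.2.1).1).symm).symm
  · exact (ed hd.2.2).2 c₀ (by simp) h02 (hs.2 fun hiff =>
      (ed hd.2.2).2 c₁ (by simp) h12 (hiff.2 (ed hd.2.2).1).symm).symm

/-- The chords of `V` that cross both `c₁` and `c₂`. -/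
noncomputable def commonChords (V : Finset (Sym2 UnitAddCircle)) (c₁ c₂ : Sym2 UnitAddCircle) :
    Finset (Sym2 UnitAddCircle) :=
  V.filter fun d => ChordsCross c₁ d ∧ ChordsCross c₂ d

namespace KnotProjection

variable {P P' : KnotProjection}

/-- The number of sets of a given type with at most one of the three chords and the rest in `V`. -/
noncomputable def lowCount (type : Finset (Sym2 UnitAddCircle) → Prop)
    (V : Finset (Sym2 UnitAddCircle)) (c₀ c₁ c₂ : Sym2 UnitAddCircle) : ℕ :=
  extCount type V ∅ + extCount type V {c₀} + extCount type V {c₁} + extCount type V {c₂}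

/-- The chords of `V` that cross none of the three chords. -/
noncomputable def freeChords (V : Finset (Sym2 UnitAddCircle)) (c₀ c₁ c₂ : Sym2 UnitAddCircle) :
    Finset (Sym2 UnitAddCircle) :=
  V.filter fun d => ¬ ChordsCross c₀ d ∧ ¬ ChordsCross c₁ d ∧ ¬ ChordsCross c₂ d

/-- The numbers of a chord diagram with three distinguished chords, in terms of the crossings among
the three, if each other chord crosses none or two of them. -/
lemma numbers_of_triangle (h01 : c₀ ≠ c₁) (h02 : c₀ ≠ c₂) (h12 : c₁ ≠ c₂)
    (hV : Disjoint V {c₀, c₁, c₂})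
    (hsep : ∀ d ∈ V, ChordsCross c₀ d ↔ ¬ (ChordsCross c₁ d ↔ ChordsCross c₂ d))
    (hP : P.chords = ((V ∪ {c₀, c₁, c₂} : Finset (Sym2 UnitAddCircle)) :
      Set (Sym2 UnitAddCircle))) :
    (P.countSub IsCrossChord = lowCount (IsClique 2) V c₀ c₁ c₂ +
      (if ChordsCross c₀ c₁ then 1 else 0) + (if ChordsCross c₀ c₂ then 1 else 0) +
      (if ChordsCross c₁ c₂ then 1 else 0)) ∧
    (P.countSub IsTripleChord = lowCount (IsClique 3) V c₀ c₁ c₂ +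
      (if ChordsCross c₀ c₁ then (commonChords V c₀ c₁).card else 0) +
      (if ChordsCross c₀ c₂ then (commonChords V c₀ c₂).card else 0) +
      (if ChordsCross c₁ c₂ then (commonChords V c₁ c₂).card else 0) +
      (if ChordsCross c₀ c₁ ∧ ChordsCross c₀ c₂ ∧ ChordsCross c₁ c₂ then 1 else 0)) ∧
    (P.countSub IsHChord = lowCount (IsStar 2) V c₀ c₁ c₂ +
      (if ChordsCross c₀ c₁ then (commonChords V c₀ c₂).card + (commonChords V c₁ c₂).card
        else (commonChords V c₀ c₁).card) +
      (if ChordsCross c₀ c₂ then (commonChords V c₀ c₁).card + (commonChords V c₁ c₂).card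
        else (commonChords V c₀ c₂).card) +
      (if ChordsCross c₁ c₂ then (commonChords V c₀ c₁).card + (commonChords V c₀ c₂).card
        else (commonChords V c₁ c₂).card) +
      (if (ChordsCross c₀ c₁ ∧ ChordsCross c₀ c₂ ∧ ¬ ChordsCross c₁ c₂) ∨
      (ChordsCross c₀ c₁ ∧ ¬ ChordsCross c₀ c₂ ∧ ChordsCross c₁ c₂) ∨
      (¬ ChordsCross c₀ c₁ ∧ ChordsCross c₀ c₂ ∧ ChordsCross c₁ c₂) then 1 else 0)) ∧
    (P.countSub IsIIIChord = lowCount (IsStar 3) V c₀ c₁ c₂ +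
      (if ChordsCross c₀ c₁ then parallelPairs (commonChords V c₀ c₂) +
          parallelPairs (commonChords V c₁ c₂)
        else crossingPairs (commonChords V c₀ c₁) (freeChords V c₀ c₁ c₂)) +
      (if ChordsCross c₀ c₂ then parallelPairs (commonChords V c₀ c₁) +
          parallelPairs (commonChords V c₁ c₂)
        else crossingPairs (commonChords V c₀ c₂) (freeChords V c₀ c₁ c₂)) +
      (if ChordsCross c₁ c₂ then parallelPairs (commonChords V c₀ c₁) +
          parallelPairs (commonChords V c₀ c₂)
        else crossingPairs (commonChords V c₁ c₂) (freeChords V c₀ c₁ c₂))) := by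
  have hsub : ∀ {T : Finset (Sym2 UnitAddCircle)}, T ⊆ {c₀, c₁, c₂} → Disjoint V T := fun h =>
    hV.mono_right h
  have V01 : Disjoint V {c₀, c₁} := hsub (by grind)
  have V02 : Disjoint V {c₀, c₂} := hsub (by grind)
  have V12 : Disjoint V {c₁, c₂} := hsub (by grind)
  have f1 : (V.filter fun d => ChordsCross c₀ d ∧ ¬ ChordsCross c₁ d) = commonChords V c₀ c₂ :=
    Finset.filter_congr fun d hd => by have := hsep d hd; clear * - this; tauto
  have f2 : (V.filter fun d => ChordsCross c₁ d ∧ ¬ ChordsCross c₀ d) = commonChords V c₁ c₂ :=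
    Finset.filter_congr fun d hd => by have := hsep d hd; clear * - this; tauto
  have f3 : (V.filter fun d => ChordsCross c₀ d ∧ ¬ ChordsCross c₂ d) = commonChords V c₀ c₁ :=
    Finset.filter_congr fun d hd => by have := hsep d hd; clear * - this; tauto
  have f4 : (V.filter fun d => ChordsCross c₂ d ∧ ¬ ChordsCross c₀ d) = commonChords V c₁ c₂ :=
    Finset.filter_congr fun d hd => by have := hsep d hd; clear * - this; tauto
  have f5 : (V.filter fun d => ChordsCross c₁ d ∧ ¬ ChordsCross c₂ d) = commonChords V c₀ c₁ :=
    Finset.filter_congr fun d hd => by have := hsep d hd; clear * - this; tauto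
  have f6 : (V.filter fun d => ChordsCross c₂ d ∧ ¬ ChordsCross c₁ d) = commonChords V c₀ c₂ :=
    Finset.filter_congr fun d hd => by have := hsep d hd; clear * - this; tauto
  have g1 : (V.filter fun d => ¬ ChordsCross c₀ d ∧ ¬ ChordsCross c₁ d) = freeChords V c₀ c₁ c₂ :=
    Finset.filter_congr fun d hd => by have := hsep d hd; clear * - this; tauto
  have g2 : (V.filter fun d => ¬ ChordsCross c₀ d ∧ ¬ ChordsCross c₂ d) = freeChords V c₀ c₁ c₂ :=
    Finset.filter_congr fun d hd => by have := hsep d hd; clear * - this; tauto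
  have g3 : (V.filter fun d => ¬ ChordsCross c₁ d ∧ ¬ ChordsCross c₂ d) = freeChords V c₀ c₁ c₂ :=
    Finset.filter_congr fun d hd => by have := hsep d hd; clear * - this; tauto
  have p1 : extCount (IsStar 3) V {c₀, c₁} = if ChordsCross c₀ c₁ then
      parallelPairs (commonChords V c₀ c₂) + parallelPairs (commonChords V c₁ c₂)
        else crossingPairs (commonChords V c₀ c₁) (freeChords V c₀ c₁ c₂) := by
    split_ifs with h
    · rw [extCount_pair_star_three_of_cross h01 V01 h, f1, f2]
    · rw [extCount_pair_star_three_of_parallel h01 V01 h, g1]; rfl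
  have p2 : extCount (IsStar 3) V {c₀, c₂} = if ChordsCross c₀ c₂ then
      parallelPairs (commonChords V c₀ c₁) + parallelPairs (commonChords V c₁ c₂)
        else crossingPairs (commonChords V c₀ c₂) (freeChords V c₀ c₁ c₂) := by
    split_ifs with h
    · rw [extCount_pair_star_three_of_cross h02 V02 h, f3, f4]
    · rw [extCount_pair_star_three_of_parallel h02 V02 h, g2]; rfl
  have p3 : extCount (IsStar 3) V {c₁, c₂} = if ChordsCross c₁ c₂ then
      parallelPairs (commonChords V c₀ c₁) + parallelPairs (commonChords V c₀ c₂)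
        else crossingPairs (commonChords V c₁ c₂) (freeChords V c₀ c₁ c₂) := by
    split_ifs with h
    · rw [extCount_pair_star_three_of_cross h12 V12 h, f5, f6]
    · rw [extCount_pair_star_three_of_parallel h12 V12 h, g3]; rfl
  refine ⟨?_, ?_, ?_, ?_⟩
  · rw [countSub_eq_of_triple (fun _ => isCrossChord_iff) h01 h02 h12 hV hP,
      extCount_pair_clique_two h01 V01, extCount_pair_clique_two h02 V02,
      extCount_pair_clique_two h12 V12, extCount_triple_clique_two h01 h02 h12 hV]
    rfl
  · rw [countSub_eq_of_triple (fun _ => isTripleChord_iff) h01 h02 h12 hV hP,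
      extCount_pair_clique_three h01 V01, extCount_pair_clique_three h02 V02,
      extCount_pair_clique_three h12 V12, extCount_triple_clique_three h01 h02 h12 hV]
    rfl
  · rw [countSub_eq_of_triple (fun _ => isHChord_iff) h01 h02 h12 hV hP,
      extCount_pair_star_two h01 V01, extCount_pair_star_two h02 V02,
      extCount_pair_star_two h12 V12, extCount_triple_star_two h01 h02 h12 hV, f1, f2, f3, f4, f5,
      f6]
    rfl
  · rw [countSub_eq_of_triple (fun _ => isIIIChord_iff) h01 h02 h12 hV hP, p1, p2, p3,
      extCount_triple_star_three h01 h02 h12 hV hsep]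
    rfl

/-- What the parity conditions say about the three chords of a triangle and the chords around it. -/
lemma parity_of_triangle (h01 : c₀ ≠ c₁) (h02 : c₀ ≠ c₂) (h12 : c₁ ≠ c₂)
    (hV : Disjoint V {c₀, c₁, c₂})
    (hsep : ∀ d ∈ V, ChordsCross c₀ d ↔ ¬ (ChordsCross c₁ d ↔ ChordsCross c₂ d))
    (hP : P.chords = ((V ∪ {c₀, c₁, c₂} : Finset (Sym2 UnitAddCircle)) :
      Set (Sym2 UnitAddCircle))) :
    Even ((commonChords V c₀ c₁).card + (commonChords V c₀ c₂).card +
      (if ChordsCross c₀ c₁ then 1 else 0) + (if ChordsCross c₀ c₂ then 1 else 0)) ∧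
    Even ((commonChords V c₀ c₁).card + (commonChords V c₁ c₂).card +
      (if ChordsCross c₀ c₁ then 1 else 0) + (if ChordsCross c₁ c₂ then 1 else 0)) ∧
    (¬ ChordsCross c₀ c₁ → Even ((commonChords V c₀ c₁).card +
      if ChordsCross c₀ c₂ ∧ ChordsCross c₁ c₂ then 1 else 0)) ∧
    (¬ ChordsCross c₀ c₂ → Even ((commonChords V c₀ c₂).card +
      if ChordsCross c₀ c₁ ∧ ChordsCross c₁ c₂ then 1 else 0)) ∧
    (¬ ChordsCross c₁ c₂ → Even ((commonChords V c₁ c₂).card +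
      if ChordsCross c₀ c₁ ∧ ChordsCross c₀ c₂ then 1 else 0)) ∧
    Even (crossingPairs (commonChords V c₀ c₁) (freeChords V c₀ c₁ c₂) +
      crossingPairs (commonChords V c₀ c₂) (freeChords V c₀ c₁ c₂) +
      crossingPairs (commonChords V c₁ c₂) (freeChords V c₀ c₁ c₂)) := by
  have m0 : c₀ ∈ P.chords := by rw [hP]; simp
  have m1 : c₁ ∈ P.chords := by rw [hP]; simp
  have m2 : c₂ ∈ P.chords := by rw [hP]; simp
  have s0 := not_chordsCross_self c₀
  have s1 := not_chordsCross_self c₁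
  have s2 := not_chordsCross_self c₂
  have b01 := chordsCross_comm (e := c₁) (f := c₀)
  have b02 := chordsCross_comm (e := c₂) (f := c₀)
  have b12 := chordsCross_comm (e := c₂) (f := c₁)
  -- counting over the three chords of the triangle
  have hcount : ∀ p : Sym2 UnitAddCircle → Prop, {f ∈ P.chords | p f}.ncard = (V.filter p).card +
      ((if p c₀ then 1 else 0) + (if p c₁ then 1 else 0) + (if p c₂ then 1 else 0)) := by
    intro p
    rw [ncard_chords_filter hP, Finset.filter_union, Finset.card_union_of_disjoint
      (Finset.disjoint_filter_filter hV)]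
    congr 1
    rw [Finset.card_filter, Finset.sum_insert (by simp [h01, h02]), Finset.sum_pair h12, add_assoc]
  have d01 : Disjoint (commonChords V c₀ c₁) (commonChords V c₀ c₂) :=
    Finset.disjoint_filter.2 fun d hd => by have := hsep d hd; clear * - this; tauto
  have d02 : Disjoint (commonChords V c₀ c₁) (commonChords V c₁ c₂) :=
    Finset.disjoint_filter.2 fun d hd => by have := hsep d hd; clear * - this; tauto
  have d12 : Disjoint (commonChords V c₀ c₂) (commonChords V c₁ c₂) :=
    Finset.disjoint_filter.2 fun d hd => by have := hsep d hd; clear * - this; tauto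
  refine ⟨?_, ?_, ?_, ?_, ?_, ?_⟩
  · have := P.even_ncard_crossing m0
    rw [hcount, if_neg s0, zero_add] at this
    have hN : V.filter (ChordsCross c₀) = commonChords V c₀ c₁ ∪ commonChords V c₀ c₂ := by
      unfold commonChords
      rw [← Finset.filter_or]
      exact Finset.filter_congr fun d hd => by have := hsep d hd; clear * - this; tauto
    rw [hN, Finset.card_union_of_disjoint d01] at this
    simpa only [add_assoc] using this
  · have := P.even_ncard_crossing m1
    rw [hcount, if_neg s1, add_zero, b01] at this
    have hN : V.filter (ChordsCross c₁) = commonChords V c₀ c₁ ∪ commonChords V c₁ c₂ := by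
      unfold commonChords
      rw [← Finset.filter_or]
      exact Finset.filter_congr fun d hd => by have := hsep d hd; clear * - this; tauto
    rw [hN, Finset.card_union_of_disjoint d02] at this
    simpa only [add_assoc] using this
  · intro h
    have := P.even_ncard_common m0 m1 h01 h
    rw [hcount] at this
    simp only [s0, s1, false_and, and_false, if_false, zero_add] at this
    unfold commonChords
    convert this
  · intro h
    have := P.even_ncard_common m0 m2 h02 h
    rw [hcount] at this
    simp only [s0, s2, b12, false_and, and_false, if_false, zero_add, add_zero] at this
    unfold commonChords
    convert this
  · intro h
    have := P.even_ncard_common m1 m2 h12 h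
    rw [hcount] at this
    simp only [s1, s2, b01, b02, false_and, and_false, if_false, add_zero] at this
    unfold commonChords
    convert this
  · rw [← crossingPairs_union_left _ d01, ← crossingPairs_union_left]
    · have hout : freeChords V c₀ c₁ c₂ = V \ (commonChords V c₀ c₁ ∪ commonChords V c₀ c₂ ∪
          commonChords V c₁ c₂) := by
        ext d
        simp only [freeChords, commonChords, Finset.mem_filter, Finset.mem_sdiff, Finset.mem_union]
        have := hsep d
        clear * - this
        tauto
      rw [hout]
      refine even_crossingPairs_sdiff ?_ ?_
      · exact Finset.union_subset (Finset.union_subset (Finset.filter_subset _ _)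
          (Finset.filter_subset _ _)) (Finset.filter_subset _ _)
      · intro d hd
        have hdV : d ∈ V := by
          simp only [commonChords, Finset.mem_union, Finset.mem_filter] at hd
          rcases hd with (hd | hd) | hd <;> exact hd.1
        have := P.even_ncard_crossing (e := d) (by rw [hP]; simp [hdV])
        rw [hcount] at this
        have hs := hsep d hdV
        rw [chordsCross_comm (e := d) (f := c₀), chordsCross_comm (e := d) (f := c₁),
          chordsCross_comm (e := d) (f := c₂)] at this
        by_cases h1 : ChordsCross c₁ d <;> by_cases h2 : ChordsCross c₂ d
        all_goals
          simp only [h1, h2, iff_true, not_true, not_false_iff, iff_false] at hs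
          simp only [h1, h2, hs, if_true, if_false] at this
          simpa [Nat.even_add_one, Nat.even_add] using this
    · exact Finset.disjoint_union_left.2 ⟨d02, d12⟩

/-- The effect of replacing three chords by chords that cross the same other chords, while crossing
and parallel are exchanged among the three, if each other chord crosses none or two of them. -/
theorem numbers_of_triangle_flip (h01 : c₀ ≠ c₁) (h02 : c₀ ≠ c₂) (h12 : c₁ ≠ c₂)
    (h01' : c₀' ≠ c₁') (h02' : c₀' ≠ c₂') (h12' : c₁' ≠ c₂')
    (hV : Disjoint V {c₀, c₁, c₂}) (hV' : Disjoint V {c₀', c₁', c₂'})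
    (hsep : ∀ d ∈ V, ChordsCross c₀ d ↔ ¬ (ChordsCross c₁ d ↔ ChordsCross c₂ d))
    (e0 : ∀ d ∈ V, ChordsCross c₀ d ↔ ChordsCross c₀' d)
    (e1 : ∀ d ∈ V, ChordsCross c₁ d ↔ ChordsCross c₁' d)
    (e2 : ∀ d ∈ V, ChordsCross c₂ d ↔ ChordsCross c₂' d)
    (f01 : ChordsCross c₀' c₁' ↔ ¬ ChordsCross c₀ c₁)
    (f02 : ChordsCross c₀' c₂' ↔ ¬ ChordsCross c₀ c₂)
    (f12 : ChordsCross c₁' c₂' ↔ ¬ ChordsCross c₁ c₂)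
    (hP : P.chords = ((V ∪ {c₀, c₁, c₂} : Finset (Sym2 UnitAddCircle)) :
      Set (Sym2 UnitAddCircle)))
    (hP' : P'.chords = ((V ∪ {c₀', c₁', c₂'} : Finset (Sym2 UnitAddCircle)) :
      Set (Sym2 UnitAddCircle))) :
    ((ChordsCross c₀ c₁ ↔ ChordsCross c₀ c₂) ∧ (ChordsCross c₀ c₁ ↔ ChordsCross c₁ c₂) →
      (P'.crossNumber - P.crossNumber = 3 ∨ P'.crossNumber - P.crossNumber = -3) ∧
      Odd (P'.tripleNumber - P.tripleNumber) ∧ Even (P'.hNumber - P.hNumber) ∧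
      Even (P'.iiiNumber - P.iiiNumber)) ∧
    (¬ ((ChordsCross c₀ c₁ ↔ ChordsCross c₀ c₂) ∧ (ChordsCross c₀ c₁ ↔ ChordsCross c₁ c₂)) →
      (P'.crossNumber - P.crossNumber = 1 ∨ P'.crossNumber - P.crossNumber = -1) ∧
      Odd (P'.tripleNumber - P.tripleNumber) ∧ Even (P'.hNumber - P.hNumber) ∧
      Even (P'.iiiNumber - P.iiiNumber)) := by
  have hsep' : ∀ d ∈ V, ChordsCross c₀' d ↔ ¬ (ChordsCross c₁' d ↔ ChordsCross c₂' d) :=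
    fun d hd => by rw [← e0 d hd, ← e1 d hd, ← e2 d hd]; exact hsep d hd
  have k01 : commonChords V c₀' c₁' = commonChords V c₀ c₁ :=
    Finset.filter_congr fun d hd => by rw [e0 d hd, e1 d hd]
  have k02 : commonChords V c₀' c₂' = commonChords V c₀ c₂ :=
    Finset.filter_congr fun d hd => by rw [e0 d hd, e2 d hd]
  have k12 : commonChords V c₁' c₂' = commonChords V c₁ c₂ :=
    Finset.filter_congr fun d hd => by rw [e1 d hd, e2 d hd]
  have ko : freeChords V c₀' c₁' c₂' = freeChords V c₀ c₁ c₂ :=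
    Finset.filter_congr fun d hd => by rw [e0 d hd, e1 d hd, e2 d hd]
  -- sets with at most one of the three chords are not affected
  have hlow : ∀ {type : Finset (Sym2 UnitAddCircle) → Prop}
      (_ : ∀ (U : Finset (Sym2 UnitAddCircle)) (φ : Sym2 UnitAddCircle → Sym2 UnitAddCircle),
      Set.InjOn φ U → (∀ e ∈ U, ∀ f ∈ U, ChordsCross (φ e) (φ f) ↔ ChordsCross e f) →
      type U → type (U.image φ)), lowCount type V c₀' c₁' c₂' = lowCount type V c₀ c₁ c₂ := by
    intro type ht
    have n : ∀ x ∈ ({c₀, c₁, c₂} : Finset (Sym2 UnitAddCircle)), x ∉ V := fun x hx hxV =>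
      Finset.disjoint_left.1 hV hxV hx
    have n' : ∀ x ∈ ({c₀', c₁', c₂'} : Finset (Sym2 UnitAddCircle)), x ∉ V := fun x hx hxV =>
      Finset.disjoint_left.1 hV' hxV hx
    unfold lowCount
    rw [extCount_singleton_congr ht (n c₀ (by simp)) (n' c₀' (by simp)) e0,
      extCount_singleton_congr ht (n c₁ (by simp)) (n' c₁' (by simp)) e1,
      extCount_singleton_congr ht (n c₂ (by simp)) (n' c₂' (by simp)) e2]
  obtain ⟨x1, x2, x3, x4⟩ := numbers_of_triangle h01 h02 h12 hV hsep hP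
  obtain ⟨y1, y2, y3, y4⟩ := numbers_of_triangle h01' h02' h12' hV' hsep' hP'
  obtain ⟨q1, q2, q3, q4, q5, q6⟩ := parity_of_triangle h01 h02 h12 hV hsep hP
  obtain ⟨r1, r2, r3, r4, r5, -⟩ := parity_of_triangle h01' h02' h12' hV' hsep' hP'
  rw [hlow (fun U φ h1 h2 h3 => h3.image h1 h2)] at y1 y2 y3 y4
  simp only [k01, k02, k12, ko, f01, f02, f12] at y1 y2 y3 y4 r1 r2 r3 r4 r5
  unfold crossNumber tripleNumber hNumber iiiNumber
  rw [x1, x2, x3, x4, y1, y2, y3, y4]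
  clear x1 x2 x3 x4 y1 y2 y3 y4
  -- what remains is a statement about the parities of these numbers, for each possibility of
  -- crossings among the three chords
  generalize lowCount (IsClique 2) V c₀ c₁ c₂ = l1
  generalize lowCount (IsClique 3) V c₀ c₁ c₂ = l2
  generalize lowCount (IsStar 2) V c₀ c₁ c₂ = l3
  generalize lowCount (IsStar 3) V c₀ c₁ c₂ = l4
  generalize (commonChords V c₀ c₁).card = n01 at *
  generalize (commonChords V c₀ c₂).card = n02 at *
  generalize (commonChords V c₁ c₂).card = n12 at *
  generalize parallelPairs (commonChords V c₀ c₁) = p01 at *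
  generalize parallelPairs (commonChords V c₀ c₂) = p02 at *
  generalize parallelPairs (commonChords V c₁ c₂) = p12 at *
  generalize crossingPairs (commonChords V c₀ c₁) (freeChords V c₀ c₁ c₂) = w01 at *
  generalize crossingPairs (commonChords V c₀ c₂) (freeChords V c₀ c₁ c₂) = w02 at *
  generalize crossingPairs (commonChords V c₁ c₂) (freeChords V c₀ c₁ c₂) = w12 at *
  simp only [Nat.even_iff, Int.even_iff, Int.odd_iff] at *
  by_cases t01 : ChordsCross c₀ c₁ <;> by_cases t02 : ChordsCross c₀ c₂ <;>
    by_cases t12 : ChordsCross c₁ c₂ <;>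
    simp only [t01, t02, t12, if_true, if_false, not_true, not_false_iff, and_true, true_and,
      and_false, or_true, or_false, forall_const, iff_true, iff_false,
      IsEmpty.forall_iff, and_self, or_self] at * <;> omega

end KnotProjection

end

/-! ### Chords under a local replacement -/

/-- The pairs `p, q` and `u, v` alternate if and only if exactly one of `p` and `q` lies between `u`
and `v`. -/
lemma alternate_iff {p q u v : ℝ} (h1 : u ≠ p) (h2 : u ≠ q) (h3 : v ≠ p) (h4 : v ≠ q) :
    Alternate p q u v ↔ ¬ ((p < u ↔ p < v) ↔ (q < u ↔ q < v)) := by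
  unfold Alternate
  grind

namespace KnotProjection

namespace LocalReplacement

variable {n : ℕ} {P P' : KnotProjection} (L : LocalReplacement n P P')

/-- A local replacement, read backwards. -/
def symm : LocalReplacement n P' P where
  disk := L.disk
  isDisk := L.isDisk
  base := L.base
  a := L.a
  b := L.b
  base_lt := L.base_lt
  a_lt_b := L.a_lt_b
  lt_base := L.lt_base
  disjoint := L.disjoint
  mem_disk := L.mem_disk'
  mem_disk' := L.mem_disk
  mem_interior := L.mem_interior'
  mem_interior' := L.mem_interior
  agree := fun t ht h => (L.agree t ht h).symm

/-- The chords of `P` that join parameters outside the strands. -/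
def outer : Set (Sym2 UnitAddCircle) :=
  {e | ∃ u ∈ Ico L.base (L.base + 1), ∃ v ∈ Ico L.base (L.base + 1), u ∉ L.strands ∧
    v ∉ L.strands ∧ u ≠ v ∧ P (u : UnitAddCircle) = P (v : UnitAddCircle) ∧
    e = s((u : UnitAddCircle), (v : UnitAddCircle))}

lemma mem_strands {t : ℝ} : t ∈ L.strands ↔ ∃ i, t ∈ Icc (L.a i) (L.b i) := by
  simp [strands, strand]

lemma mem_Ico_of_mem_strand {t : ℝ} {i : Fin n} (h : t ∈ L.strand i) :
    t ∈ Ico L.base (L.base + 1) :=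
  ⟨by linarith [L.base_lt i, h.1], by linarith [L.lt_base i, h.2]⟩

lemma mem_Ico_of_mem_strands {t : ℝ} (h : t ∈ L.strands) : t ∈ Ico L.base (L.base + 1) := by
  obtain ⟨i, hi⟩ := L.mem_strands.1 h
  exact L.mem_Ico_of_mem_strand hi

lemma outer_symm : L.symm.outer = L.outer := by
  have hag : ∀ t ∈ Ico L.base (L.base + 1), t ∉ L.strands →
      P (t : UnitAddCircle) = P' (t : UnitAddCircle) := fun t ht hs =>
    L.agree t ht fun i hi => hs (L.mem_strands.2 ⟨i, Ioo_subset_Icc_self hi⟩)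
  ext e
  constructor
  · rintro ⟨u, hu, v, hv, hus, hvs, hne, h, rfl⟩
    exact ⟨u, hu, v, hv, hus, hvs, hne, by rw [hag u hu hus, hag v hv hvs, h], rfl⟩
  · rintro ⟨u, hu, v, hv, hus, hvs, hne, h, rfl⟩
    exact ⟨u, hu, v, hv, hus, hvs, hne, by rw [← hag u hu hus, ← hag v hv hvs, h], rfl⟩

/-- A double point in the disk comes from the strands alone, one outside of it from the rest. -/
lemma chords_eq : P.chords = L.outer ∪ Sym2.map (fun t : ℝ => (t : UnitAddCircle)) ''
    P.crossingsIn L.strands := by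
  ext e
  constructor
  · rintro ⟨p, q, hpq, h, rfl⟩
    obtain ⟨s, hs, rfl⟩ := exists_coe_mem_Ico L.base p
    obtain ⟨t, ht, rfl⟩ := exists_coe_mem_Ico L.base q
    have hst : s ≠ t := fun h => hpq (by rw [h])
    have hiff : s ∈ L.strands ↔ t ∈ L.strands := by
      rw [mem_strands, mem_strands, ← L.mem_disk s hs, ← L.mem_disk t ht, h]
    by_cases hsS : s ∈ L.strands
    · exact Or.inr ⟨s(s, t), ⟨s, hsS, t, hiff.1 hsS, hst, h, rfl⟩, rfl⟩
    · exact Or.inl ⟨s, hs, t, ht, hsS, fun h => hsS (hiff.2 h), hst, h, rfl⟩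
  · rintro (⟨u, hu, v, hv, hus, hvs, hne, h, rfl⟩ | ⟨_, ⟨s, hs, t, ht, hst, h, rfl⟩, rfl⟩)
    · exact ⟨u, v, fun he => hne ((coe_inj_of_mem_Ico hu hv).1 he), h, rfl⟩
    · exact ⟨s, t, fun he => hst ((coe_inj_of_mem_Ico (L.mem_Ico_of_mem_strands hs)
        (L.mem_Ico_of_mem_strands ht)).1 he), h, rfl⟩

/-- The two curves have the same chords apart from those that come from the strands. -/
lemma exists_outer_finset : ∃ V : Finset (Sym2 UnitAddCircle),
    (∀ d ∈ V, ∃ u ∈ Ico L.base (L.base + 1), ∃ v ∈ Ico L.base (L.base + 1), u ∉ L.strands ∧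
      v ∉ L.strands ∧ d = s((u : UnitAddCircle), (v : UnitAddCircle))) ∧
    P.chords = (V : Set (Sym2 UnitAddCircle)) ∪
      Sym2.map (fun t : ℝ => (t : UnitAddCircle)) '' P.crossingsIn L.strands ∧
    P'.chords = (V : Set (Sym2 UnitAddCircle)) ∪
      Sym2.map (fun t : ℝ => (t : UnitAddCircle)) '' P'.crossingsIn L.strands := by
  have hfin : L.outer.Finite := P.finite_chords.subset (by
    rw [L.chords_eq]; exact subset_union_left)
  refine ⟨hfin.toFinset, ?_, ?_, ?_⟩
  · intro d hd
    rw [Finite.mem_toFinset] at hd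
    obtain ⟨u, hu, v, hv, hus, hvs, -, -, h⟩ := hd
    exact ⟨u, hu, v, hv, hus, hvs, h⟩
  · rw [hfin.coe_toFinset]; exact L.chords_eq
  · rw [hfin.coe_toFinset, ← L.outer_symm]; exact L.symm.chords_eq

lemma lt_iff_of_strand {i j : Fin n} (hij : i ≠ j) {x y : ℝ} (hx : x ∈ L.strand i)
    (hy : y ∈ L.strand j) : x < y ↔ L.a i < L.a j := by
  have hd := Set.disjoint_left.1 (L.disjoint i j hij)
  have h1 := L.a_lt_b i
  have h2 := L.a_lt_b j
  have h3 : ¬ (L.a j ≤ L.a i ∧ L.a i ≤ L.b j) := fun h => hd ⟨le_rfl, h1.le⟩ h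
  have h4 : ¬ (L.a i ≤ L.a j ∧ L.a j ≤ L.b i) := fun h => hd h ⟨le_rfl, h2.le⟩
  obtain ⟨hx1, hx2⟩ := hx
  obtain ⟨hy1, hy2⟩ := hy
  grind

lemma ne_of_strand {i j : Fin n} (hij : i ≠ j) {x y : ℝ} (hx : x ∈ L.strand i)
    (hy : y ∈ L.strand j) : x ≠ y := fun h =>
  Set.disjoint_left.1 (L.disjoint i j hij) hx (h ▸ hy)

lemma lt_iff_of_notMem {i : Fin n} {x y u : ℝ} (hx : x ∈ L.strand i) (hy : y ∈ L.strand i)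
    (hu : u ∉ L.strands) : x < u ↔ y < u := by
  have h : ¬ (L.a i ≤ u ∧ u ≤ L.b i) := fun h => hu (L.mem_strands.2 ⟨i, h⟩)
  obtain ⟨hx1, hx2⟩ := hx
  obtain ⟨hy1, hy2⟩ := hy
  grind

lemma ne_of_notMem {i : Fin n} {x u : ℝ} (hx : x ∈ L.strand i) (hu : u ∉ L.strands) : u ≠ x :=
  fun h => hu (L.mem_strands.2 ⟨i, h ▸ hx⟩)

lemma not_mem_of_strand {V : Finset (Sym2 UnitAddCircle)}
    (hV : ∀ d ∈ V, ∃ u ∈ Ico L.base (L.base + 1), ∃ v ∈ Ico L.base (L.base + 1), u ∉ L.strands ∧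
      v ∉ L.strands ∧ d = s((u : UnitAddCircle), (v : UnitAddCircle))) {i : Fin n} {x : ℝ}
    (hx : x ∈ L.strand i) (y : ℝ) :
    s((x : UnitAddCircle), (y : UnitAddCircle)) ∉ V := by
  intro h
  obtain ⟨u, hu, v, hv, hus, hvs, he⟩ := hV _ h
  rcases Sym2.eq_iff.1 he with ⟨h1, -⟩ | ⟨h1, -⟩
  · exact L.ne_of_notMem hx hus ((coe_inj_of_mem_Ico (L.mem_Ico_of_mem_strand hx) hu).1 h1).symm
  · exact L.ne_of_notMem hx hvs ((coe_inj_of_mem_Ico (L.mem_Ico_of_mem_strand hx) hv).1 h1).symm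

/-- Whether a chord between two strands crosses a chord outside the strands depends only on the two
strands. -/
lemma chordsCross_outer_iff {i j : Fin n} {x y u v : ℝ} (hx : x ∈ L.strand i) (hy : y ∈ L.strand j)
    (hu : u ∈ Ico L.base (L.base + 1)) (hv : v ∈ Ico L.base (L.base + 1)) (hus : u ∉ L.strands)
    (hvs : v ∉ L.strands) :
    ChordsCross s((x : UnitAddCircle), (y : UnitAddCircle))
      s((u : UnitAddCircle), (v : UnitAddCircle)) ↔
        ¬ ((L.a i < u ↔ L.a i < v) ↔ (L.a j < u ↔ L.a j < v)) := by
  have hi : L.a i ∈ L.strand i := ⟨le_rfl, (L.a_lt_b i).le⟩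
  have hj : L.a j ∈ L.strand j := ⟨le_rfl, (L.a_lt_b j).le⟩
  rw [chordsCross_coe_iff (L.mem_Ico_of_mem_strand hx) (L.mem_Ico_of_mem_strand hy) hu hv,
    alternate_iff (L.ne_of_notMem hx hus) (L.ne_of_notMem hy hus) (L.ne_of_notMem hx hvs)
      (L.ne_of_notMem hy hvs), L.lt_iff_of_notMem hx hi hus, L.lt_iff_of_notMem hx hi hvs,
    L.lt_iff_of_notMem hy hj hus, L.lt_iff_of_notMem hy hj hvs]

end LocalReplacement

open LocalReplacement

theorem LocalRI.numbers {P P' : KnotProjection} (h : LocalRI P P') :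
    P'.crossNumber - P.crossNumber = 0 ∧ P'.tripleNumber - P.tripleNumber = 0 ∧
      P'.hNumber - P.hNumber = 0 ∧ P'.iiiNumber - P.iiiNumber = 0 := by
  classical
  obtain ⟨L, hPc, s, t, hPc'⟩ := h
  obtain ⟨V, hV, hP, hP'⟩ := L.exists_outer_finset
  obtain ⟨s', hs, t', ht, -, -, he⟩ : s(s, t) ∈ P'.crossingsIn L.strands := by rw [hPc']; rfl
  rw [he] at hPc'
  have h0 : ∀ x ∈ L.strands, x ∈ L.strand 0 := by
    intro x hx
    obtain ⟨i, hi⟩ := L.mem_strands.1 hx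
    rwa [Subsingleton.elim i 0] at hi
  have hs0 := h0 _ hs
  have ht0 := h0 _ ht
  refine numbers_eq_of_isolated (L.not_mem_of_strand hV hs0 t') ?_ (by rw [hP, hPc]; simp)
    (by rw [hP', hPc']; simp)
  intro d hd
  obtain ⟨u, hu, v, hv, hus, hvs, rfl⟩ := hV d hd
  rw [L.chordsCross_outer_iff hs0 ht0 hu hv hus hvs]
  simp

/-- A second Reidemeister move adds two chords that cross the same old chords. They cross each other
if and only if the two strands meet the double points in the same order. -/
lemma LocalRII.exists_twin_chords {order : ℝ → ℝ → Prop} {P P' : KnotProjection}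
    (h : LocalRII order P P') :
    ∃ (V : Finset (Sym2 UnitAddCircle)) (c₁ c₂ : Sym2 UnitAddCircle) (t₁ t₂ : ℝ), c₁ ≠ c₂ ∧
      c₁ ∉ V ∧ c₂ ∉ V ∧ (∀ d ∈ V, ChordsCross c₁ d ↔ ChordsCross c₂ d) ∧
      P.chords = (V : Set (Sym2 UnitAddCircle)) ∧
      P'.chords = (V : Set (Sym2 UnitAddCircle)) ∪ {c₁, c₂} ∧ order t₁ t₂ ∧
      (t₁ < t₂ → ChordsCross c₁ c₂) ∧
      (t₂ < t₁ → ¬ ChordsCross c₁ c₂) := by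
  obtain ⟨L, hPc, s₁, hs₁, s₂, hs₂, t₁, ht₁, t₂, ht₂, hPc', hs, hord⟩ := h
  obtain ⟨V, hV, hP, hP'⟩ := L.exists_outer_finset
  have is₁ := L.mem_Ico_of_mem_strand hs₁
  have is₂ := L.mem_Ico_of_mem_strand hs₂
  have it₁ := L.mem_Ico_of_mem_strand ht₁
  have it₂ := L.mem_Ico_of_mem_strand ht₂
  have h01 : (0 : Fin 2) ≠ 1 := by decide
  have n12 := L.ne_of_strand h01 hs₁ ht₂
  have n21 := L.ne_of_strand h01 hs₂ ht₁
  have hcross : t₁ ≠ t₂ → (ChordsCross s((s₁ : UnitAddCircle), (t₁ : UnitAddCircle))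
      s((s₂ : UnitAddCircle), (t₂ : UnitAddCircle)) ↔ t₁ < t₂) := by
    intro ht
    have k1 := L.lt_iff_of_strand h01 hs₁ ht₂
    have k2 := L.lt_iff_of_strand h01.symm ht₁ hs₂
    have k3 := L.lt_iff_of_strand h01 hs₁ ht₁
    rw [chordsCross_coe_iff is₁ it₁ is₂ it₂, alternate_iff hs.ne' n21 n12.symm ht.symm, k1, k2]
    have k4 : L.a 1 < L.a 0 ↔ ¬ L.a 0 < L.a 1 := by
      have : L.a 0 ≠ L.a 1 := L.ne_of_strand h01 ⟨le_rfl, (L.a_lt_b 0).le⟩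
        ⟨le_rfl, (L.a_lt_b 1).le⟩
      grind
    rw [k4]
    tauto
  refine ⟨V, s(s₁, t₁), s(s₂, t₂), t₁, t₂, ?_, L.not_mem_of_strand hV hs₁ _,
    L.not_mem_of_strand hV hs₂ _, ?_, by rw [hP, hPc]; simp, ?_, hord, ?_, ?_⟩
  · intro h
    rcases Sym2.eq_iff.1 h with ⟨h1, -⟩ | ⟨h1, -⟩
    · exact hs.ne ((coe_inj_of_mem_Ico is₁ is₂).1 h1)
    · exact n12 ((coe_inj_of_mem_Ico is₁ it₂).1 h1)
  · intro d hd
    obtain ⟨u, hu, v, hv, hus, hvs, rfl⟩ := hV d hd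
    rw [L.chordsCross_outer_iff hs₁ ht₁ hu hv hus hvs,
      L.chordsCross_outer_iff hs₂ ht₂ hu hv hus hvs]
  · rw [hP', hPc', image_pair]; rfl
  · exact fun h => (hcross h.ne).2 h
  · exact fun h h' => lt_asymm h ((hcross h.ne').1 h')

theorem LocalRII.numbers_strong {P P' : KnotProjection}
    (h : LocalRII (fun t₁ t₂ => t₂ < t₁) P P') :
    (∃ m : ℤ, 0 ≤ m ∧ P'.crossNumber - P.crossNumber = 4 * m) ∧
      Even (P'.tripleNumber - P.tripleNumber) ∧ Even (P'.hNumber - P.hNumber) ∧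
      Even (P'.iiiNumber - P.iiiNumber) := by
  classical
  obtain ⟨V, c₁, c₂, t₁, t₂, hc, h1, h2, hd, hP, hP', hord, -, hno⟩ := h.exists_twin_chords
  exact (numbers_of_twins hc (by simp [h1, h2]) hd hP (by rw [hP']; simp)).1 (hno hord)

theorem LocalRII.numbers_weak {P P' : KnotProjection}
    (h : LocalRII (fun t₁ t₂ => t₁ < t₂) P P') :
    (∃ m : ℤ, 1 ≤ m ∧ P'.crossNumber - P.crossNumber = 4 * m - 1) ∧
      Odd (P'.tripleNumber - P.tripleNumber) ∧ Even (P'.hNumber - P.hNumber) ∧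
      Even (P'.iiiNumber - P.iiiNumber) := by
  classical
  obtain ⟨V, c₁, c₂, t₁, t₂, hc, h1, h2, hd, hP, hP', hord, hyes, -⟩ := h.exists_twin_chords
  exact (numbers_of_twins hc (by simp [h1, h2]) hd hP (by rw [hP']; simp)).2 (hyes hord)

lemma image_range_fin_three {X Y : Type*} (f : X → Y) (g : Fin 3 → X) :
    f '' Set.range g = {f (g 0), f (g 1), f (g 2)} := by
  ext z
  simp [Fin.exists_fin_succ, eq_comm]

/-- Whether two chords of a triangle cross depends on the order of the three strands along the curve
and on the order of the two double points on the strand that the chords have in common. -/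
lemma LocalReplacement.chordsCross_triangle_iff {P P' : KnotProjection}
    (L : LocalReplacement 3 P P') {x y : Fin 3 → ℝ} (hx : ∀ i, x i ∈ L.strand i)
    (hy : ∀ i, y i ∈ L.strand i) (hxy : ∀ i, x i ≠ y i) {i j k : Fin 3} (hij : i ≠ j) (hik : i ≠ k)
    (hjk : j ≠ k) :
    ChordsCross s((x i : UnitAddCircle), (y j : UnitAddCircle))
      s((x j : UnitAddCircle), (y k : UnitAddCircle)) ↔
        ¬ ((L.a i < L.a j ↔ L.a i < L.a k) ↔ (y j < x j ↔ L.a j < L.a k)) := by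
  rw [chordsCross_coe_iff (L.mem_Ico_of_mem_strand (hx i)) (L.mem_Ico_of_mem_strand (hy j))
    (L.mem_Ico_of_mem_strand (hx j)) (L.mem_Ico_of_mem_strand (hy k)),
    alternate_iff (L.ne_of_strand hij.symm (hx j) (hx i)) (hxy j)
      (L.ne_of_strand hik.symm (hy k) (hx i)) (L.ne_of_strand hjk.symm (hy k) (hy j)),
    L.lt_iff_of_strand hij (hx i) (hx j), L.lt_iff_of_strand hik (hx i) (hy k),
    L.lt_iff_of_strand hjk (hy j) (hy k)]

lemma LocalReplacement.triangle_ne {P P' : KnotProjection}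
    (L : LocalReplacement 3 P P') {x y : Fin 3 → ℝ} (hx : ∀ i, x i ∈ L.strand i)
    (hy : ∀ i, y i ∈ L.strand i) {i j k : Fin 3} (hij : i ≠ j) (hik : i ≠ k) :
    s((x i : UnitAddCircle), (y j : UnitAddCircle)) ≠
      s((x j : UnitAddCircle), (y k : UnitAddCircle)) := by
  intro h
  rcases Sym2.eq_iff.1 h with ⟨h1, -⟩ | ⟨h1, -⟩
  · exact L.ne_of_strand hij (hx i) (hx j) ((coe_inj_of_mem_Ico (L.mem_Ico_of_mem_strand (hx i))
      (L.mem_Ico_of_mem_strand (hx j))).1 h1)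
  · exact L.ne_of_strand hik (hx i) (hy k) ((coe_inj_of_mem_Ico (L.mem_Ico_of_mem_strand (hx i))
      (L.mem_Ico_of_mem_strand (hy k))).1 h1)

theorem LocalRIII.numbers {coherent : Prop} {P P' : KnotProjection}
    (h : LocalRIII coherent P P') :
    (coherent → (P'.crossNumber - P.crossNumber = 3 ∨ P'.crossNumber - P.crossNumber = -3) ∧
      Odd (P'.tripleNumber - P.tripleNumber) ∧ Even (P'.hNumber - P.hNumber) ∧
      Even (P'.iiiNumber - P.iiiNumber)) ∧
    (¬ coherent → (P'.crossNumber - P.crossNumber = 1 ∨ P'.crossNumber - P.crossNumber = -1) ∧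
      Odd (P'.tripleNumber - P.tripleNumber) ∧ Even (P'.hNumber - P.hNumber) ∧
      Even (P'.iiiNumber - P.iiiNumber)) := by
  classical
  obtain ⟨L, x, y, x', y', hmem, hPc, hPc', hord, hcoh⟩ := h
  obtain ⟨V, hV, hP, hP'⟩ := L.exists_outer_finset
  have hx := fun i => (hmem i).1
  have hy := fun i => (hmem i).2.1
  have hx' := fun i => (hmem i).2.2.1
  have hy' := fun i => (hmem i).2.2.2
  have hxy : ∀ i, x i ≠ y i := fun i => by
    rcases hord i with h | h <;> [exact h.1.ne; exact h.1.ne']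
  have hxy' : ∀ i, x' i ≠ y' i := fun i => by
    rcases hord i with h | h <;> [exact h.2.ne'; exact h.2.ne]
  have hflip : ∀ i, y' i < x' i ↔ ¬ y i < x i := fun i => by
    rcases hord i with h | h
    · exact iff_of_true h.2 h.1.not_gt
    · exact iff_of_false h.2.not_gt (not_not.2 h.1)
  have hlt : ∀ i, x i < y i ↔ ¬ y i < x i := fun i => by
    rcases hord i with h | h
    · exact iff_of_true h.1 h.1.not_gt
    · exact iff_of_false h.1.not_gt (not_not.2 h.1)
  have n01 : (0 : Fin 3) ≠ 1 := by decide
  have n02 : (0 : Fin 3) ≠ 2 := by decide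
  have n12 : (1 : Fin 3) ≠ 2 := by decide
  have hao : ∀ i j : Fin 3, i ≠ j → (L.a j < L.a i ↔ ¬ L.a i < L.a j) := fun i j hij => by
    have : L.a i ≠ L.a j := L.ne_of_strand hij ⟨le_rfl, (L.a_lt_b i).le⟩ ⟨le_rfl, (L.a_lt_b j).le⟩
    rw [not_lt]
    exact ⟨le_of_lt, fun h => lt_of_le_of_ne h this.symm⟩
  have a10 := hao 0 1 n01
  have a20 := hao 0 2 n02
  have a21 := hao 1 2 n12
  -- crossings among the three chords of the triangle
  have x01 := L.chordsCross_triangle_iff hx hy hxy n01 n02 n12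
  have x12 := L.chordsCross_triangle_iff hx hy hxy n12 n01.symm n02.symm
  have x20 := L.chordsCross_triangle_iff hx hy hxy n02.symm n12.symm n01
  have x01' := L.chordsCross_triangle_iff hx' hy' hxy' n01 n02 n12
  have x12' := L.chordsCross_triangle_iff hx' hy' hxy' n12 n01.symm n02.symm
  have x20' := L.chordsCross_triangle_iff hx' hy' hxy' n02.symm n12.symm n01
  rw [chordsCross_comm] at x20 x20'
  rw [hflip] at x01' x12' x20'
  have hcoh' : coherent ↔ ((y 1 < x 1 ↔ y 0 < x 0) ∧ (y 1 < x 1 ↔ y 2 < x 2)) := by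
    have hall : ∀ p : Fin 3 → Prop, (∀ i, p i) ↔ p 0 ∧ p 1 ∧ p 2 := fun p =>
      ⟨fun h => ⟨h 0, h 1, h 2⟩, fun ⟨h0, h1, h2⟩ i => by fin_cases i <;> assumption⟩
    rw [← hcoh, hall, hall, hlt, hlt, hlt]
    clear * -
    tauto
  have key := numbers_of_triangle_flip (P := P) (P' := P') (V := V)
    (L.triangle_ne hx hy n01 n02) (L.triangle_ne hx hy n02.symm n12.symm).symm
    (L.triangle_ne hx hy n12 n01.symm)
    (L.triangle_ne hx' hy' n01 n02) (L.triangle_ne hx' hy' n02.symm n12.symm).symm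
    (L.triangle_ne hx' hy' n12 n01.symm)
    (by simp [L.not_mem_of_strand hV (hx _)])
    (by simp [L.not_mem_of_strand hV (hx' _)])
    (by
      intro d hd
      obtain ⟨u, hu, v, hv, hus, hvs, rfl⟩ := hV d hd
      rw [L.chordsCross_outer_iff (hx _) (hy _) hu hv hus hvs,
        L.chordsCross_outer_iff (hx _) (hy _) hu hv hus hvs,
        L.chordsCross_outer_iff (hx _) (hy _) hu hv hus hvs]
      clear * -
      tauto)
    (by
      intro d hd
      obtain ⟨u, hu, v, hv, hus, hvs, rfl⟩ := hV d hd
      rw [L.chordsCross_outer_iff (hx _) (hy _) hu hv hus hvs,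
        L.chordsCross_outer_iff (hx' _) (hy' _) hu hv hus hvs])
    (by
      intro d hd
      obtain ⟨u, hu, v, hv, hus, hvs, rfl⟩ := hV d hd
      rw [L.chordsCross_outer_iff (hx _) (hy _) hu hv hus hvs,
        L.chordsCross_outer_iff (hx' _) (hy' _) hu hv hus hvs])
    (by
      intro d hd
      obtain ⟨u, hu, v, hv, hus, hvs, rfl⟩ := hV d hd
      rw [L.chordsCross_outer_iff (hx _) (hy _) hu hv hus hvs,
        L.chordsCross_outer_iff (hx' _) (hy' _) hu hv hus hvs])
    (by rw [x01, x01']; clear * -; tauto)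
    (by rw [x20, x20']; clear * -; tauto)
    (by rw [x12, x12']; clear * -; tauto)
    (by rw [hP, hPc, image_range_fin_three]; simp)
    (by rw [hP', hPc', image_range_fin_three]; simp)
  have hall : ((ChordsCross s((x 0 : UnitAddCircle), (y 1 : UnitAddCircle))
      s((x 1 : UnitAddCircle), (y 2 : UnitAddCircle)) ↔
      ChordsCross s((x 0 : UnitAddCircle), (y 1 : UnitAddCircle))
      s((x 2 : UnitAddCircle), (y 0 : UnitAddCircle))) ∧
      (ChordsCross s((x 0 : UnitAddCircle), (y 1 : UnitAddCircle))
      s((x 1 : UnitAddCircle), (y 2 : UnitAddCircle)) ↔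
      ChordsCross s((x 1 : UnitAddCircle), (y 2 : UnitAddCircle))
      s((x 2 : UnitAddCircle), (y 0 : UnitAddCircle)))) ↔ coherent := by
    rw [x01, x12, x20, hcoh', a10, a20, a21]
    by_cases h0 : L.a 0 < L.a 1 <;> by_cases h1 : L.a 0 < L.a 2 <;>
      by_cases h2 : L.a 1 < L.a 2 <;> simp only [h0, h1, h2, not_true, not_false_eq_true, iff_true,
        true_iff, iff_false, false_iff, not_not, not_iff_not]
  rwa [hall] at key

end KnotProjection

end

/-! ### Reidemeister moves up to equivalence -/

theorem mainTheorem3 (P P' : KnotProjection) :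
    (KnotProjection.RI P P' →
      P'.crossNumber - P.crossNumber = 0 ∧
      P'.tripleNumber - P.tripleNumber = 0 ∧
      P'.hNumber - P.hNumber = 0 ∧
      P'.iiiNumber - P.iiiNumber = 0) ∧
    (KnotProjection.StrongRII P P' →
      (∃ m : ℤ, 0 ≤ m ∧ P'.crossNumber - P.crossNumber = 4 * m) ∧
      Even (P'.tripleNumber - P.tripleNumber) ∧
      Even (P'.hNumber - P.hNumber) ∧
      Even (P'.iiiNumber - P.iiiNumber)) ∧
    (KnotProjection.WeakRII P P' →
      (∃ m : ℤ, 1 ≤ m ∧ P'.crossNumber - P.crossNumber = 4 * m - 1) ∧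
      Odd (P'.tripleNumber - P.tripleNumber) ∧
      Even (P'.hNumber - P.hNumber) ∧
      Even (P'.iiiNumber - P.iiiNumber)) ∧
    (KnotProjection.StrongRIII P P' →
      (P'.crossNumber - P.crossNumber = 3 ∨ P'.crossNumber - P.crossNumber = -3) ∧
      Odd (P'.tripleNumber - P.tripleNumber) ∧
      Even (P'.hNumber - P.hNumber) ∧
      Even (P'.iiiNumber - P.iiiNumber)) ∧
    (KnotProjection.WeakRIII P P' →
      (P'.crossNumber - P.crossNumber = 1 ∨ P'.crossNumber - P.crossNumber = -1) ∧
      Odd (P'.tripleNumber - P.tripleNumber) ∧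
      Even (P'.hNumber - P.hNumber) ∧
      Even (P'.iiiNumber - P.iiiNumber)) := by
  have transfer : ∀ {move : KnotProjection → KnotProjection → Prop}
      {concl : ℤ → ℤ → ℤ → ℤ → Prop},
      (∀ {Q Q' : KnotProjection}, move Q Q' → concl (Q'.crossNumber - Q.crossNumber)
        (Q'.tripleNumber - Q.tripleNumber) (Q'.hNumber - Q.hNumber)
        (Q'.iiiNumber - Q.iiiNumber)) →
      KnotProjection.UpToEquivalence move P P' → concl (P'.crossNumber - P.crossNumber)
        (P'.tripleNumber - P.tripleNumber) (P'.hNumber - P.hNumber)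
        (P'.iiiNumber - P.iiiNumber) := by
    rintro move concl h ⟨Q, Q', hQ, hQ', hmove⟩
    obtain ⟨e1, e2, e3, e4⟩ := hQ.numbers_eq
    obtain ⟨f1, f2, f3, f4⟩ := hQ'.numbers_eq
    rw [← e1, ← e2, ← e3, ← e4, ← f1, ← f2, ← f3, ← f4]
    exact h hmove
  refine ⟨?_, ?_, ?_, ?_, ?_⟩
  · exact transfer (concl := fun x y z w => x = 0 ∧ y = 0 ∧ z = 0 ∧ w = 0)
      fun h => h.numbers
  · exact transfer (concl := fun x y z w => (∃ m : ℤ, 0 ≤ m ∧ x = 4 * m) ∧ Even y ∧ Even z ∧ Even w)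
      fun h => h.numbers_strong
  · exact transfer
      (concl := fun x y z w => (∃ m : ℤ, 1 ≤ m ∧ x = 4 * m - 1) ∧ Odd y ∧ Even z ∧ Even w)
      fun h => h.numbers_weak
  · exact transfer (concl := fun x y z w => (x = 3 ∨ x = -3) ∧ Odd y ∧ Even z ∧ Even w)
      fun h => h.numbers.1 trivial
  · exact transfer (concl := fun x y z w => (x = 1 ∨ x = -1) ∧ Odd y ∧ Even z ∧ Even w)
      fun h => h.numbers.2 not_false
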